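/- **Setting.** Let $\phi=(c_1,\dots,c_m)$, $m\ge 1$, be a 3-SAT formula in $n\ge 3$ variables $b_1,\dots,b_n$ (each clause has at most three literals, on distinct variables), and let $\theta\in(0,\pi/2]$. Put $R_Y(\alpha)=\begin{pmatrix}\cos(\alpha/2)&-\sin(\alpha/2)\\ \sin(\alpha/2)&\cos(\alpha/2)\end{pmatrix}$, encode TRUE by $R_Y(\theta)|+\rangle$ and FALSE by $R_Y(-\theta)|+\rangle$, and let $P_i(\theta)$ be the tensor product of the projectors onto $R_Y(\pi+\theta)|+\rangle$ for each positive literal of $c_i$, onto $R_Y(\pi-\theta)|+\rangle$ for each negative literal, and of the identity on all other qubits. Let $C_i=\mathbb I-P_i$, and $H=\sum_iP_i$. The spectral gap of an operator is the difference of its two lowest distinct eigenvalues, and the uniform gap $\Delta_{\mathrm{uni}}$ is the minimum of the spectral gaps of $\sum_{i\in I}P_i(\theta)$ over all nonempty $I\subseteq\{1,\dots,m\}$. Let $g\ge 1$ be an integer such that each $P_i(\theta)$ fails to commute with at most $g$ others. **Cycles.** An $(N,n,3)$-perfect hash family is a family of $N$ functions $\{1,\dots,n\}\to\{1,2,3\}$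 such that each 3-subset of $\{1,\dots,n\}$ is mapped injectively by one of them. Fix one with $N\le K\ln n$. Composing its members with all maps $\{1,2,3\}\to\{0,1\}$ gives $8N$ bit strings. Each clause is put into the layer of the first string that has a 1 at its positive and a 0 at its negative literals. A layer is measured by the one projective measurement $\{Q,\mathbb I-Q\}$, where $Q$ is the product of the (commuting) $C_i$ in it. A cycle measures all layers in order; $T_{\mathrm c}$ is the product of their $Q$'s, and $\mu=\|T_{\mathrm c}-\mathcal P_{\mathrm{GS}}\|$ with $\mathcal P_{\mathrm{GS}}$ the projector onto $\ker H$; this is the least $\mu$ with $\|T_{\mathrm c}^r-\mathcal P_{\mathrm{GS}}\|\le\mu^r$ for all $r\ge1$. **State preparation with tolerance $\epsilon$.** Start in $|+\rangle^{\otimes n}$ and measure $r^*=\max\{1,\lceil \ln((\epsilon\cos^n(\theta/2))^{-1})/\ln(\mu^{-1})\rceil\}$ cycles; restart whenever a check fails, until all checks of an attempt have passed ($q=1$). In the amplitude-amplified version ($q=2$) one attempt is: run the $r^*$ cycles with each measurement deferred to an auxiliary qubit, apply $j$ amplitude amplification iterates, $j$ uniform in $\{0,\dots,\lceil(2/(1+\cos\theta))^{n/2}\rceil\}$,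 and measure whether all checks passed; restart if not. **Readout with parameter $\delta'$.** *Unique solution:* with $\epsilon=\frac18(1-\frac1{\sqrt2})^2\sin^2\theta$, measure $\lceil 2\ln(n/\delta')/\ln\frac{2}{1+\cos^2\theta}\rceil$ prepared copies in the computational basis and take the majority vote on each qubit. *Multiple solutions:* with $\epsilon=\frac18\sin^2\theta$, measure the first qubit of $\lceil 8\ln(2n/\delta')/\sin^2\theta\rceil$ copies; let $p$ be the average outcome ($+1$ for $|1\rangle$, $-1$ for $|0\rangle$); set the first variable to FALSE if $|p+\sin\theta|\le|p-\sin\theta|$ and to TRUE otherwise; delete the clauses this satisfies, delete the falsified literals from the others, drop the variable (also from the bit strings), and continue with the resulting formula in one variable less until all variables are fixed (the number of copies per variable stays the same). **Runtime.** The runtime is the number of measurements; a layer check and the readout measurement of a copy count one each. In the amplified version each coherent layer check (those inside the iterates and their inverses included), each of the two reflections per iterate, and each final measurement of the auxiliary qubits count one. **Theorem (overall time complexity as a function of the uniform gap).** There is a constant $K$ such that for all $n\ge3$ an $(N,n,3)$-perfect hash family with $N\le K\ln n$ exists. Let $K$ be any constant, let any such families be used, let $\phi$ be satisfiable and $0<\delta\le\frac12$,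 and run the algorithm with readout parameter $\delta'=\delta/2$. Then, with joint failure probability of state preparation and readout at most $\delta$, it returns a satisfying assignment of $\phi$ within time $$T\le C\,\ln(n)\,\frac{\ln\left(\frac1{1-\cos^2\theta}\right)+n\ln\left(\frac1{\cos(\theta/2)}\right)}{\Delta_{\mathrm{uni}}/(4g^2)}\,\ln(\delta^{-1})\left(\frac2{1+\cos\theta}\right)^{n/q}t(\theta,n,\delta),$$ where $q=1$ by default and $q=2$ for the amplitude-amplified version, as follows. 1. With the multiple solution readout, $t(\theta,n,\delta)=\dfrac{\ln(n/\delta)}{\sin^2\theta}$. For each $\theta_0>0$ the constant $C$ can be chosen to depend on $K$ and $\theta_0$ only, uniformly in $\theta\in[\theta_0,\pi/2]$, $n$, $\phi$, $g$, $\delta$, $q$ and the hash family. 2. If $\phi$ has exactly one satisfying assignment, then with the unique solution readout, $t(\theta,n,\delta)=\dfrac{\ln(n/\delta)}{\ln\left(\frac{2}{1+\cos^2\theta}\right)}$, and $C$ depends on $K$ only, uniformly also in $\theta\in(0,\pi/2]$. -/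

import Mathlib

open scoped ENNReal Kronecker

noncomputable section

namespace QSat

/-! ## SAT formulas -/

/-- A truth value assignment, equivalently a computational basis label of `n` qubits. -/
abbrev Assignment (n : ℕ) := Fin n → Bool

/-- A clause: `some true` at `i` is the literal `b_i`, `some false` is the literal `¬ b_i`, and
`none` means that the variable `b_i` does not occur. -/
abbrev Clause (n : ℕ) := Fin n → Option Bool

/-- A formula in conjunctive normal form: the list of its clauses. -/
abbrev Formula (n : ℕ) := List (Clause n)

/-- `x` satisfies every clause of `φ`. -/
def Sat {n : ℕ} (φ : Formula n) (x : Assignment n) : Prop :=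
  ∀ c ∈ φ, ∃ i, c i = some (x i)

/-- Every clause has at most `k` literals. -/
def IsKSat {n : ℕ} (k : ℕ) (φ : Formula n) : Prop :=
  ∀ c ∈ φ, (Finset.univ.filter fun i => (c i).isSome).card ≤ k

/-- Fix the first variable to `v`: satisfied clauses are discarded, falsified literals are
deleted, and the first variable is dropped. -/
def Formula.assign {n : ℕ} (φ : Formula (n + 1)) (v : Bool) : Formula n :=
  φ.filterMap fun c => if c 0 = some v then none else some fun i => c i.succ

/-! ## Kets, rotated encoding, clause projectors, Hamiltonian -/

/-- Vectors of the Hilbert space with orthonormal basis `ι`. -/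
abbrev Ket (ι : Type) [Fintype ι] := EuclideanSpace ℂ ι

/-- Operators, as matrices in the computational basis. -/
abbrev Op (ι : Type) := Matrix ι ι ℂ

/-- The operator `A` as a continuous linear map. -/
def act {ι : Type} [Fintype ι] [DecidableEq ι] (A : Op ι) : Ket ι →L[ℂ] Ket ι :=
  Matrix.toEuclideanCLM (𝕜 := ℂ) A

/-- The rank-one operator `|u⟩⟨u|`. -/
def ketbra {ι : Type} (u : ι → ℂ) : Op ι := Matrix.vecMulVec u (star u)

/-- The rotation about the `Y` axis; `false` labels `|0⟩` and `true` labels `|1⟩`. -/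
def rotY (θ : ℝ) : Matrix Bool Bool ℂ := Matrix.of fun a b =>
  match a, b with
  | false, false => ((Real.cos (θ / 2) : ℝ) : ℂ)
  | false, true => ((-Real.sin (θ / 2) : ℝ) : ℂ)
  | true, false => ((Real.sin (θ / 2) : ℝ) : ℂ)
  | true, true => ((Real.cos (θ / 2) : ℝ) : ℂ)

/-- The one-qubit vector `|+⟩`. -/
def plusQubit : Bool → ℂ := fun _ => ((1 / Real.sqrt 2 : ℝ) : ℂ)

/-- `1` for `TRUE` and `-1` for `FALSE`. -/
def sgn (s : Bool) : ℝ := if s then 1 else -1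

/-- The vector `R_Y(π ± θ)|+⟩`, orthogonal to the encoding `R_Y(± θ)|+⟩` of the value `s`. -/
def perpQubit (θ : ℝ) (s : Bool) : Bool → ℂ :=
  (rotY (Real.pi + sgn s * θ)).mulVec plusQubit

/-- The clause projector `P(θ)`: the tensor product of `|s^⊥⟩⟨s^⊥|` over the literals of the
clause and of the identity over all other qubits. -/
def clauseProj {n : ℕ} (θ : ℝ) (c : Clause n) : Op (Assignment n) := Matrix.of fun x y =>
  ∏ i, (match c i with
    | none => (1 : Matrix Bool Bool ℂ)
    | some s => ketbra (perpQubit θ s)) (x i) (y i)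

/-- `H(θ) = ∑ P_i(θ)`. -/
def hamiltonian {n : ℕ} (θ : ℝ) (φ : Formula n) : Op (Assignment n) :=
  (φ.map (clauseProj θ)).sum

/-- The real eigenvalues of an operator. -/
def eigenvalues {ι : Type} [Fintype ι] [DecidableEq ι] (A : Op ι) : Set ℝ :=
  {e | Module.End.HasEigenvalue (Matrix.toLin' A) (e : ℂ)}

/-- The spectral gap: the distance from the lowest eigenvalue to the next larger one. -/
def spectralGap {ι : Type} [Fintype ι] [DecidableEq ι] (A : Op ι) : ℝ :=
  sInf {d | 0 < d ∧ ∃ e₀, IsLeast (eigenvalues A) e₀ ∧ e₀ + d ∈ eigenvalues A}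

/-- The uniform spectral gap: the least spectral gap of `∑_{i ∈ I} P_i(θ)` over the nonempty
sets `I` of (indices of) clauses. -/
def uniformGap {n : ℕ} (θ : ℝ) (φ : Formula n) : ℝ :=
  ⨅ I : {I : Finset (Fin φ.length) // I.Nonempty},
    spectralGap (∑ i ∈ I.1, clauseProj θ (φ.get i))

/-- No clause projector fails to commute with more than `g` of the others. -/
def NoncommBound {n : ℕ} (θ : ℝ) (φ : Formula n) (g : ℕ) : Prop :=
  ∀ i : Fin φ.length,
    {j : Fin φ.length | j ≠ i ∧
      ¬ Commute (clauseProj θ (φ.get i)) (clauseProj θ (φ.get j))}.ncard ≤ g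

/-! ## Grouping the clause checks into layers -/

/-- `F` is an `(N, n, k)`-perfect hash family. -/
def IsPerfectHashFamily {N n k : ℕ} (F : Fin N → Fin n → Fin k) : Prop :=
  ∀ S : Finset (Fin n), S.card = k → ∃ i, Set.InjOn (F i) (S : Set (Fin n))

/-- All bit strings obtained from the members of a hash family by giving each of the `k` symbols
a bit. -/
def layerStrings {N n k : ℕ} (F : Fin N → Fin n → Fin k) : List (Assignment n) :=
  (List.finRange N).flatMap fun i =>
    (Finset.univ : Finset (Fin k → Bool)).toList.map fun s => s ∘ F i

/-- The clause agrees with the bit string `b` wherever a variable occurs. -/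
def compatible {n : ℕ} (b : Assignment n) (c : Clause n) : Bool :=
  decide (∀ i, c i = none ∨ c i = some (b i))

/-- Sort each clause into the first layer with which it is compatible. -/
def layers {n : ℕ} : List (Assignment n) → Formula n → List (Formula n)
  | [], _ => []
  | b :: B, φ => φ.filter (compatible b) :: layers B (φ.filter fun c => !compatible b c)

/-- The passing projector `∏ C_i(θ)`, `C_i(θ) = 1 - P_i(θ)`, of the clauses of one layer. -/
def layerCheck {n : ℕ} (θ : ℝ) (l : Formula n) : Op (Assignment n) :=
  (l.map fun c => 1 - clauseProj θ c).prod

/-- The checks of one cycle, in the order in which they are measured. -/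
def cycleChecks {n : ℕ} (θ : ℝ) (B : List (Assignment n)) (φ : Formula n) :
    List (Op (Assignment n)) :=
  (layers B φ).map (layerCheck θ)

/-- The operator applied by one fully passed cycle (the first check acts first). -/
def cycleOp {n : ℕ} (θ : ℝ) (B : List (Assignment n)) (φ : Formula n) : Op (Assignment n) :=
  (cycleChecks θ B φ).reverse.prod

/-- The space of zero-energy states of `H(θ)`. -/
def groundSpace {n : ℕ} (θ : ℝ) (φ : Formula n) : Submodule ℂ (Ket (Assignment n)) :=
  LinearMap.ker (act (hamiltonian θ φ) : Ket (Assignment n) →ₗ[ℂ] Ket (Assignment n))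

/-- The speed of convergence `μ`: the least number with `‖T ^ r - P_GS‖ ≤ μ ^ r` for all `r ≥ 1`,
where `T` is the operator of one cycle. As `T` is the identity on the ground space and preserves its
orthogonal complement,
`T ^ r - P_GS = (T - P_GS) ^ r`, so this least number is `‖T - P_GS‖`. -/
def rate {n : ℕ} (θ : ℝ) (B : List (Assignment n)) (φ : Formula n) : ℝ :=
  ‖act (cycleOp θ B φ) - (groundSpace θ φ).starProjection‖

/-- The number `r*` of cycles for tolerance `ε`. It is at least one; this only matters for
`μ = 0`, where the quotient of logarithms stands for `x / ∞ = 0`. -/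
def cycles {n : ℕ} (θ : ℝ) (B : List (Assignment n)) (φ : Formula n) (ε : ℝ) : ℕ :=
  max 1 ⌈Real.log ((ε * Real.cos (θ / 2) ^ n)⁻¹) / Real.log ((rate θ B φ)⁻¹)⌉₊

/-- All the checks of one attempt at state preparation, in order. -/
def schedule {n : ℕ} (θ : ℝ) (B : List (Assignment n)) (φ : Formula n) (ε : ℝ) :
    List (Op (Assignment n)) :=
  (List.replicate (cycles θ B φ ε) (cycleChecks θ B φ)).flatten

/-! ## Randomized computations with a budget of measurements -/

/-- A randomized computation. It is given a number of measurements that it may still make, and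
returns its result with the number of those left over, or fails when they do not suffice. -/
abbrev Alg := StateT ℕ (OptionT PMF)

/-- Stop without a result. -/
def abort {α : Type} : Alg α := fun _ => OptionT.mk (pure none)

/-- Pay for `c` operations. -/
def tick (c : ℕ) : Alg Unit := fun t => if c ≤ t then pure ((), t - c) else abort t

/-- Make a random choice, at no cost. -/
def draw {α : Type} (p : PMF α) : Alg α := fun t => OptionT.lift (p.map fun a => (a, t))

/-- The probability that `A` returns an element of `good` within `T` operations. -/
def successProb {α : Type} (A : Alg α) (T : ℕ) (good : α → Prop) : ℝ :=
  ((A T).run.toOuterMeasure {o | ∃ a t, o = some (a, t) ∧ good a}).toReal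

open Classical in
/-- The distribution with probabilities proportional to `w` (uniform if `w = 0`). Below `w` lists
the Born weights of a measurement of a unit vector, which already add up to one. -/
def sample {α : Type} [Fintype α] [Nonempty α] (w : α → ℝ) : PMF α :=
  if h : (∑' a, ENNReal.ofReal (w a)) ≠ 0 ∧ (∑' a, ENNReal.ofReal (w a)) ≠ ∞ then
    PMF.normalize (fun a => ENNReal.ofReal (w a)) h.1 h.2
  else PMF.uniformOfFintype α

/-- The normalization of a ket. -/
def normalized {ι : Type} [Fintype ι] (ψ : Ket ι) : Ket ι := ((‖ψ‖⁻¹ : ℝ) : ℂ) • ψ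

/-- Measure `{Q, 1 - Q}` with a single measurement. The post-measurement state is returned on the
outcome `Q`; on the other outcome the state is discarded. -/
def measureCheck {n : ℕ} (Q : Op (Assignment n)) (ψ : Ket (Assignment n)) :
    Alg (Option (Ket (Assignment n))) := do
  tick 1
  let pass ← draw (sample fun b : Bool => if b then ‖act Q ψ‖ ^ 2 else ‖act (1 - Q) ψ‖ ^ 2)
  return if pass then some (normalized (act Q ψ)) else none

/-! ## State preparation -/

/-- The initial state `|+⟩^{⊗ n}`. -/
def plusState (n : ℕ) : Ket (Assignment n) :=
  WithLp.toLp 2 fun x => ∏ i, plusQubit (x i)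

/-- Make the given checks one after the other; give up at the first one that fails. -/
def runChecks {n : ℕ} : List (Op (Assignment n)) → Ket (Assignment n) →
    Alg (Option (Ket (Assignment n)))
  | [], ψ => return some ψ
  | Q :: L, ψ => do
    match ← measureCheck Q ψ with
    | none => return none
    | some ψ' => runChecks L ψ'

/-- The basis of the `n` qubits together with one auxiliary qubit for each of `N` checks. -/
abbrev Reg (N n : ℕ) := Assignment N × Assignment n

/-- The bit flip of the auxiliary qubit `k`. -/
def flipAux {N : ℕ} (k : Fin N) : Op (Assignment N) := Matrix.of fun a a' =>
  if a = Function.update a' k (!a' k) then 1 else 0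

/-- The check `{Q, 1 - Q}` with deferred measurement: auxiliary qubit `k` is flipped on the
failing subspace. -/
def coherentCheck {N n : ℕ} (k : Fin N) (Q : Op (Assignment n)) : Op (Reg N n) :=
  (1 : Op (Assignment N)) ⊗ₖ Q + flipAux k ⊗ₖ (1 - Q)

/-- All checks of a schedule with deferred measurement, the first one acting first. -/
def coherentRun {n : ℕ} (L : List (Op (Assignment n))) : Op (Reg L.length n) :=
  ((List.finRange L.length).map fun k => coherentCheck k (L.get k)).reverse.prod

/-- The input `|0…0⟩ ⊗ |+…+⟩` of the deferred run. -/
def coherentInput (N n : ℕ) : Ket (Reg N n) :=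
  WithLp.toLp 2 fun p => if p.1 = (fun _ => false) then plusState n p.2 else 0

/-- The projector onto the states all of whose auxiliary qubits are `|0⟩`: all checks passed. -/
def allPassed (N n : ℕ) : Op (Reg N n) :=
  ketbra (fun a : Assignment N => if a = (fun _ => false) then 1 else 0) ⊗ₖ
    (1 : Op (Assignment n))

/-- The amplitude amplification iterate `A (2|in⟩⟨in| - 1) A† (1 - 2 Π)` for the deferred run `A`
and the projector `Π` on the event that all checks are passed. -/
def groverIterate {n : ℕ} (L : List (Op (Assignment n))) : Op (Reg L.length n) :=
  coherentRun L * ((2 : ℂ) • ketbra (coherentInput L.length n).ofLp - 1) *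
    (coherentRun L).conjTranspose * (1 - (2 : ℂ) • allPassed L.length n)

/-- Upper limit for the number of iterates: one over the guaranteed overlap, rounded up. -/
def maxIterates (θ : ℝ) (n : ℕ) : ℕ := ⌈(2 / (1 + Real.cos θ)) ^ ((n : ℝ) / 2)⌉₊

/-- The two versions of the algorithm. -/
inductive Mode
  | plain
  | amplified

/-- The exponent `q`. -/
def Mode.q : Mode → ℝ
  | .plain => 1
  | .amplified => 2

/-- One attempt at state preparation with the checks `L`. In the amplified version a number `j` of
iterates is drawn uniformly from `0, …, maxIterates`, the deferred run is followed by `j` iterates, and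
the auxiliary qubits are measured. Every coherent check (also in the two inverse or forward runs of
each iterate), each of the two reflections of an iterate, and the final measurement cost one. -/
def attempt {n : ℕ} (θ : ℝ) (L : List (Op (Assignment n))) :
    Mode → Alg (Option (Ket (Assignment n)))
  | .plain => runChecks L (plusState n)
  | .amplified => do
    let j ← draw (PMF.uniformOfFintype (Fin (maxIterates θ n + 1)))
    tick ((2 * j.val + 1) * L.length + 2 * j.val + 1)
    let Ψ : Ket (Reg L.length n) :=
      act (groverIterate L ^ j.val * coherentRun L) (coherentInput L.length n)
    let good : Op (Reg L.length n) := allPassed L.length n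
    let pass ← draw (sample fun b : Bool => if b then ‖act good Ψ‖ ^ 2 else ‖act (1 - good) Ψ‖ ^ 2)
    let out : Ket (Assignment n) := WithLp.toLp 2 fun x => Ψ (fun _ => false, x)
    return if pass then some (normalized out) else none

/-- Repeat an attempt, at most `k` times, until it succeeds. -/
def repeatUntil {α : Type} (A : Alg (Option α)) : ℕ → Alg α
  | 0 => abort
  | k + 1 => do
    match ← A with
    | some a => return a
    | none => repeatUntil A k

/-- Prepare `|ψ_out⟩` with tolerance `ε`, restarting after each failed attempt. The limit on
the number of attempts is never reached before the budget is, since an attempt that fails has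
made at least one measurement. -/
def prepare {n : ℕ} (m : Mode) (θ : ℝ) (B : List (Assignment n)) (φ : Formula n) (ε : ℝ) :
    Alg (Ket (Assignment n)) := do
  let t ← get
  repeatUntil (attempt θ (schedule θ B φ ε) m) (t + 1)

/-! ## Readout -/

/-- Measure all qubits in the computational basis (one measurement). -/
def readAll {n : ℕ} (ψ : Ket (Assignment n)) : Alg (Assignment n) := do
  tick 1
  draw (sample fun x => ‖ψ x‖ ^ 2)

/-- Measure the first qubit in the computational basis. -/
def readFirst {n : ℕ} (ψ : Ket (Assignment (n + 1))) : Alg Bool := do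
  tick 1
  draw (sample fun b => ∑ x with x 0 = b, ‖ψ x‖ ^ 2)

/-- Add up the outcomes (`+1` for `|0⟩`, `-1` for `|1⟩`) of the `Z` measurements of each qubit on
`k` copies prepared by `prep`. -/
def tally {n : ℕ} (prep : Alg (Ket (Assignment n))) : ℕ → (Fin n → ℤ) → Alg (Fin n → ℤ)
  | 0, v => return v
  | k + 1, v => do
    let ψ ← prep
    let x ← readAll ψ
    tally prep k fun i => v i + if x i then -1 else 1

/-- The solver with readout for a promised unique solution, with readout parameter `δ`. -/
def uniqueSolver {n : ℕ} (m : Mode) (θ δ : ℝ) (B : List (Assignment n)) (φ : Formula n) :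
    Alg (Assignment n) := do
  let ε : ℝ := (1 - 1 / Real.sqrt 2) ^ 2 / 8 * Real.sin θ ^ 2
  let R : ℕ := ⌈2 * Real.log (n / δ) / Real.log (2 / (1 + Real.cos θ ^ 2))⌉₊
  let v ← tally (prepare m θ B φ ε) R 0
  return fun i => if 0 < v i then false else true

/-- Add up the outcomes (`-sin θ` is the expectation for `FALSE`, so `-1` is the outcome `|0⟩` and
`+1` the outcome `|1⟩`) of measurements of the first qubit on `k` copies prepared by `prep`. -/
def tallyFirst {n : ℕ} (prep : Alg (Ket (Assignment (n + 1)))) : ℕ → ℤ → Alg ℤ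
  | 0, v => return v
  | k + 1, v => do
    let ψ ← prep
    let b ← readFirst ψ
    tallyFirst prep k (v + if b then 1 else -1)

/-- The iteration of the multiple solution readout with `r` copies for each variable: decide the
first variable, propagate it through the formula, and go on with one qubit less. -/
def multipleLoop (m : Mode) (θ ε : ℝ) (r : ℕ) :
    (n : ℕ) → List (Assignment n) → Formula n → Alg (Assignment n)
  | 0, _, _ => return Fin.elim0
  | n + 1, B, φ => do
    let v ← tallyFirst (prepare m θ B φ ε) r 0
    let p : ℝ := (v : ℝ) / r
    let s : Bool := if |p + Real.sin θ| ≤ |p - Real.sin θ| then false else true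
    let rest ← multipleLoop m θ ε r n (B.map fun b i => b i.succ) (φ.assign s)
    return Fin.cons s rest

/-- The solver with readout for possibly many solutions, with readout parameter `δ`. -/
def multipleSolver {n : ℕ} (m : Mode) (θ δ : ℝ) (B : List (Assignment n)) (φ : Formula n) :
    Alg (Assignment n) :=
  multipleLoop m θ (Real.sin θ ^ 2 / 8) ⌈8 * Real.log (2 * n / δ) / Real.sin θ ^ 2⌉₊ n B φ

/-! ## The runtime bound -/

/-- The readout cost for possibly many solutions. -/
def tMultiple (θ : ℝ) (n : ℕ) (δ : ℝ) : ℝ := Real.log (n / δ) / Real.sin θ ^ 2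

/-- The readout cost for a unique solution. -/
def tUnique (θ : ℝ) (n : ℕ) (δ : ℝ) : ℝ :=
  Real.log (n / δ) / Real.log (2 / (1 + Real.cos θ ^ 2))

/-- The runtime bound in terms of the uniform gap `Δ`, with readout cost `t`. -/
def gapBound (θ : ℝ) (n : ℕ) (Δ : ℝ) (g : ℕ) (δ q t : ℝ) : ℝ :=
  Real.log n *
    ((Real.log (1 / (1 - Real.cos θ ^ 2)) + n * Real.log (1 / Real.cos (θ / 2))) /
      (Δ / (4 * (g : ℝ) ^ 2))) *
    Real.log δ⁻¹ * (2 / (1 + Real.cos θ)) ^ ((n : ℝ) / q) * t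

end QSat

end

noncomputable section
namespace QSat

/-! ## Expected losses of randomized computations -/

/-! Everything is measured by one functional, the expected loss of a computation with a budget,
which composes along monadic binds. A loss of at most `δ` gives success probability at least `1 -
δ`, so it suffices to propagate loss bounds backwards through solver, readout and preparation.

State preparation. Encodings of solutions are unit ground states with overlap `cos(θ/2)^n` with the
initial state. Let `T` be the operator of a cycle and `χ` orthogonal to the ground space. The
detectability lemma (`sum_sq_act_passOp_le`) bounds the energy of `T χ` by `g² (‖χ‖² - ‖T χ‖²)`,
since a projection can regain weight only from components removed by projections it does not commute
with. The energy is also at least `Δ ‖T χ‖²`, hence `(1 + Δ/g²) ‖T χ‖² ≤ ‖χ‖²` and `ln(1/μ) ≥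
Δ/(4g²)`. After `r*` cycles the passed state is `ε`-close to the ground space, and all checks pass
with probability at least `cos(θ/2)^(2n) = ((1 + cos θ)/2)^n`. In the amplified version the iterates
rotate by twice the angle `α` whose sine is the norm of the passed component; averaged over the
random number of iterates the success probability is at least `1/4`.

Readout. Up to sign, the vectors orthogonal to the encodings form a dual basis, so a ground state
involves only encodings of solutions (`sin_pow_smul_eq_sum`, `inner_dualKet_eq_zero`). If all
solutions agree on a variable, its qubit factors out and has bias exactly `± sin θ`. Near the ground
space the bias keeps at least `sin θ / √2`, so each copy multiplies a suitable exponential moment by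
at most `√((1 + cos² θ)/2)`, a Chernoff bound. If the solutions disagree on a variable, either
decision is correct.

Restriction. Fixing a variable neither lowers the uniform gap nor increases noncommutativity:
prefixing one fixed qubit vector embeds the restricted system into an invariant subspace of the
original one (`GapAtLeast.assign`, `NoncommLe.assign`). The same `Δ` and `g` therefore serve all
variables. The costs per variable form a geometric sum whose ratio is bounded away from `1` only for
`θ ≥ θ₀`; this is where `C` acquires its dependence on `θ₀`.

Time. The random number of restarts is controlled by a potential `2^k (1 - p/2)^m`, with `k` copies
still to be made, time for `m` trials and success probability `p` per trial. Linearly many trials in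
`k/p`, plus a logarithm of the failure probability, suffice. -/

/-- The expected loss of a computation with budget `t`: failing to return costs `1`, and returning
`a` with `s` measurements left costs `f a s`. -/
def loss {α : Type} (A : Alg α) (t : ℕ) (f : α → ℕ → ℝ≥0∞) : ℝ≥0∞ :=
  ∑' o, (A t).run o * o.elim 1 fun q => f q.1 q.2

/-- The expectation of a bound function with respect to a monadic bind of distributions. -/
theorem tsum_bind_mul {α β : Type} (p : PMF α) (q : α → PMF β) (f : β → ℝ≥0∞) :
    ∑' b, (p.bind q) b * f b = ∑' a, p a * ∑' b, q a b * f b := by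
  simp only [PMF.bind_apply, ← ENNReal.tsum_mul_right, ← ENNReal.tsum_mul_left]
  rw [ENNReal.tsum_comm]
  simp only [mul_assoc]

theorem tsum_pure_mul {α : Type} (a : α) (f : α → ℝ≥0∞) :
    ∑' b, (PMF.pure a) b * f b = f a := by
  rw [tsum_eq_single a]
  · simp
  · intro b hb
    simp [PMF.pure_apply, hb]

@[simp] theorem loss_pure {α : Type} (a : α) (t : ℕ) (f : α → ℕ → ℝ≥0∞) :
    loss (pure a : Alg α) t f = f a t :=
  tsum_pure_mul (some (a, t)) _

@[simp] theorem loss_get (t : ℕ) (f : ℕ → ℕ → ℝ≥0∞) :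
    loss (get : Alg ℕ) t f = f t t :=
  tsum_pure_mul (some (t, t)) _

@[simp] theorem loss_tick (c t : ℕ) (f : Unit → ℕ → ℝ≥0∞) :
    loss (tick c) t f = if c ≤ t then f () (t - c) else 1 := by
  unfold loss tick
  split_ifs with h
  · exact tsum_pure_mul (some ((), t - c)) _
  · exact tsum_pure_mul none _

-- The weakest-precondition rule: the loss of the continuation, as a function of result and
-- remaining budget, is the loss function for the first stage. A failure of either stage costs `1`.
@[simp] theorem loss_bind {α β : Type} (A : Alg α) (B : α → Alg β) (t : ℕ)
    (f : β → ℕ → ℝ≥0∞) :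
    loss (A >>= B) t f = loss A t fun a s => loss (B a) s f := by
  unfold loss
  have : ((A >>= B) t).run = ((A t).run).bind fun o =>
      o.elim (PMF.pure none) fun q => (B q.1 q.2).run := by
    change PMF.bind _ _ = _
    congr 1
    funext o
    cases o <;> rfl
  rw [this, tsum_bind_mul]
  refine tsum_congr fun o => ?_
  cases o with
  | none => simp
  | some q => rfl

theorem loss_draw {α : Type} (p : PMF α) (t : ℕ) (f : α → ℕ → ℝ≥0∞) :
    loss (draw p) t f = ∑' a, p a * f a t := by
  unfold loss
  have : (draw p t).run = p.bind fun a => PMF.pure (some (a, t)) := by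
    change PMF.bind (p.map fun a => (a, t)) (fun q => PMF.pure (some q)) = _
    rw [PMF.bind_map]
    rfl
  rw [this, tsum_bind_mul]
  simp only [tsum_pure_mul, Option.elim]

theorem loss_le_one {α : Type} (A : Alg α) (t : ℕ) {f : α → ℕ → ℝ≥0∞}
    (h : ∀ a s, f a s ≤ 1) : loss A t f ≤ 1 := by
  calc loss A t f ≤ ∑' o, (A t).run o := by
        refine ENNReal.tsum_le_tsum fun o => ?_
        cases o with
        | none => simp
        | some q => exact mul_le_of_le_one_right (zero_le) (h _ _)
    _ = 1 := PMF.tsum_coe _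

/-- A bound for the loss is a bound for the probability of not returning a good result. -/
theorem le_successProb {α : Type} (A : Alg α) (T : ℕ) (good : α → Prop) [DecidablePred good]
    {δ : ℝ} (hδ : 0 ≤ δ)
    (h : loss A T (fun a _ => if good a then 0 else 1) ≤ ENNReal.ofReal δ) :
    1 - δ ≤ successProb A T good := by
  unfold successProb
  rw [PMF.toOuterMeasure_apply]
  set S := {o : Option (α × ℕ) | ∃ a t, o = some (a, t) ∧ good a}
  set s := ∑' o, S.indicator (⇑(A T).run) o
  set l := loss A T (fun a _ => if good a then 0 else 1) with hl
  have hsum : s + l = 1 := by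
    rw [← PMF.tsum_coe (A T).run, hl, loss, ← ENNReal.tsum_add]
    refine tsum_congr fun o => ?_
    cases o with
    | none =>
      have : (none : Option (α × ℕ)) ∉ S := by rintro ⟨a, t, h, -⟩; cases h
      simp [Set.indicator_of_notMem this]
    | some q =>
      by_cases hq : good q.1
      · have : some q ∈ S := ⟨q.1, q.2, rfl, hq⟩
        simp [Set.indicator_of_mem this, hq]
      · have : some q ∉ S := by
          rintro ⟨a, t, h, hg⟩
          cases h
          exact hq hg
        simp [Set.indicator_of_notMem this, hq]
  have hs : s ≠ ∞ := fun h => by simp [h] at hsum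
  have hl' : l ≠ ∞ := fun h => by simp [h] at hsum
  have h1 : s.toReal + l.toReal = 1 := by
    rw [← ENNReal.toReal_add hs hl', hsum, ENNReal.toReal_one]
  have h2 : l.toReal ≤ δ := ENNReal.toReal_le_of_le_ofReal hδ h
  linarith

theorem sample_apply {α : Type} [Fintype α] [Nonempty α] {w : α → ℝ} (h0 : ∀ a, 0 ≤ w a)
    (h1 : ∑ a, w a = 1) (a : α) : sample w a = ENNReal.ofReal (w a) := by
  have hsum : ∑' a, ENNReal.ofReal (w a) = 1 := by
    rw [tsum_fintype, ← ENNReal.ofReal_sum_of_nonneg fun a _ => h0 a, h1, ENNReal.ofReal_one]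
  unfold sample
  rw [dif_pos (by rw [hsum]; exact ⟨one_ne_zero, ENNReal.one_ne_top⟩), PMF.normalize_apply, hsum, inv_one, mul_one]

/-- The expected loss after sampling from given probabilities. -/
theorem loss_draw_sample_le {α : Type} [Fintype α] [Nonempty α] {w : α → ℝ} (h0 : ∀ a, 0 ≤ w a)
    (h1 : ∑ a, w a = 1) (t : ℕ) (f : α → ℕ → ℝ≥0∞) (x : α → ℝ)
    (hf : ∀ a, w a ≠ 0 → f a t ≤ ENNReal.ofReal (x a)) (hx : ∀ a, w a ≠ 0 → 0 ≤ x a) :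
    loss (draw (sample w)) t f ≤ ENNReal.ofReal (∑ a, w a * x a) := by
  rw [loss_draw, tsum_fintype, ENNReal.ofReal_sum_of_nonneg]
  · refine Finset.sum_le_sum fun a _ => ?_
    rw [sample_apply h0 h1]
    -- Impossible outcomes are exempt from the hypotheses: there the post-measurement state would be
    -- the normalization of the zero vector.
    by_cases ha : w a = 0
    · simp [ha]
    · rw [ENNReal.ofReal_mul (h0 a)]
      exact mul_le_mul_right (hf a ha) _
  · intro a _
    by_cases ha : w a = 0
    · simp [ha]
    · exact mul_nonneg (h0 a) (hx a ha)


/-! ## Operators -/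

section Operators

variable {ι : Type} [Fintype ι] [DecidableEq ι]

theorem act_apply (A : Op ι) (ψ : Ket ι) (x : ι) : act A ψ x = ∑ y, A x y * ψ y := by
  rfl

@[simp] theorem act_one (ψ : Ket ι) : act (1 : Op ι) ψ = ψ := by
  unfold act; rw [map_one]; rfl

@[simp] theorem act_zero (ψ : Ket ι) : act (0 : Op ι) ψ = 0 := by
  unfold act; rw [map_zero]; rfl

theorem act_mul (A B : Op ι) (ψ : Ket ι) : act (A * B) ψ = act A (act B ψ) := by
  unfold act; rw [map_mul]; rfl

theorem act_add (A B : Op ι) (ψ : Ket ι) : act (A + B) ψ = act A ψ + act B ψ := by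
  unfold act; rw [map_add]; rfl

theorem act_sub (A B : Op ι) (ψ : Ket ι) : act (A - B) ψ = act A ψ - act B ψ := by
  unfold act; rw [map_sub]; rfl

theorem act_smul (a : ℂ) (A : Op ι) (ψ : Ket ι) : act (a • A) ψ = a • act A ψ := by
  unfold act; rw [map_smul]; rfl

theorem inner_act (A : Op ι) (ψ χ : Ket ι) :
    inner ℂ (act A ψ) χ = inner ℂ ψ (act A.conjTranspose χ) := by
  have : act A.conjTranspose = ContinuousLinearMap.adjoint (act A) := by
    unfold act
    rw [← ContinuousLinearMap.star_eq_adjoint, ← map_star]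
    rfl
  rw [this, ContinuousLinearMap.adjoint_inner_right]

theorem _root_.IsStarProjection.inner_act {P : Op ι} (h : IsStarProjection P) (ψ χ : Ket ι) :
    inner ℂ (act P ψ) χ = inner ℂ ψ (act P χ) := by
  rw [QSat.inner_act]
  congr 2
  exact congrArg act h.isSelfAdjoint

theorem _root_.IsStarProjection.act_act {P : Op ι} (h : IsStarProjection P) (ψ : Ket ι) :
    act P (act P ψ) = act P ψ := by
  rw [← act_mul, h.isIdempotentElem.eq]

theorem _root_.IsStarProjection.inner_self {P : Op ι} (h : IsStarProjection P) (ψ : Ket ι) :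
    inner ℂ ψ (act P ψ) = (‖act P ψ‖ ^ 2 : ℝ) := by
  rw [← h.act_act, ← h.inner_act, h.act_act, inner_self_eq_norm_sq_to_K]
  simp

/-- A projective measurement has total probability one. -/
theorem _root_.IsStarProjection.norm_sq_add {P : Op ι} (h : IsStarProjection P) (ψ : Ket ι) :
    ‖act P ψ‖ ^ 2 + ‖act (1 - P) ψ‖ ^ 2 = ‖ψ‖ ^ 2 := by
  have h1 : inner ℂ (act P ψ) (act (1 - P) ψ) = 0 := by
    rw [h.inner_act, ← act_mul, mul_sub, h.isIdempotentElem.eq]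
    simp
  have h2 : act P ψ + act (1 - P) ψ = ψ := by
    rw [← act_add, add_sub_cancel, act_one]
  have := norm_add_sq_eq_norm_sq_add_norm_sq_of_inner_eq_zero _ _ h1
  rw [h2] at this
  nlinarith

theorem _root_.IsStarProjection.norm_act_le {P : Op ι} (h : IsStarProjection P) (ψ : Ket ι) :
    ‖act P ψ‖ ≤ ‖ψ‖ := by
  have := h.norm_sq_add ψ
  exact abs_le_of_sq_le_sq' (by nlinarith [sq_nonneg ‖act (1 - P) ψ‖]) (norm_nonneg _) |>.2

end Operators

/-! ## Tensor products -/

/-- The tensor product of one-qubit operators. -/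
def tensorOp {n : ℕ} (M : Fin n → Matrix Bool Bool ℂ) : Op (Assignment n) :=
  Matrix.of fun x y => ∏ i, M i (x i) (y i)

/-- The tensor product of one-qubit vectors. -/
def tensorKet {n : ℕ} (v : Fin n → Bool → ℂ) : Ket (Assignment n) :=
  WithLp.toLp 2 fun x => ∏ i, v i (x i)

theorem tensorKet_apply {n : ℕ} (v : Fin n → Bool → ℂ) (x : Assignment n) :
    tensorKet v x = ∏ i, v i (x i) := rfl

theorem sum_prod_assignment {n : ℕ} (f : Fin n → Bool → ℂ) :
    ∑ x : Assignment n, ∏ i, f i (x i) = ∏ i, ∑ b, f i b := by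
  rw [Finset.prod_univ_sum, Fintype.piFinset_univ]

theorem tensorOp_mul {n : ℕ} (M M' : Fin n → Matrix Bool Bool ℂ) :
    tensorOp M * tensorOp M' = tensorOp fun i => M i * M' i := by
  ext x y
  simp only [tensorOp, Matrix.mul_apply, Matrix.of_apply, ← Finset.prod_mul_distrib]
  rw [sum_prod_assignment fun i b => M i (x i) b * M' i b (y i)]

theorem tensorOp_conjTranspose {n : ℕ} (M : Fin n → Matrix Bool Bool ℂ) :
    (tensorOp M).conjTranspose = tensorOp fun i => (M i).conjTranspose := by
  ext x y
  simp [tensorOp, Matrix.conjTranspose_apply]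

theorem act_tensorOp_tensorKet {n : ℕ} (M : Fin n → Matrix Bool Bool ℂ) (v : Fin n → Bool → ℂ) :
    act (tensorOp M) (tensorKet v) = tensorKet fun i => (M i).mulVec (v i) := by
  ext x
  simp only [act_apply, tensorKet_apply, tensorOp, Matrix.of_apply, ← Finset.prod_mul_distrib]
  rw [sum_prod_assignment fun i b => M i (x i) b * v i b]
  rfl

theorem inner_tensorKet {n : ℕ} (v w : Fin n → Bool → ℂ) :
    inner ℂ (tensorKet v) (tensorKet w) = ∏ i, ∑ b, star (v i b) * w i b := by
  rw [← sum_prod_assignment fun i b => star (v i b) * w i b, PiLp.inner_apply]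
  refine Finset.sum_congr rfl fun x _ => ?_
  simp [tensorKet_apply, Finset.prod_mul_distrib, mul_comm]

/-! ## The rotated encoding -/

/-- The encoding `R_Y(± θ)|+⟩` of a truth value. -/
def encQubit (θ : ℝ) (s : Bool) : Bool → ℂ := (rotY (sgn s * θ)).mulVec plusQubit

theorem rotY_mulVec_plusQubit (α : ℝ) (b : Bool) :
    (rotY α).mulVec plusQubit b =
      (((Real.cos (α / 2) + sgn b * Real.sin (α / 2)) / Real.sqrt 2 : ℝ) : ℂ) := by
  cases b <;> simp [rotY, plusQubit, Matrix.mulVec, dotProduct, sgn] <;> ring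

theorem encQubit_apply (θ : ℝ) (s b : Bool) :
    encQubit θ s b =
      (((Real.cos (θ / 2) + sgn s * sgn b * Real.sin (θ / 2)) / Real.sqrt 2 : ℝ) : ℂ) := by
  rw [encQubit, rotY_mulVec_plusQubit]
  cases s <;> cases b <;> simp [sgn, neg_div]

theorem perpQubit_apply (θ : ℝ) (s b : Bool) :
    perpQubit θ s b =
      (((-(sgn s * Real.sin (θ / 2)) + sgn b * Real.cos (θ / 2)) / Real.sqrt 2 : ℝ) : ℂ) := by
  rw [perpQubit, rotY_mulVec_plusQubit]
  cases s <;> cases b <;> simp [sgn, add_div, ← sub_eq_add_neg, sub_div, Real.cos_pi_div_two_sub,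
    Real.sin_pi_div_two_sub, Real.cos_add, Real.sin_add]

theorem sqrt_two_mul_self : Real.sqrt 2 * Real.sqrt 2 = 2 := Real.mul_self_sqrt (by norm_num)

theorem sin_eq_half (θ : ℝ) : Real.sin θ = 2 * Real.sin (θ / 2) * Real.cos (θ / 2) := by
  rw [← Real.sin_two_mul]; congr 1; ring

theorem div_sqrt_two_mul (a b : ℝ) :
    (a / Real.sqrt 2) * (b / Real.sqrt 2) = a * b / 2 := by
  rw [div_mul_div_comm, sqrt_two_mul_self]

theorem star_perpQubit (θ : ℝ) (s b : Bool) : star (perpQubit θ s b) = perpQubit θ s b := by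
  rw [perpQubit_apply]; exact Complex.conj_ofReal _

theorem star_encQubit (θ : ℝ) (s b : Bool) : star (encQubit θ s b) = encQubit θ s b := by
  rw [encQubit_apply]; exact Complex.conj_ofReal _

theorem sum_perpQubit_perpQubit (θ : ℝ) (s : Bool) :
    ∑ b, star (perpQubit θ s b) * perpQubit θ s b = 1 := by
  simp only [star_perpQubit]
  simp only [perpQubit_apply, Fintype.sum_bool, ← Complex.ofReal_mul,
    div_sqrt_two_mul, ← Complex.ofReal_add]
  rw [← Complex.ofReal_one, Complex.ofReal_inj]
  have := Real.sin_sq_add_cos_sq (θ / 2)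
  cases s <;> simp [sgn] <;> linarith

theorem sum_encQubit_encQubit (θ : ℝ) (s : Bool) :
    ∑ b, star (encQubit θ s b) * encQubit θ s b = 1 := by
  simp only [star_encQubit]
  simp only [encQubit_apply, Fintype.sum_bool, ← Complex.ofReal_mul,
    div_sqrt_two_mul, ← Complex.ofReal_add]
  rw [← Complex.ofReal_one, Complex.ofReal_inj]
  have := Real.sin_sq_add_cos_sq (θ / 2)
  cases s <;> simp [sgn] <;> linarith

theorem sum_perpQubit_encQubit (θ : ℝ) (s : Bool) :
    ∑ b, star (perpQubit θ s b) * encQubit θ s b = 0 := by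
  simp only [star_perpQubit]
  simp only [perpQubit_apply, encQubit_apply, Fintype.sum_bool,
    ← Complex.ofReal_mul, div_sqrt_two_mul, ← Complex.ofReal_add]
  rw [← Complex.ofReal_zero, Complex.ofReal_inj]
  cases s <;> simp [sgn] <;> ring

theorem sum_encQubit_plusQubit (θ : ℝ) (s : Bool) :
    ∑ b, star (encQubit θ s b) * plusQubit b = (Real.cos (θ / 2) : ℝ) := by
  simp only [star_encQubit]
  simp only [encQubit_apply, plusQubit, Fintype.sum_bool,
    ← Complex.ofReal_mul, div_sqrt_two_mul, ← Complex.ofReal_add]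
  rw [Complex.ofReal_inj]
  cases s <;> simp [sgn] <;> ring

/-- The perpendicular vectors form the dual basis of the encodings. -/
theorem sum_encQubit_mul_perpQubit (θ : ℝ) (y z : Bool) :
    ∑ b, (sgn b : ℂ) * encQubit θ b y * star (perpQubit θ (!b) z) =
      if y = z then (Real.sin θ : ℂ) else 0 := by
  simp only [star_perpQubit]
  simp only [perpQubit_apply, encQubit_apply, Fintype.sum_bool, ← Complex.ofReal_mul, mul_assoc (sgn _),
    div_sqrt_two_mul, ← Complex.ofReal_add, sin_eq_half θ]
  rw [← Complex.ofReal_zero, ← apply_ite, Complex.ofReal_inj]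
  have := Real.sin_sq_add_cos_sq (θ / 2)
  cases y <;> cases z <;> simp [sgn] <;> ring

/-- This is the signal that the readout detects: a computational basis measurement of an encoded
value is biased by `± sin θ`. -/
theorem encQubit_bias (θ : ℝ) (s : Bool) :
    ‖encQubit θ s true‖ ^ 2 - ‖encQubit θ s false‖ ^ 2 = sgn s * Real.sin θ := by
  simp only [encQubit_apply, Complex.norm_real, Real.norm_eq_abs, sq_abs, div_pow,
    Real.sq_sqrt (show (0 : ℝ) ≤ 2 by norm_num), sin_eq_half θ]
  cases s <;> simp [sgn] <;> ring

theorem norm_sq_encQubit (θ : ℝ) (s : Bool) :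
    ‖encQubit θ s true‖ ^ 2 + ‖encQubit θ s false‖ ^ 2 = 1 := by
  simp only [encQubit_apply, Complex.norm_real, Real.norm_eq_abs, sq_abs, div_pow,
    Real.sq_sqrt (show (0 : ℝ) ≤ 2 by norm_num)]
  have := Real.sin_sq_add_cos_sq (θ / 2)
  cases s <;> simp [sgn] <;> linarith


/-! ## Clause projectors -/

/-- The one-qubit factor of a clause projector. -/
def litOp (θ : ℝ) : Option Bool → Matrix Bool Bool ℂ
  | none => 1
  | some s => ketbra (perpQubit θ s)

theorem clauseProj_eq_tensorOp {n : ℕ} (θ : ℝ) (c : Clause n) :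
    clauseProj θ c = tensorOp fun i => litOp θ (c i) := by
  ext x y
  simp only [clauseProj, tensorOp, Matrix.of_apply]
  refine Finset.prod_congr rfl fun i _ => ?_
  cases c i <;> rfl

theorem ketbra_mulVec (u v : Bool → ℂ) :
    (ketbra u).mulVec v = (∑ b, star (u b) * v b) • u := by
  ext a
  simp only [ketbra, Matrix.mulVec, dotProduct, Matrix.vecMulVec_apply, Pi.star_apply,
    Pi.smul_apply, smul_eq_mul, Finset.sum_mul]
  exact Finset.sum_congr rfl fun b _ => by ring

theorem isStarProjection_litOp (θ : ℝ) (o : Option Bool) : IsStarProjection (litOp θ o) := by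
  cases o with
  | none => exact .one _
  | some s =>
    refine ⟨?_, ?_⟩
    · have h : star (perpQubit θ s) ⬝ᵥ perpQubit θ s = 1 := sum_perpQubit_perpQubit θ s
      rw [IsIdempotentElem, litOp, ketbra, Matrix.vecMulVec_mul_vecMulVec, h]
      simp
    · ext a b
      simp [litOp, ketbra, Matrix.vecMulVec_apply, mul_comm]

theorem isStarProjection_clauseProj {n : ℕ} (θ : ℝ) (c : Clause n) :
    IsStarProjection (clauseProj θ c) := by
  rw [clauseProj_eq_tensorOp]
  refine ⟨?_, ?_⟩
  · rw [IsIdempotentElem, tensorOp_mul]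
    exact congrArg _ (funext fun i => (isStarProjection_litOp θ (c i)).isIdempotentElem)
  · rw [IsSelfAdjoint, Matrix.star_eq_conjTranspose, tensorOp_conjTranspose]
    exact congrArg _ (funext fun i => (isStarProjection_litOp θ (c i)).isSelfAdjoint)

/-- Clauses that agree with the same bit string have commuting projectors. -/
theorem commute_of_compatible {n : ℕ} (θ : ℝ) {b : Assignment n} {c d : Clause n}
    (hc : compatible b c = true) (hd : compatible b d = true) :
    Commute (clauseProj θ c) (clauseProj θ d) := by
  simp only [compatible, decide_eq_true_eq] at hc hd
  rw [Commute, SemiconjBy, clauseProj_eq_tensorOp, clauseProj_eq_tensorOp, tensorOp_mul,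
    tensorOp_mul]
  congr 1
  funext i
  rcases hc i with h | h <;> rcases hd i with h' | h' <;> simp [h, h', litOp]

/-! ## The ground space -/

theorem act_list_sum {ι : Type} [Fintype ι] [DecidableEq ι] (l : List (Op ι)) (ψ : Ket ι) :
    act l.sum ψ = (l.map fun A => act A ψ).sum := by
  induction l with
  | nil => simp
  | cons A l ih => simp [act_add, ih]

theorem inner_hamiltonian {n : ℕ} (θ : ℝ) (φ : Formula n) (ψ : Ket (Assignment n)) :
    inner ℂ ψ (act (hamiltonian θ φ) ψ) =
      ((φ.map fun c => ‖act (clauseProj θ c) ψ‖ ^ 2).sum : ℝ) := by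
  induction φ with
  | nil => simp [hamiltonian]
  | cons c φ ih =>
    simp only [hamiltonian, List.map_cons, List.sum_cons] at ih ⊢
    rw [act_add, inner_add_right, ih, (isStarProjection_clauseProj θ c).inner_self]
    push_cast
    rfl

/-- The energy is the sum of the `‖P_c ψ‖²`, so it vanishes only if every term does. -/
theorem mem_groundSpace {n : ℕ} {θ : ℝ} {φ : Formula n} {ψ : Ket (Assignment n)} :
    ψ ∈ groundSpace θ φ ↔ ∀ c ∈ φ, act (clauseProj θ c) ψ = 0 := by
  rw [groundSpace, LinearMap.mem_ker]
  constructor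
  · intro h c hc
    have h0 := inner_hamiltonian θ φ ψ
    rw [show act (hamiltonian θ φ) ψ = 0 from h, inner_zero_right] at h0
    have h1 : (φ.map fun c => ‖act (clauseProj θ c) ψ‖ ^ 2).sum = 0 := by exact_mod_cast h0.symm
    have h2 : ‖act (clauseProj θ c) ψ‖ ^ 2 ≤ 0 := by
      rw [← h1]
      refine List.single_le_sum ?_ _ (List.mem_map_of_mem hc)
      simp only [List.mem_map]
      rintro _ ⟨d, -, rfl⟩
      positivity
    have h3 : ‖act (clauseProj θ c) ψ‖ = 0 := by
      nlinarith [norm_nonneg (act (clauseProj θ c) ψ)]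
    exact norm_eq_zero.mp h3
  · intro h
    change act (hamiltonian θ φ) ψ = 0
    rw [hamiltonian, act_list_sum, List.map_map]
    refine List.sum_eq_zero fun x hx => ?_
    obtain ⟨c, hc, rfl⟩ := List.mem_map.mp hx
    exact h c hc

/-- The encoding of an assignment. -/
def encKet {n : ℕ} (θ : ℝ) (x : Assignment n) : Ket (Assignment n) :=
  tensorKet fun i => encQubit θ (x i)

/-- The product state orthogonal to the encodings of all assignments but one. -/
def dualKet {n : ℕ} (θ : ℝ) (x : Assignment n) : Ket (Assignment n) :=
  tensorKet fun i => perpQubit θ (!x i)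

theorem norm_eq_one_of_inner_self {ι : Type} [Fintype ι] {ψ : Ket ι}
    (h : inner ℂ ψ ψ = 1) : ‖ψ‖ = 1 := by
  have h2 := inner_self_eq_norm_sq (𝕜 := ℂ) ψ
  rw [h, RCLike.one_re] at h2
  nlinarith [norm_nonneg ψ]

theorem norm_encKet {n : ℕ} (θ : ℝ) (x : Assignment n) : ‖encKet θ x‖ = 1 := by
  have h : inner ℂ (encKet θ x) (encKet θ x) = 1 := by
    rw [encKet, inner_tensorKet]
    exact Finset.prod_eq_one fun i _ => sum_encQubit_encQubit θ (x i)
  exact norm_eq_one_of_inner_self h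

theorem plusState_eq {n : ℕ} : plusState n = tensorKet fun _ => plusQubit := rfl

theorem norm_plusState (n : ℕ) : ‖plusState n‖ = 1 := by
  have h1 : ∑ b, star (plusQubit b) * plusQubit b = 1 := by
    simp only [plusQubit, Complex.star_def, Complex.conj_ofReal, ← Complex.ofReal_mul,
      div_sqrt_two_mul, Fintype.sum_bool]
    norm_num
  have h : inner ℂ (plusState n) (plusState n) = 1 := by
    rw [plusState_eq, inner_tensorKet, h1]
    simp
  exact norm_eq_one_of_inner_self h

theorem inner_encKet_plusState {n : ℕ} (θ : ℝ) (x : Assignment n) :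
    inner ℂ (encKet θ x) (plusState n) = ((Real.cos (θ / 2) ^ n : ℝ) : ℂ) := by
  rw [encKet, plusState_eq, inner_tensorKet]
  rw [Finset.prod_congr rfl fun i _ => sum_encQubit_plusQubit θ (x i)]
  simp

/-- At a satisfied literal the one-qubit factor of the projector annihilates the encoding, which
kills the whole product. -/
theorem encKet_mem_groundSpace {n : ℕ} (θ : ℝ) {φ : Formula n} {x : Assignment n}
    (hx : Sat φ x) : encKet θ x ∈ groundSpace θ φ := by
  rw [mem_groundSpace]
  intro c hc
  obtain ⟨i, hi⟩ := hx c hc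
  rw [clauseProj_eq_tensorOp, encKet, act_tensorOp_tensorKet]
  ext y
  rw [tensorKet_apply]
  refine Finset.prod_eq_zero (Finset.mem_univ i) ?_
  rw [hi, litOp, ketbra_mulVec, sum_perpQubit_encQubit]
  simp

/-- The states of zero energy have no component along an assignment that does not satisfy the
formula. -/
theorem inner_dualKet_eq_zero {n : ℕ} {θ : ℝ} {φ : Formula n} {ψ : Ket (Assignment n)}
    (hψ : ψ ∈ groundSpace θ φ) {x : Assignment n} (hx : ¬ Sat φ x) :
    inner ℂ (dualKet θ x) ψ = 0 := by
  simp only [Sat, not_forall, not_exists] at hx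
  obtain ⟨c, hc, hx⟩ := hx
  -- Every literal of a violated clause has the value opposite to that of `x`, so the projector of
  -- the clause fixes the dual product state.
  have h : act (clauseProj θ c) (dualKet θ x) = dualKet θ x := by
    rw [clauseProj_eq_tensorOp, dualKet, act_tensorOp_tensorKet]
    congr 1
    funext i
    cases hci : c i with
    | none => simp [litOp]
    | some s =>
      have : s = !x i := by
        have := hx i
        rw [hci] at this
        cases s <;> cases hxi : x i <;> simp_all
      rw [this, litOp, ketbra_mulVec, sum_perpQubit_perpQubit, one_smul]
  rw [← h, (isStarProjection_clauseProj θ c).inner_act, mem_groundSpace.mp hψ c hc,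
    inner_zero_right]

/-- Expansion of a state in the nonorthogonal basis of encodings. One qubit has the signed
perpendicular vectors as dual basis, with normalization `sin θ`; the tensor product gives `sin θ ^
n`, kept on the left to avoid division. -/
theorem sin_pow_smul_eq_sum {n : ℕ} (θ : ℝ) (ψ : Ket (Assignment n)) (y : Assignment n) :
    (Real.sin θ : ℂ) ^ n * ψ y =
      ∑ x, ((∏ i, (sgn (x i) : ℂ)) * inner ℂ (dualKet θ x) ψ) * encKet θ x y := by
  have h : ∀ x z : Assignment n,
      (∏ i, (sgn (x i) : ℂ)) * (star (dualKet θ x z) * ψ z) * encKet θ x y =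
        (∏ i, (sgn (x i) : ℂ) * encQubit θ (x i) (y i) * star (perpQubit θ (!x i) (z i))) * ψ z := by
    intro x z
    simp only [Finset.prod_mul_distrib, dualKet, encKet, tensorKet_apply, star_prod]
    ring
  have h2 : ∀ x : Assignment n, (inner ℂ (dualKet θ x) ψ : ℂ) =
      ∑ z, star (dualKet θ x z) * ψ z := by
    intro x
    rw [PiLp.inner_apply]
    exact Finset.sum_congr rfl fun z _ => by simp [mul_comm]
  simp only [h2, Finset.mul_sum, Finset.sum_mul, h]
  rw [Finset.sum_comm]
  have h3 : ∀ z, ∑ x : Assignment n,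
      (∏ i, (sgn (x i) : ℂ) * encQubit θ (x i) (y i) * star (perpQubit θ (!x i) (z i))) * ψ z =
      if y = z then (Real.sin θ : ℂ) ^ n * ψ z else 0 := by
    intro z
    rw [← Finset.sum_mul, sum_prod_assignment fun i b =>
      (sgn b : ℂ) * encQubit θ b (y i) * star (perpQubit θ (!b) (z i))]
    simp only [sum_encQubit_mul_perpQubit]
    rw [Finset.prod_ite_zero]
    split_ifs with h1 h2 h2
    · simp
    · exact absurd (funext fun i => h1 i (Finset.mem_univ i)) h2
    · exact absurd (fun i _ => congrFun h2 i) h1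
    · simp
  simp only [h3]
  simp

/-- If all solutions agree on a variable, its qubit factors out of the states of zero energy. -/
theorem groundSpace_factor {n : ℕ} {θ : ℝ} (hθ : Real.sin θ ≠ 0) {φ : Formula n}
    {ψ : Ket (Assignment n)} (hψ : ψ ∈ groundSpace θ φ) {i : Fin n} {v : Bool}
    (hv : ∀ x, Sat φ x → x i = v) (y : Assignment n) :
    ψ (Function.update y i true) * encQubit θ v false =
      ψ (Function.update y i false) * encQubit θ v true := by
  have hs : (Real.sin θ : ℂ) ^ n ≠ 0 := pow_ne_zero _ (by exact_mod_cast hθ)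
  refine mul_left_cancel₀ hs ?_
  rw [← mul_assoc, ← mul_assoc, sin_pow_smul_eq_sum, sin_pow_smul_eq_sum, Finset.sum_mul,
    Finset.sum_mul]
  refine Finset.sum_congr rfl fun x _ => ?_
  by_cases hx : Sat φ x
  · have h : ∀ b, encKet θ x (Function.update y i b) =
        encQubit θ v b * ∏ j ∈ Finset.univ.erase i, encQubit θ (x j) (y j) := by
      intro b
      rw [encKet, tensorKet_apply, ← Finset.mul_prod_erase _ _ (Finset.mem_univ i), hv x hx]
      congr 1
      · simp
      · refine Finset.prod_congr rfl fun j hj => ?_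
        rw [Function.update_of_ne (Finset.ne_of_mem_erase hj)]
    rw [h, h]
    ring
  · rw [inner_dualKet_eq_zero hψ hx]
    simp

/-- The expectation of the outcome of a qubit, with `1` for `true` and `-1` for `false`. -/
def bias {n : ℕ} (i : Fin n) (ψ : Ket (Assignment n)) : ℝ := ∑ x, sgn (x i) * ‖ψ x‖ ^ 2

/-- Flipping bit `i` is an involution, and every pair of assignments that differ only there is met
twice on the right. -/
theorem two_mul_sum_assignment {n : ℕ} (i : Fin n) (f : Assignment n → ℝ) :
    2 * ∑ x, f x = ∑ x, (f (Function.update x i true) + f (Function.update x i false)) := by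
  have hinv : Function.Involutive fun x : Assignment n => Function.update x i (!x i) := by
    intro x; simp
  have h : ∑ x, f (Function.update x i (!x i)) = ∑ x, f x :=
    Equiv.sum_comp hinv.toPerm f
  rw [two_mul]
  nth_rewrite 2 [← h]
  rw [← Finset.sum_add_distrib]
  refine Finset.sum_congr rfl fun x _ => ?_
  cases hx : x i
  · rw [add_comm, show Function.update x i false = x by rw [← hx]; simp]
    rfl
  · rw [show Function.update x i true = x by rw [← hx]; simp]
    rfl

/-- By `groundSpace_factor` the two amplitudes of each pair differing at bit `i` are in the ratio of
the entries of `encQubit θ v`. Hence each pair has the relative bias of that vector. -/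
theorem bias_groundSpace {n : ℕ} {θ : ℝ} (hθ : Real.sin θ ≠ 0) {φ : Formula n}
    {ψ : Ket (Assignment n)} (hψ : ψ ∈ groundSpace θ φ) {i : Fin n} {v : Bool}
    (hv : ∀ x, Sat φ x → x i = v) :
    bias i ψ = sgn v * Real.sin θ * ‖ψ‖ ^ 2 := by
  have h1 := two_mul_sum_assignment i fun x => sgn (x i) * ‖ψ x‖ ^ 2
  have h2 := two_mul_sum_assignment i fun x => ‖ψ x‖ ^ 2
  rw [EuclideanSpace.norm_sq_eq]
  have : 2 * bias i ψ = 2 * (sgn v * Real.sin θ * ∑ x, ‖ψ x‖ ^ 2) := by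
    rw [bias, h1, mul_left_comm, h2, Finset.mul_sum]
    refine Finset.sum_congr rfl fun x _ => ?_
    have hf := congrArg (fun z : ℂ => ‖z‖ ^ 2) (groundSpace_factor hθ hψ hv x)
    simp only [norm_mul, mul_pow] at hf
    have hb := encQubit_bias θ v
    have hn := norm_sq_encQubit θ v
    rw [← hb]
    simp only [Function.update_self, sgn, if_true, Bool.false_eq_true, if_false]
    linear_combination (‖ψ (Function.update x i false)‖ ^ 2
      - ‖ψ (Function.update x i true)‖ ^ 2) * hn + 2 * hf
  linarith

theorem sgn_mul_self (s : Bool) : sgn s * sgn s = 1 := by cases s <;> simp [sgn]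

/-- The bias of a state close to the ground space. -/
theorem le_bias_of_near {n : ℕ} {θ ε : ℝ} (hθ : 0 < Real.sin θ) {φ : Formula n}
    {ψ u : Ket (Assignment n)} (hψ : ‖ψ‖ = 1) (hu : u ∈ groundSpace θ φ)
    (hortho : inner ℂ u (ψ - u) = 0) (hε : ‖ψ - u‖ ≤ ε) {i : Fin n} {v : Bool}
    (hv : ∀ x, Sat φ x → x i = v) :
    Real.sin θ - 2 * ε - 2 * ε ^ 2 ≤ sgn v * bias i ψ := by
  set η := ψ - u with hη
  have hψ' : ψ = u + η := by rw [hη]; abel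
  have hpyth : ‖u‖ ^ 2 + ‖η‖ ^ 2 = 1 := by
    have := norm_add_sq_eq_norm_sq_add_norm_sq_of_inner_eq_zero _ _ hortho
    rw [← hψ', hψ] at this
    nlinarith
  have hub := bias_groundSpace hθ.ne' hu hv
  have hCS : ∑ x, ‖u x‖ * ‖η x‖ ≤ ‖u‖ * ‖η‖ := by
    rw [EuclideanSpace.norm_eq, EuclideanSpace.norm_eq]
    exact Real.sum_mul_le_sqrt_mul_sqrt _ _ _
  -- Replacing `ψ` by `u` changes each weight by at most `2 ‖u x‖ ‖η x‖ + ‖η x‖²`. Summed with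
  -- Cauchy–Schwarz this costs `2ε + ε²`; the second `ε²` comes from `‖u‖² = 1 - ‖η‖²`.
  have hpt : ∀ x, sgn v * (sgn (x i) * ‖u x‖ ^ 2) - (2 * (‖u x‖ * ‖η x‖) + ‖η x‖ ^ 2) ≤
      sgn v * (sgn (x i) * ‖ψ x‖ ^ 2) := by
    intro x
    have h1 : ψ x = u x + η x := by rw [hψ']; rfl
    have h2 : ‖ψ x‖ ≤ ‖u x‖ + ‖η x‖ := h1 ▸ norm_add_le _ _
    have h3 : ‖u x‖ ≤ ‖ψ x‖ + ‖η x‖ := by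
      have : u x = ψ x - η x := by rw [h1]; ring
      rw [this]; exact norm_sub_le _ _
    have h4 := norm_nonneg (ψ x)
    have h5 := norm_nonneg (u x)
    have h6 := norm_nonneg (η x)
    cases v <;> cases x i <;> simp only [sgn, if_true, if_false, Bool.false_eq_true] <;> nlinarith
  have hsum := Finset.sum_le_sum fun x (_ : x ∈ Finset.univ) => hpt x
  simp only [Finset.sum_sub_distrib, ← Finset.mul_sum, Finset.sum_add_distrib] at hsum
  rw [← EuclideanSpace.norm_sq_eq η] at hsum
  change sgn v * bias i u - _ ≤ sgn v * bias i ψ at hsum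
  rw [hub] at hsum
  have h7 : sgn v * (sgn v * Real.sin θ * ‖u‖ ^ 2) = Real.sin θ * ‖u‖ ^ 2 := by
    rw [← mul_assoc, ← mul_assoc, sgn_mul_self, one_mul]
  have h8 := Real.sin_le_one θ
  have hn := norm_nonneg η
  have hun : ‖u‖ ≤ 1 := by nlinarith [norm_nonneg u]
  rw [h7] at hsum
  have h9 : ‖η‖ ^ 2 ≤ ε ^ 2 := by gcongr
  have h10 : ‖u‖ * ‖η‖ ≤ ε := by nlinarith
  have h11 : Real.sin θ * ‖u‖ ^ 2 ≥ Real.sin θ - ε ^ 2 := by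
    have : ‖u‖ ^ 2 = 1 - ‖η‖ ^ 2 := by linarith
    rw [this]; nlinarith [sq_nonneg ‖η‖]
  linarith


/-! ## The detectability lemma -/

section Detectability

variable {ι : Type} [Fintype ι] [DecidableEq ι]

/-- The product of the complements of the given projections. -/
def passOp (l : List (Op ι)) : Op ι := (l.map fun P => 1 - P).prod

/-- The norms of the components that are removed one after the other by the complements of the
given projections, the last of which acts first. -/
def removed : List (Op ι) → Ket ι → List (Op ι × ℝ)
  | [], _ => []
  | P :: l, ψ => (P, ‖act P (act (passOp l) ψ)‖) :: removed l ψ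

theorem act_passOp_cons (P : Op ι) (l : List (Op ι)) (ψ : Ket ι) :
    act (passOp (P :: l)) ψ = act (1 - P) (act (passOp l) ψ) := by
  rw [passOp, List.map_cons, List.prod_cons, act_mul]
  rfl

theorem map_fst_removed (l : List (Op ι)) (ψ : Ket ι) : (removed l ψ).map Prod.fst = l := by
  induction l with
  | nil => rfl
  | cons P l ih => simp [removed, ih]

theorem snd_removed_nonneg (l : List (Op ι)) (ψ : Ket ι) :
    ∀ x ∈ removed l ψ, 0 ≤ x.2 := by
  induction l with
  | nil => simp [removed]
  | cons P l ih =>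
    intro x hx
    rcases List.mem_cons.mp hx with rfl | hx
    · exact norm_nonneg _
    · exact ih x hx

/-- Pythagoras at each step, telescoped: the removed component is orthogonal to what remains. -/
theorem sum_sq_removed {l : List (Op ι)} (hl : ∀ P ∈ l, IsStarProjection P) (ψ : Ket ι) :
    ((removed l ψ).map fun x => x.2 ^ 2).sum = ‖ψ‖ ^ 2 - ‖act (passOp l) ψ‖ ^ 2 := by
  induction l with
  | nil => simp [removed, passOp]
  | cons P l ih =>
    have h := (hl P (by simp)).norm_sq_add (act (passOp l) ψ)
    rw [removed, List.map_cons, List.sum_cons, ih fun Q hQ => hl Q (by simp [hQ]),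
      act_passOp_cons]
    linarith

-- Move `Q` through the product, beginning with the factor that acts last. A commuting factor is
-- passed for free and does not increase the norm; a noncommuting one costs the norm of the
-- component it removes. The process ends at the factor of `Q` itself, because `Q (1 - Q) = 0`.
open Classical in
theorem norm_act_passOp_le {l : List (Op ι)} (hl : ∀ P ∈ l, IsStarProjection P) (ψ : Ket ι)
    {Q : Op ι} (hQ : Q ∈ l) :
    ‖act Q (act (passOp l) ψ)‖ ≤
      (((removed l ψ).filter fun x => ¬ Commute Q x.1).map Prod.snd).sum := by
  induction l with
  | nil => simp at hQ
  | cons P l ih =>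
    have hP := hl P (by simp)
    have hl' : ∀ R ∈ l, IsStarProjection R := fun R hR => hl R (by simp [hR])
    rw [act_passOp_cons, removed, List.filter_cons]
    set χ := act (passOp l) ψ with hχ
    by_cases hQP : Q = P
    · subst hQP
      rw [← act_mul, mul_sub, hP.isIdempotentElem.eq]
      simp only [mul_one, sub_self, act_zero, norm_zero]
      refine List.sum_nonneg ?_
      intro a ha
      obtain ⟨x, hx, rfl⟩ := List.mem_map.mp ha
      split_ifs at hx with h
      · rcases List.mem_cons.mp hx with rfl | hx
        · exact norm_nonneg _
        · exact snd_removed_nonneg l ψ x (List.mem_filter.mp hx).1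
      · exact snd_removed_nonneg l ψ x (List.mem_filter.mp hx).1
    · have hQl : Q ∈ l := by
        rcases List.mem_cons.mp hQ with h | h
        · exact absurd h hQP
        · exact h
      have hQpr := hl' Q hQl
      by_cases hc : Commute Q P
      · have h1 : Q * (1 - P) = (1 - P) * Q := by
          rw [mul_sub, sub_mul, hc.eq, mul_one, one_mul]
        rw [← act_mul, h1, act_mul, if_neg (by simpa using hc)]
        exact ((hP.one_sub).norm_act_le _).trans (ih hl' hQl)
      · rw [if_pos (by simpa using hc), List.map_cons, List.sum_cons, act_sub, act_one, map_sub]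
        calc ‖act Q χ - act Q (act P χ)‖ ≤ ‖act Q χ‖ + ‖act Q (act P χ)‖ := norm_sub_le _ _
          _ ≤ _ + ‖act P χ‖ := add_le_add (ih hl' hQl) (hQpr.norm_act_le _)
          _ = _ := add_comm _ _

theorem sq_list_sum_le (l : List ℝ) : l.sum ^ 2 ≤ l.length * (l.map (· ^ 2)).sum := by
  have h := sq_sum_le_card_mul_sum_sq (s := Finset.univ) (f := fun i : Fin l.length => l.get i)
  rw [← List.sum_ofFn, List.ofFn_get] at h
  have h2 : ∑ i : Fin l.length, l.get i ^ 2 = (l.map (· ^ 2)).sum := by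
    rw [← List.sum_ofFn]
    congr 1
    conv_rhs => rw [← List.ofFn_get l, List.map_ofFn]
    rfl
  rw [h2] at h
  simpa using h

/-- Double counting: an element `b` contributes `f b` once for every `a` related to it. -/
theorem sum_map_sum_filter {α β : Type} (r : α → β → Bool) (f : β → ℝ) (l : List α)
    (L : List β) :
    (l.map fun a => ((L.filter (r a)).map f).sum).sum =
      (L.map fun b => (l.countP fun a => r a b : ℝ) * f b).sum := by
  induction L with
  | nil => simp
  | cons b L ih =>
    rw [List.map_cons, List.sum_cons, ← ih]
    clear ih
    induction l with
    | nil => simp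
    | cons a l ih =>
      simp only [List.map_cons, List.sum_cons, List.countP_cons, List.filter_cons] at ih ⊢
      rw [ih]
      cases r a b <;> simp <;> ring

open Classical in
/-- The detectability lemma in terms of the energy of the resulting state. -/
theorem sum_sq_act_passOp_le {l : List (Op ι)} (hl : ∀ P ∈ l, IsStarProjection P) {g : ℕ}
    (hg : ∀ P ∈ l, (l.countP fun Q => ¬ Commute P Q) ≤ g) (ψ : Ket ι) :
    (l.map fun Q => ‖act Q (act (passOp l) ψ)‖ ^ 2).sum ≤
      g ^ 2 * (‖ψ‖ ^ 2 - ‖act (passOp l) ψ‖ ^ 2) := by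
  set L := removed l ψ with hL
  have hLl : L.map Prod.fst = l := map_fst_removed l ψ
  have h1 : ∀ Q ∈ l, ‖act Q (act (passOp l) ψ)‖ ^ 2 ≤
      g * ((L.filter fun x => ¬ Commute Q x.1).map fun x => x.2 ^ 2).sum := by
    intro Q hQ
    have h := norm_act_passOp_le hl ψ hQ
    have h2 := pow_le_pow_left₀ (norm_nonneg _) h 2
    refine h2.trans ((sq_list_sum_le _).trans ?_)
    rw [List.map_map, List.length_map]
    refine mul_le_mul_of_nonneg_right ?_ ?_
    · have : (L.filter fun x => ¬ Commute Q x.1).length ≤ g := by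
        have h3 := hg Q hQ
        rw [← hLl, List.countP_map] at h3
        rwa [← List.countP_eq_length_filter]
      exact_mod_cast this
    · refine List.sum_nonneg fun a ha => ?_
      obtain ⟨x, -, rfl⟩ := List.mem_map.mp ha
      exact sq_nonneg _
  -- One factor `g` comes from Cauchy–Schwarz over the at most `g` noncommuting components. The
  -- other arises on exchanging the sums: since commuting is symmetric, each component is charged by
  -- at most `g` projections.
  calc (l.map fun Q => ‖act Q (act (passOp l) ψ)‖ ^ 2).sum
      ≤ (l.map fun Q => (g : ℝ) * ((L.filter fun x => ¬ Commute Q x.1).map fun x => x.2 ^ 2).sum).sum :=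
        List.sum_le_sum h1
    _ = g * (L.map fun x => ((l.countP fun Q => ¬ Commute Q x.1 : ℕ) : ℝ) * x.2 ^ 2).sum := by
        rw [List.sum_map_mul_left]
        exact congrArg _ (sum_map_sum_filter (fun (Q : Op ι) (x : Op ι × ℝ) =>
          decide (¬ Commute Q x.1)) (fun x => x.2 ^ 2) l L)
    _ ≤ g * (L.map fun x => (g : ℝ) * x.2 ^ 2).sum := by
        refine mul_le_mul_of_nonneg_left (List.sum_le_sum fun x hx => ?_) (Nat.cast_nonneg g)
        refine mul_le_mul_of_nonneg_right ?_ (sq_nonneg _)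
        have hx' : x.1 ∈ l := by rw [← hLl]; exact List.mem_map_of_mem hx
        have h3 := hg x.1 hx'
        simp only [Commute.symm_iff (a := x.1)] at h3
        exact_mod_cast h3
    _ = g ^ 2 * (‖ψ‖ ^ 2 - ‖act (passOp l) ψ‖ ^ 2) := by
        rw [List.sum_map_mul_left, sum_sq_removed hl]
        ring

end Detectability

/-! ## The spectral gap -/

section Gap

variable {ι : Type} [Fintype ι] [DecidableEq ι]

theorem mem_eigenvalues {A : Op ι} {e : ℝ} :
    e ∈ eigenvalues A ↔ ∃ ψ : Ket ι, ψ ≠ 0 ∧ act A ψ = (e : ℂ) • ψ := by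
  rw [eigenvalues, Set.mem_ofPred_eq]
  constructor
  · intro h
    obtain ⟨v, hv⟩ := h.exists_hasEigenvector
    refine ⟨WithLp.toLp 2 v, fun h0 => hv.2 ?_, ?_⟩
    · exact congrArg WithLp.ofLp h0
    · exact congrArg (WithLp.toLp 2) hv.apply_eq_smul
  · rintro ⟨ψ, h0, h⟩
    refine Module.End.hasEigenvalue_of_hasEigenvector (x := ψ.ofLp) ⟨?_, fun h1 => h0 ?_⟩
    · rw [Module.End.mem_eigenspace_iff]
      exact congrArg WithLp.ofLp h
    · exact congrArg (WithLp.toLp 2) h1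

theorem finite_eigenvalues (A : Op ι) : (eigenvalues A).Finite := by
  have h := Module.End.finite_hasEigenvalue (Matrix.toLin' A)
  exact h.preimage (Complex.ofReal_injective.injOn)

/-- The gap exists as soon as there are two eigenvalues. -/
theorem spectralGap_mem {A : Op ι} {e e' : ℝ} (he : IsLeast (eigenvalues A) e)
    (he' : e' ∈ eigenvalues A) (hne : e' ≠ e) :
    0 < spectralGap A ∧ e + spectralGap A ∈ eigenvalues A := by
  have hset : {d | 0 < d ∧ ∃ e₀, IsLeast (eigenvalues A) e₀ ∧ e₀ + d ∈ eigenvalues A} =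
      {d | 0 < d ∧ e + d ∈ eigenvalues A} := by
    ext d
    constructor
    · rintro ⟨hd, e₀, h0, h1⟩
      exact ⟨hd, he.unique h0 ▸ h1⟩
    · rintro ⟨hd, h1⟩
      exact ⟨hd, e, he, h1⟩
  rw [spectralGap, hset]
  refine Set.Nonempty.csInf_mem (s := {d | 0 < d ∧ e + d ∈ eigenvalues A})
    ⟨e' - e, ?_, by simpa using he'⟩ ?_
  · have := he.2 he'
    exact sub_pos.mpr (lt_of_le_of_ne this hne.symm)
  · refine ((finite_eigenvalues A).preimage (add_right_injective e).injOn).subset ?_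
    exact fun d hd => hd.2

theorem spectralGap_le {A : Op ι} {e d : ℝ} (he : IsLeast (eigenvalues A) e) (hd : 0 < d)
    (h : e + d ∈ eigenvalues A) : spectralGap A ≤ d :=
  csInf_le ⟨0, fun _ hx => hx.1.le⟩ ⟨hd, e, he, h⟩

/-- In an eigenbasis, a vector orthogonal to the kernel has components only at positive eigenvalues,
each of which is at least the gap. -/
theorem spectralGap_mul_norm_sq_le {A : Op ι} (hA : A.IsHermitian)
    (h0 : IsLeast (eigenvalues A) 0) {ψ : Ket ι}
    (hψ : ∀ χ : Ket ι, act A χ = 0 → inner ℂ χ ψ = 0) :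
    spectralGap A * ‖ψ‖ ^ 2 ≤ RCLike.re (inner ℂ ψ (act A ψ)) := by
  set b := hA.eigenvectorBasis
  have hb : ∀ i, act A (b i) = (hA.eigenvalues i : ℂ) • b i := by
    intro i
    exact congrArg (WithLp.toLp 2) (hA.mulVec_eigenvectorBasis i)
  have h1 : inner ℂ ψ (act A ψ) = ((∑ i, hA.eigenvalues i * ‖inner ℂ (b i) ψ‖ ^ 2 : ℝ) : ℂ) := by
    rw [← b.sum_inner_mul_inner]
    push_cast
    refine Finset.sum_congr rfl fun i _ => ?_
    have h2 : inner ℂ (b i) (act A ψ) = (hA.eigenvalues i : ℂ) * inner ℂ (b i) ψ := by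
      have h3 : inner ℂ (act A (b i)) ψ = inner ℂ (b i) (act A ψ) := by rw [inner_act, hA.eq]
      rw [← h3, hb, inner_smul_left, Complex.conj_ofReal]
    rw [h2, mul_left_comm, ← inner_conj_symm ψ (b i), RCLike.conj_mul]
    rfl
  rw [h1, ← b.sum_sq_norm_inner_right ψ, Finset.mul_sum]
  change _ ≤ (((∑ i, hA.eigenvalues i * ‖inner ℂ (b i) ψ‖ ^ 2 : ℝ) : ℂ)).re
  rw [Complex.ofReal_re]
  refine Finset.sum_le_sum fun i _ => ?_
  have hmem : hA.eigenvalues i ∈ eigenvalues A :=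
    mem_eigenvalues.mpr ⟨b i, b.orthonormal.ne_zero i, hb i⟩
  rcases (h0.2 hmem).eq_or_lt with h | h
  · have : inner ℂ (b i) ψ = 0 := hψ _ (by rw [hb, ← h]; simp)
    simp [this]
  · exact mul_le_mul_of_nonneg_right (spectralGap_le h0 h (by simpa using hmem)) (sq_nonneg _)

end Gap


/-! ## The gaps of a formula and of its restrictions -/

theorem isHermitian_hamiltonian {n : ℕ} (θ : ℝ) (φ : Formula n) :
    (hamiltonian θ φ).IsHermitian := by
  induction φ with
  | nil => simp [hamiltonian]
  | cons c φ ih =>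
    simp only [hamiltonian, List.map_cons, List.sum_cons] at ih ⊢
    exact Matrix.IsHermitian.add (isStarProjection_clauseProj θ c).isSelfAdjoint ih

theorem Sat.sublist {n : ℕ} {φ l : Formula n} (h : l.Sublist φ) {x : Assignment n}
    (hx : Sat φ x) : Sat l x := fun c hc => hx c (h.subset hc)

/-- A satisfiable formula has the ground state energy `0`. -/
theorem isLeast_eigenvalues_hamiltonian {n : ℕ} (θ : ℝ) {φ : Formula n}
    (hφ : ∃ x, Sat φ x) : IsLeast (eigenvalues (hamiltonian θ φ)) 0 := by
  constructor
  · obtain ⟨x, hx⟩ := hφ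
    refine mem_eigenvalues.mpr ⟨encKet θ x, ?_, ?_⟩
    · rw [← norm_ne_zero_iff, norm_encKet]
      exact one_ne_zero
    · rw [show act (hamiltonian θ φ) (encKet θ x) = 0 from encKet_mem_groundSpace θ hx]
      simp
  · intro e he
    obtain ⟨ψ, h0, h⟩ := mem_eigenvalues.mp he
    have h1 := inner_hamiltonian θ φ ψ
    rw [h, inner_smul_right, inner_self_eq_norm_sq_to_K] at h1
    have h2 : e * ‖ψ‖ ^ 2 = (φ.map fun c => ‖act (clauseProj θ c) ψ‖ ^ 2).sum := by
      apply Complex.ofReal_injective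
      rw [← h1]
      push_cast
      rfl
    have h3 : 0 ≤ (φ.map fun c => ‖act (clauseProj θ c) ψ‖ ^ 2).sum := by
      refine List.sum_nonneg fun a ha => ?_
      obtain ⟨x, -, rfl⟩ := List.mem_map.mp ha
      positivity
    have h4 : 0 < ‖ψ‖ ^ 2 := by positivity
    by_contra hneg
    nlinarith [not_le.mp hneg]

/-- A product state in the range of the clause projector. -/
def clauseKet {n : ℕ} (θ : ℝ) (c : Clause n) : Ket (Assignment n) :=
  tensorKet fun i => perpQubit θ ((c i).getD true)

theorem clauseKet_ne_zero {n : ℕ} (θ : ℝ) (c : Clause n) : clauseKet θ c ≠ 0 := by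
  rw [← norm_ne_zero_iff, norm_eq_one_of_inner_self]
  · exact one_ne_zero
  · rw [clauseKet, inner_tensorKet]
    exact Finset.prod_eq_one fun i _ => sum_perpQubit_perpQubit _ _

theorem act_clauseProj_clauseKet {n : ℕ} (θ : ℝ) (c : Clause n) :
    act (clauseProj θ c) (clauseKet θ c) = clauseKet θ c := by
  rw [clauseProj_eq_tensorOp, clauseKet, act_tensorOp_tensorKet]
  congr 1
  funext i
  cases hci : c i with
  | none => simp [litOp]
  | some s => rw [litOp, ketbra_mulVec, Option.getD_some, sum_perpQubit_perpQubit, one_smul]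

/-- The gap of a nonempty satisfiable formula is a positive eigenvalue. -/
theorem spectralGap_hamiltonian_mem {n : ℕ} (θ : ℝ) {φ : Formula n} (hne : φ ≠ [])
    (hφ : ∃ x, Sat φ x) : 0 < spectralGap (hamiltonian θ φ) ∧
      spectralGap (hamiltonian θ φ) ∈ eigenvalues (hamiltonian θ φ) := by
  have h0 := isLeast_eigenvalues_hamiltonian θ hφ
  obtain ⟨e, he, hne0⟩ : ∃ e ∈ eigenvalues (hamiltonian θ φ), e ≠ 0 := by
    -- Were all eigenvalues zero, the Hermitian matrix would vanish, and the product state in the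
    -- range of a clause projector would be a ground state.
    by_contra hcon
    push Not at hcon
    have hA := isHermitian_hamiltonian θ φ
    have hz : hA.eigenvalues = 0 := by
      funext i
      refine hcon _ (mem_eigenvalues.mpr ⟨hA.eigenvectorBasis i,
        hA.eigenvectorBasis.orthonormal.ne_zero i, ?_⟩)
      exact congrArg (WithLp.toLp 2) (hA.mulVec_eigenvectorBasis i)
    have hzero := hA.eigenvalues_eq_zero_iff.mp hz
    obtain ⟨c, hc⟩ := List.exists_mem_of_ne_nil φ hne
    have hmem : clauseKet θ c ∈ groundSpace θ φ := by
      change act (hamiltonian θ φ) _ = 0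
      rw [hzero, act_zero]
    have := mem_groundSpace.mp hmem c hc
    rw [act_clauseProj_clauseKet] at this
    exact clauseKet_ne_zero θ c this
  have := spectralGap_mem h0 he hne0
  rwa [zero_add] at this

/-- The gaps of all nonempty subformulas are at least `Δ`. -/
def GapAtLeast {n : ℕ} (Δ θ : ℝ) (φ : Formula n) : Prop :=
  ∀ l : Formula n, l.Sublist φ → l ≠ [] → Δ ≤ spectralGap (hamiltonian θ l)

theorem hamiltonian_eq_sum {n : ℕ} (θ : ℝ) (l : Formula n) :
    hamiltonian θ l = ∑ i : Fin l.length, clauseProj θ (l.get i) := by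
  rw [hamiltonian, ← List.sum_ofFn]
  congr 1
  conv_lhs => rw [← List.ofFn_get l, List.map_ofFn]
  rfl

/-- Index sets and sublists describe the same subformulas; sublists are more convenient because they
pass through `filter` and `map` when a variable is fixed. -/
theorem gapAtLeast_uniformGap {n : ℕ} (θ : ℝ) (φ : Formula n) :
    GapAtLeast (uniformGap θ φ) θ φ := by
  intro l hl hne
  obtain ⟨f, hf⟩ := List.sublist_iff_exists_fin_orderEmbedding_get_eq.mp hl
  let I : Finset (Fin φ.length) := Finset.univ.map f.toEmbedding
  have hI : I.Nonempty := by
    have : 0 < l.length := List.length_pos_iff.mpr hne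
    exact ⟨f ⟨0, this⟩, by simp [I]⟩
  have h : hamiltonian θ l = ∑ i ∈ I, clauseProj θ (φ.get i) := by
    rw [hamiltonian_eq_sum, Finset.sum_map]
    exact Finset.sum_congr rfl fun i _ => by rw [hf i]; rfl
  rw [h]
  exact ciInf_le (Set.finite_range _).bddBelow
    (⟨I, hI⟩ : {I : Finset (Fin φ.length) // I.Nonempty})

theorem exists_sublist_uniformGap {n : ℕ} (θ : ℝ) {φ : Formula n} (hne : φ ≠ []) :
    ∃ l : Formula n, l.Sublist φ ∧ l ≠ [] ∧ uniformGap θ φ = spectralGap (hamiltonian θ l) := by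
  have hlen : 0 < φ.length := List.length_pos_iff.mpr hne
  have : Nonempty {I : Finset (Fin φ.length) // I.Nonempty} :=
    ⟨⟨{⟨0, hlen⟩}, Finset.singleton_nonempty _⟩⟩
  obtain ⟨⟨I, hI⟩, h⟩ := exists_eq_ciInf_of_finite
    (f := fun I : {I : Finset (Fin φ.length) // I.Nonempty} =>
      spectralGap (∑ i ∈ I.1, clauseProj θ (φ.get i)))
  let f := I.orderEmbOfFin rfl
  let l : Formula n := List.ofFn fun k => φ.get (f k)
  refine ⟨l, ?_, ?_, ?_⟩
  · refine List.sublist_iff_exists_fin_orderEmbedding_get_eq.mpr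
      ⟨(Fin.castOrderIso (by simp [l])).toOrderEmbedding.trans f, fun ix => ?_⟩
    simp [l]
    rfl
  · rw [← List.length_pos_iff]
    simpa [l] using hI
  · change _ = uniformGap θ φ at h
    rw [← h]
    congr 1
    rw [hamiltonian, List.map_ofFn, List.sum_ofFn]
    have : I = Finset.univ.map f.toEmbedding := (Finset.map_orderEmbOfFin_univ I rfl).symm
    change ∑ i ∈ I, clauseProj θ (φ.get i) = _
    conv_lhs => rw [this]
    rw [Finset.sum_map]
    rfl

theorem uniformGap_pos {n : ℕ} (θ : ℝ) {φ : Formula n} (hne : φ ≠ []) (hφ : ∃ x, Sat φ x) :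
    0 < uniformGap θ φ := by
  obtain ⟨l, hl, hlne, h⟩ := exists_sublist_uniformGap θ hne
  rw [h]
  exact (spectralGap_hamiltonian_mem θ hlne (hφ.imp fun x hx => hx.sublist hl)).1

/-- A single clause projector has the eigenvalue `1` above its ground energy `0`. -/
theorem uniformGap_le_one {n : ℕ} (θ : ℝ) {φ : Formula n} (hne : φ ≠ []) (hφ : ∃ x, Sat φ x) :
    uniformGap θ φ ≤ 1 := by
  obtain ⟨c, hc⟩ := List.exists_mem_of_ne_nil φ hne
  have hl : [c].Sublist φ := List.singleton_sublist.mpr hc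
  refine (gapAtLeast_uniformGap θ φ [c] hl (by simp)).trans ?_
  refine spectralGap_le (isLeast_eigenvalues_hamiltonian θ (hφ.imp fun x hx => hx.sublist hl))
    one_pos ?_
  refine mem_eigenvalues.mpr ⟨clauseKet θ c, clauseKet_ne_zero θ c, ?_⟩
  simp [hamiltonian, act_clauseProj_clauseKet]

/-- Every projector fails to commute with at most `g` members of the list. -/
def NoncommLe {n : ℕ} (θ : ℝ) (φ : Formula n) (g : ℕ) : Prop :=
  open Classical in
  ∀ c ∈ φ, (φ.countP fun d => ¬ Commute (clauseProj θ c) (clauseProj θ d)) ≤ g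

theorem card_filter_get {α : Type} (p : α → Prop) [DecidablePred p] (l : List α) :
    (Finset.univ.filter fun i : Fin l.length => p (l.get i)).card = l.countP p := by
  induction l with
  | nil => rfl
  | cons a l ih =>
    rw [List.countP_cons, ← ih]
    refine (Fin.card_filter_univ_succ' (n := l.length) _).trans ?_
    rw [add_comm]
    congr 1
    by_cases h : p a <;> simp [h]

/-- A projector commutes with itself, so the condition `j ≠ i` excludes nothing. -/
theorem NoncommBound.noncommLe {n : ℕ} {θ : ℝ} {φ : Formula n} {g : ℕ}
    (h : NoncommBound θ φ g) : NoncommLe θ φ g := by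
  classical
  intro c hc
  obtain ⟨i, rfl⟩ := List.get_of_mem hc
  have h1 := h i
  have h2 : {j : Fin φ.length | j ≠ i ∧
      ¬ Commute (clauseProj θ (φ.get i)) (clauseProj θ (φ.get j))} =
      ((Finset.univ.filter fun j : Fin φ.length =>
        ¬ Commute (clauseProj θ (φ.get i)) (clauseProj θ (φ.get j)) : Finset _) : Set _) := by
    ext j
    simp only [Set.mem_ofPred_eq, Finset.coe_filter, Finset.mem_univ, true_and]
    refine ⟨fun h => h.2, fun h => ⟨?_, h⟩⟩
    rintro rfl
    exact h (Commute.refl _)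
  rw [h2, Set.ncard_coe_finset,
    card_filter_get fun d => ¬ Commute (clauseProj θ (φ.get i)) (clauseProj θ d)] at h1
  convert h1

/-! ### Restrictions -/

/-- A qubit in front of a state. -/
def consKet {n : ℕ} (w : Bool → ℂ) (u : Ket (Assignment n)) : Ket (Assignment (n + 1)) :=
  WithLp.toLp 2 fun x => w (x 0) * u fun i => x i.succ

theorem sum_assignment_succ {n : ℕ} {M : Type} [AddCommMonoid M] (f : Assignment (n + 1) → M) :
    ∑ x, f x = ∑ b, ∑ x : Assignment n, f (Fin.cons b x) := by
  rw [← Fintype.sum_prod_type']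
  exact (Equiv.sum_comp (Fin.consEquiv fun _ : Fin (n + 1) => Bool) f).symm

theorem act_clauseProj_consKet {n : ℕ} (θ : ℝ) (c : Clause (n + 1)) (w : Bool → ℂ)
    (u : Ket (Assignment n)) :
    act (clauseProj θ c) (consKet w u) =
      consKet ((litOp θ (c 0)).mulVec w) (act (clauseProj θ fun i => c i.succ) u) := by
  ext x
  simp only [clauseProj_eq_tensorOp]
  rw [act_apply, sum_assignment_succ]
  simp only [consKet, tensorOp, Matrix.of_apply, Fin.prod_univ_succ, Fin.cons_zero, Fin.cons_succ,
    act_apply, Matrix.mulVec, dotProduct, Finset.sum_mul_sum]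
  refine Finset.sum_congr rfl fun b _ => Finset.sum_congr rfl fun y _ => ?_
  ring

/-- A clause without the literal `s` on the first variable has there either no literal or the
opposite one. Both the identity and the projector of the opposite literal fix `perpQubit θ (!s)`, so
only the restricted clause acts. -/
theorem act_clauseProj_consKet_of_ne {n : ℕ} {θ : ℝ} {c : Clause (n + 1)} {s : Bool}
    (hc : c 0 ≠ some s) (u : Ket (Assignment n)) :
    act (clauseProj θ c) (consKet (perpQubit θ (!s)) u) =
      consKet (perpQubit θ (!s)) (act (clauseProj θ fun i => c i.succ) u) := by
  rw [act_clauseProj_consKet]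
  congr 1
  cases hc0 : c 0 with
  | none => simp [litOp]
  | some t =>
    have : t = !s := by
      rw [hc0] at hc
      cases s <;> cases t <;> simp_all
    rw [this, litOp, ketbra_mulVec, sum_perpQubit_perpQubit, one_smul]

theorem consKet_perpQubit_injective {n : ℕ} (θ : ℝ) (s : Bool) :
    Function.Injective (consKet (n := n) (perpQubit θ s)) := by
  intro u v huv
  obtain ⟨b, hb⟩ : ∃ b, perpQubit θ s b ≠ 0 := by
    by_contra hcon
    push Not at hcon
    simpa [hcon] using sum_perpQubit_perpQubit θ s
  ext x
  have := congrArg (fun ψ : Ket (Assignment (n + 1)) => ψ (Fin.cons b x)) huv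
  simp only [consKet, Fin.cons_zero, Fin.cons_succ] at this
  exact mul_left_cancel₀ hb this

theorem consKet_add {n : ℕ} (w : Bool → ℂ) (u v : Ket (Assignment n)) :
    consKet w (u + v) = consKet w u + consKet w v := by
  ext x; simp [consKet, mul_add]

theorem consKet_smul {n : ℕ} (w : Bool → ℂ) (a : ℂ) (u : Ket (Assignment n)) :
    consKet w (a • u) = a • consKet w u := by
  ext x; simp [consKet, mul_left_comm]

theorem act_hamiltonian_consKet {n : ℕ} {θ : ℝ} {s : Bool} (l : Formula (n + 1))
    (hl : ∀ c ∈ l, c 0 ≠ some s) (u : Ket (Assignment n)) :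
    act (hamiltonian θ l) (consKet (perpQubit θ (!s)) u) =
      consKet (perpQubit θ (!s)) (act (hamiltonian θ (l.map fun c i => c i.succ)) u) := by
  induction l with
  | nil =>
    simp only [hamiltonian, List.map_nil, List.sum_nil, act_zero]
    ext x; simp [consKet]
  | cons c l ih =>
    simp only [hamiltonian, List.map_cons, List.sum_cons] at ih ⊢
    rw [act_add, act_add, consKet_add, ih fun d hd => hl d (by simp [hd]),
      act_clauseProj_consKet_of_ne (hl c (by simp))]

theorem assign_eq_map_filter {n : ℕ} (φ : Formula (n + 1)) (s : Bool) :
    φ.assign s = (φ.filter fun c => c 0 ≠ some s).map fun c i => c i.succ := by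
  induction φ with
  | nil => rfl
  | cons c φ ih =>
    rw [Formula.assign] at ih ⊢
    rw [List.filterMap_cons, ih, List.filter_cons]
    by_cases h : c 0 = some s <;> simp [h]

theorem sat_assign_iff {n : ℕ} {φ : Formula (n + 1)} {s : Bool} {x : Assignment n} :
    Sat (φ.assign s) x ↔ Sat φ (Fin.cons s x) := by
  simp only [Sat, assign_eq_map_filter, List.mem_map, List.mem_filter, decide_eq_true_eq]
  constructor
  · intro h c hc
    by_cases h0 : c 0 = some s
    · exact ⟨0, h0⟩
    · obtain ⟨i, hi⟩ := h _ ⟨c, ⟨hc, h0⟩, rfl⟩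
      exact ⟨i.succ, hi⟩
  · rintro h _ ⟨c, ⟨hc, h0⟩, rfl⟩
    obtain ⟨i, hi⟩ := h c hc
    refine Fin.cases (fun h1 => absurd h1 h0) (fun j hj => ⟨j, hj⟩) i hi

/-- Lift a subformula of the restriction to clauses of `φ` that survive the assignment. Prefixing
`perpQubit θ (!s)` turns eigenvectors of the restricted Hamiltonian into eigenvectors of the lifted
one with the same eigenvalue. Satisfiability gives both ground energies the value `0`, so the gap of
the restriction is a positive eigenvalue upstairs and bounds the gap there from above. -/
theorem GapAtLeast.assign {n : ℕ} {Δ θ : ℝ} {φ : Formula (n + 1)} (h : GapAtLeast Δ θ φ)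
    {s : Bool} (hs : ∃ x, Sat (φ.assign s) x) : GapAtLeast Δ θ (φ.assign s) := by
  intro l hl hne
  have hsat : ∃ x, Sat l x := hs.imp fun x hx => hx.sublist hl
  rw [assign_eq_map_filter] at hl
  obtain ⟨l', hl', rfl⟩ := List.sublist_map_iff.mp hl
  have hmem : ∀ c ∈ l', c 0 ≠ some s := fun c hc => by
    simpa using (List.mem_filter.mp (hl'.subset hc)).2
  have hsub : l'.Sublist φ := hl'.trans List.filter_sublist
  refine (h l' hsub (by rintro rfl; exact hne rfl)).trans ?_
  have hsat' : ∃ x, Sat l' x := by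
    obtain ⟨x, hx⟩ := hs
    exact ⟨_, (sat_assign_iff.mp hx).sublist hsub⟩
  obtain ⟨hpos, hev⟩ := spectralGap_hamiltonian_mem θ hne hsat
  refine spectralGap_le (isLeast_eigenvalues_hamiltonian θ hsat') hpos ?_
  rw [zero_add]
  obtain ⟨u, hu0, hu⟩ := mem_eigenvalues.mp hev
  refine mem_eigenvalues.mpr ⟨consKet (perpQubit θ (!s)) u, fun h0 => hu0 ?_, ?_⟩
  · apply consKet_perpQubit_injective θ (!s)
    rw [h0]
    ext x; simp [consKet]
  · rw [act_hamiltonian_consKet l' hmem, hu, consKet_smul]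

theorem op_ext {ι : Type} [Fintype ι] [DecidableEq ι] {A B : Op ι}
    (h : ∀ ψ : Ket ι, act A ψ = act B ψ) : A = B := by
  have : act A = act B := ContinuousLinearMap.ext h
  exact (Matrix.toEuclideanCLM (𝕜 := ℂ)).injective this

/-- The prefix map is injective and intertwines the restricted projectors with the original ones, so
commutation descends. -/
theorem commute_clauseProj_succ {n : ℕ} {θ : ℝ} {c d : Clause (n + 1)} {s : Bool}
    (hc : c 0 ≠ some s) (hd : d 0 ≠ some s) (h : Commute (clauseProj θ c) (clauseProj θ d)) :
    Commute (clauseProj θ fun i => c i.succ) (clauseProj θ fun i => d i.succ) := by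
  refine op_ext fun ψ => consKet_perpQubit_injective θ (!s) ?_
  rw [act_mul, act_mul, ← act_clauseProj_consKet_of_ne hc, ← act_clauseProj_consKet_of_ne hd,
    ← act_clauseProj_consKet_of_ne hd, ← act_clauseProj_consKet_of_ne hc, ← act_mul, h.eq, act_mul]

theorem NoncommLe.assign {n : ℕ} {θ : ℝ} {φ : Formula (n + 1)} {g : ℕ} (h : NoncommLe θ φ g)
    (s : Bool) : NoncommLe θ (φ.assign s) g := by
  intro c' hc'
  rw [assign_eq_map_filter] at hc' ⊢
  obtain ⟨c, hc, rfl⟩ := List.mem_map.mp hc'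
  obtain ⟨hcφ, hc0⟩ := List.mem_filter.mp hc
  refine le_trans ?_ (h c hcφ)
  rw [List.countP_map, List.countP_filter]
  refine List.countP_mono_left fun d _ hd => ?_
  simp only [Function.comp_apply, Bool.and_eq_true, decide_eq_true_eq] at hd hc0 ⊢
  exact fun hcomm => hd.1 (commute_clauseProj_succ hc0 hd.2 hcomm)


/-! ## Layers and the speed of convergence -/

/-- Empty layers are kept as trivial checks, so the cost of a cycle depends only on the number of
bit strings. -/
theorem length_layers {n : ℕ} (B : List (Assignment n)) (φ : Formula n) :
    (layers B φ).length = B.length := by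
  induction B generalizing φ with
  | nil => rfl
  | cons b B ih => simp [layers, ih]

theorem flatten_layers_perm {n : ℕ} (B : List (Assignment n)) (φ : Formula n)
    (h : ∀ c ∈ φ, ∃ b ∈ B, compatible b c = true) : (layers B φ).flatten.Perm φ := by
  induction B generalizing φ with
  | nil =>
    cases φ with
    | nil => exact List.Perm.refl _
    | cons c φ => simpa using h c (by simp)
  | cons b B ih =>
    rw [layers, List.flatten_cons]
    refine (List.Perm.append_left _ (ih _ fun c hc => ?_)).trans
      (List.filter_append_perm (compatible b) φ)
    obtain ⟨hcφ, hcb⟩ := List.mem_filter.mp hc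
    obtain ⟨b', hb', hb'c⟩ := h c hcφ
    rcases List.mem_cons.mp hb' with rfl | hb'
    · simp [hb'c] at hcb
    · exact ⟨b', hb', hb'c⟩

theorem exists_compatible_of_mem_layers {n : ℕ} {B : List (Assignment n)} {φ l : Formula n}
    (hl : l ∈ layers B φ) : ∃ b, ∀ c ∈ l, compatible b c = true := by
  induction B generalizing φ with
  | nil => simp [layers] at hl
  | cons b B ih =>
    rcases List.mem_cons.mp hl with rfl | hl
    · exact ⟨b, fun c hc => (List.mem_filter.mp hc).2⟩
    · exact ih hl

theorem isStarProjection_layerCheck {n : ℕ} (θ : ℝ) (l : Formula n)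
    (h : ∀ c ∈ l, ∀ d ∈ l, Commute (clauseProj θ c) (clauseProj θ d)) :
    IsStarProjection (layerCheck θ l) := by
  induction l with
  | nil => exact .one _
  | cons c l ih =>
    rw [layerCheck, List.map_cons, List.prod_cons]
    refine (isStarProjection_clauseProj θ c).one_sub.mul
      (ih fun d hd e he => h d (by simp [hd]) e (by simp [he])) ?_
    refine Commute.list_prod_right _ _ fun A hA => ?_
    obtain ⟨d, hd, rfl⟩ := List.mem_map.mp hA
    have hcd := h c (by simp) d (by simp [hd])
    exact (Commute.sub_right (Commute.one_right _)
      (Commute.sub_left (Commute.one_left _) hcd))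

theorem isStarProjection_of_mem_cycleChecks {n : ℕ} {θ : ℝ} {B : List (Assignment n)}
    {φ : Formula n} {Q : Op (Assignment n)} (hQ : Q ∈ cycleChecks θ B φ) :
    IsStarProjection Q := by
  obtain ⟨l, hl, rfl⟩ := List.mem_map.mp hQ
  obtain ⟨b, hb⟩ := exists_compatible_of_mem_layers hl
  exact isStarProjection_layerCheck θ l fun c hc d hd => commute_of_compatible θ (hb c hc) (hb d hd)

/-- The first check acts first and so stands on the right, whence the reversal. Afterwards the
layers are irrelevant: the analysis sees only some ordering of all clause projectors. -/
theorem cycleOp_eq_passOp {n : ℕ} (θ : ℝ) (B : List (Assignment n)) (φ : Formula n) :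
    cycleOp θ B φ = passOp ((layers B φ).reverse.flatten.map (clauseProj θ)) := by
  rw [cycleOp, cycleChecks, passOp, List.map_map, List.map_flatten, List.prod_flatten,
    List.map_map, List.map_reverse]
  rfl

/-- What the analysis needs to know about a formula and the bit strings of its layers. -/
structure Admissible {n : ℕ} (θ Δ : ℝ) (g : ℕ) (B : List (Assignment n)) (φ : Formula n) :
    Prop where
  sat : ∃ x, Sat φ x
  gap : GapAtLeast Δ θ φ
  noncomm : NoncommLe θ φ g
  cover : ∀ c ∈ φ, ∃ b ∈ B, compatible b c = true

theorem Admissible.assign {n : ℕ} {θ Δ : ℝ} {g : ℕ} {B : List (Assignment (n + 1))}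
    {φ : Formula (n + 1)} (h : Admissible θ Δ g B φ) {s : Bool}
    (hs : ∃ x, Sat φ x ∧ x 0 = s) :
    Admissible θ Δ g (B.map fun b i => b i.succ) (φ.assign s) := by
  have hsat : ∃ x, Sat (φ.assign s) x := by
    obtain ⟨x, hx, rfl⟩ := hs
    refine ⟨Fin.tail x, sat_assign_iff.mpr ?_⟩
    rwa [Fin.cons_self_tail]
  refine ⟨hsat, h.gap.assign hsat, h.noncomm.assign s, fun c' hc' => ?_⟩
  rw [assign_eq_map_filter] at hc'
  obtain ⟨c, hc, rfl⟩ := List.mem_map.mp hc'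
  obtain ⟨b, hb, hbc⟩ := h.cover c (List.mem_filter.mp hc).1
  refine ⟨_, List.mem_map_of_mem hb, ?_⟩
  simp only [compatible, decide_eq_true_eq] at hbc ⊢
  exact fun i => hbc i.succ

theorem act_passOp_of_mem_groundSpace {n : ℕ} {θ : ℝ} {φ l : Formula n} (hl : ∀ c ∈ l, c ∈ φ)
    {ψ : Ket (Assignment n)} (hψ : ψ ∈ groundSpace θ φ) :
    act (passOp (l.map (clauseProj θ))) ψ = ψ := by
  induction l with
  | nil => simp [passOp]
  | cons c l ih =>
    rw [List.map_cons, act_passOp_cons, ih fun d hd => hl d (by simp [hd]), act_sub, act_one,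
      mem_groundSpace.mp hψ c (hl c (by simp)), sub_zero]

theorem inner_act_passOp {n : ℕ} {θ : ℝ} {φ l : Formula n} (hl : ∀ c ∈ l, c ∈ φ)
    {ψ : Ket (Assignment n)} (hψ : ψ ∈ groundSpace θ φ) (χ : Ket (Assignment n)) :
    inner ℂ ψ (act (passOp (l.map (clauseProj θ))) χ) = inner ℂ ψ χ := by
  induction l with
  | nil => simp [passOp]
  | cons c l ih =>
    rw [List.map_cons, act_passOp_cons, act_sub, act_one, inner_sub_right,
      ← (isStarProjection_clauseProj θ c).inner_act, mem_groundSpace.mp hψ c (hl c (by simp)),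
      inner_zero_left, sub_zero, ih fun d hd => hl d (by simp [hd])]

theorem Admissible.mem_layers {n : ℕ} {θ Δ : ℝ} {g : ℕ} {B : List (Assignment n)}
    {φ : Formula n} (h : Admissible θ Δ g B φ) : (layers B φ).reverse.flatten.Perm φ :=
  ((List.reverse_perm _).flatten).trans (flatten_layers_perm B φ h.cover)

section

variable {n : ℕ} {θ Δ : ℝ} {g : ℕ} {B : List (Assignment n)} {φ : Formula n}

theorem Admissible.act_cycleOp (h : Admissible θ Δ g B φ) {ψ : Ket (Assignment n)}
    (hψ : ψ ∈ groundSpace θ φ) : act (cycleOp θ B φ) ψ = ψ := by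
  rw [cycleOp_eq_passOp]
  exact act_passOp_of_mem_groundSpace (fun c hc => h.mem_layers.subset hc) hψ

theorem Admissible.act_cycleOp_mem (h : Admissible θ Δ g B φ) {χ : Ket (Assignment n)}
    (hχ : χ ∈ (groundSpace θ φ)ᗮ) : act (cycleOp θ B φ) χ ∈ (groundSpace θ φ)ᗮ := by
  rw [Submodule.mem_orthogonal] at hχ ⊢
  intro ψ hψ
  rw [cycleOp_eq_passOp, inner_act_passOp (fun c hc => h.mem_layers.subset hc) hψ, hχ ψ hψ]

/-- One cycle contracts the states orthogonal to the ground space. -/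
theorem Admissible.norm_sq_act_cycleOp_le (h : Admissible θ Δ g B φ)
    (hg : 1 ≤ g) {χ : Ket (Assignment n)} (hχ : χ ∈ (groundSpace θ φ)ᗮ) :
    (1 + Δ / g ^ 2) * ‖act (cycleOp θ B φ) χ‖ ^ 2 ≤ ‖χ‖ ^ 2 := by
  classical
  -- Restrictions may leave no clauses. The gap condition is then void, but the ground space is
  -- everything and `χ = 0`.
  rcases eq_or_ne φ [] with rfl | hne
  · have htop : χ ∈ groundSpace θ ([] : Formula n) := by simp [mem_groundSpace]
    have h0 : χ = 0 := by
      have := (Submodule.mem_orthogonal _ _).mp hχ χ htop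
      exact inner_self_eq_zero.mp this
    simp [h0]
  have hT := h.act_cycleOp_mem hχ
  set χ' := act (cycleOp θ B φ) χ with hχ'
  have h1 : spectralGap (hamiltonian θ φ) * ‖χ'‖ ^ 2 ≤
      RCLike.re (inner ℂ χ' (act (hamiltonian θ φ) χ')) :=
    spectralGap_mul_norm_sq_le (isHermitian_hamiltonian θ φ)
      (isLeast_eigenvalues_hamiltonian θ h.sat) fun v hv =>
        (Submodule.mem_orthogonal _ _).mp hT v hv
  rw [inner_hamiltonian, RCLike.re_eq_complex_re, Complex.ofReal_re] at h1
  have hperm := h.mem_layers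
  have h2 : (φ.map fun c => ‖act (clauseProj θ c) χ'‖ ^ 2).sum ≤
      (g : ℝ) ^ 2 * (‖χ‖ ^ 2 - ‖χ'‖ ^ 2) := by
    have h3 := sum_sq_act_passOp_le (l := (layers B φ).reverse.flatten.map (clauseProj θ))
      (fun P hP => by
        obtain ⟨c, -, rfl⟩ := List.mem_map.mp hP
        exact isStarProjection_clauseProj θ c) (g := g) (fun P hP => by
        obtain ⟨c, hc, rfl⟩ := List.mem_map.mp hP
        rw [List.countP_map, hperm.countP_eq]
        exact h.noncomm c (hperm.subset hc)) χ
    rw [← cycleOp_eq_passOp, ← hχ', List.map_map, (hperm.map _).sum_eq] at h3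
    exact h3
  -- The energy of `χ'` is squeezed between the gap bound, available because `χ'` stays orthogonal
  -- to the ground space, and the detectability bound.
  have h3 : Δ * ‖χ'‖ ^ 2 ≤ (g : ℝ) ^ 2 * (‖χ‖ ^ 2 - ‖χ'‖ ^ 2) :=
    (mul_le_mul_of_nonneg_right (h.gap φ (List.Sublist.refl _) hne) (sq_nonneg _)).trans
      (h1.trans h2)
  have hg2 : (0 : ℝ) < (g : ℝ) ^ 2 := by
    have : (1 : ℝ) ≤ g := by exact_mod_cast hg
    positivity
  have h4 : Δ / g ^ 2 * ‖χ'‖ ^ 2 ≤ ‖χ‖ ^ 2 - ‖χ'‖ ^ 2 := by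
    rw [div_mul_eq_mul_div, div_le_iff₀ hg2]
    linarith
  linarith

/-- `T - P_GS` annihilates the ground component, so it acts as `T` on the orthogonal part, where the
contraction applies. -/
theorem Admissible.rate_sq_le (h : Admissible θ Δ g B φ) (hΔ : 0 < Δ) (hg : 1 ≤ g) :
    rate θ B φ ^ 2 ≤ (1 + Δ / g ^ 2)⁻¹ := by
  have hpos : 0 < 1 + Δ / (g : ℝ) ^ 2 := by positivity
  have hle : rate θ B φ ≤ Real.sqrt ((1 + Δ / g ^ 2)⁻¹) := by
    refine ContinuousLinearMap.opNorm_le_bound _ (Real.sqrt_nonneg _) fun ψ => ?_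
    set u := (groundSpace θ φ).starProjection ψ with hu
    have hmem : u ∈ groundSpace θ φ := Submodule.starProjection_apply_mem _ _
    have hχ : ψ - u ∈ (groundSpace θ φ)ᗮ := Submodule.sub_starProjection_mem_orthogonal _
    have h1 : (act (cycleOp θ B φ) - (groundSpace θ φ).starProjection) ψ =
        act (cycleOp θ B φ) (ψ - u) := by
      rw [sub_apply, map_sub, h.act_cycleOp hmem]
    have h2 := h.norm_sq_act_cycleOp_le hg hχ
    have h3 : ‖ψ - u‖ ^ 2 ≤ ‖ψ‖ ^ 2 := by
      have h4 : inner ℂ u (ψ - u) = 0 := (Submodule.mem_orthogonal _ _).mp hχ u hmem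
      have h5 := norm_add_sq_eq_norm_sq_add_norm_sq_of_inner_eq_zero _ _ h4
      rw [add_sub_cancel] at h5
      nlinarith [norm_nonneg u]
    rw [h1]
    refine abs_le_of_sq_le_sq' ?_ (by positivity) |>.2
    rw [mul_pow, Real.sq_sqrt (by positivity), inv_mul_eq_div, le_div_iff₀ hpos]
    linarith
  calc rate θ B φ ^ 2 ≤ Real.sqrt ((1 + Δ / g ^ 2)⁻¹) ^ 2 :=
        pow_le_pow_left₀ (norm_nonneg _) hle 2
    _ = _ := Real.sq_sqrt (by positivity)

theorem rate_nonneg : 0 ≤ rate θ B φ := norm_nonneg _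

/-- The logarithmic speed of convergence is at least `Δ / (4 g²)`. -/
theorem Admissible.le_log_inv_rate (h : Admissible θ Δ g B φ) (hΔ : 0 < Δ) (hΔ1 : Δ ≤ 1)
    (hg : 1 ≤ g) (hr : 0 < rate θ B φ) : Δ / (4 * (g : ℝ) ^ 2) ≤ Real.log (rate θ B φ)⁻¹ := by
  have hg1 : (1 : ℝ) ≤ (g : ℝ) ^ 2 := by
    have : (1 : ℝ) ≤ g := by exact_mod_cast hg
    nlinarith
  set x := Δ / (g : ℝ) ^ 2 with hx
  have hx0 : 0 < x := by positivity
  have hx1 : x ≤ 1 := by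
    rw [hx, div_le_one (by positivity)]
    linarith
  have h1 : Real.log (rate θ B φ ^ 2) ≤ Real.log ((1 + x)⁻¹) :=
    Real.log_le_log (by positivity) (h.rate_sq_le hΔ hg)
  have h2 : Real.log ((1 + x)⁻¹) ≤ (1 + x)⁻¹ - 1 :=
    Real.log_le_sub_one_of_pos (by positivity)
  -- This uses `x ≤ 1`. The `4` in the final rate is this factor `2` times the `2` from bounding
  -- `μ²` rather than `μ`.
  have h3 : (1 + x)⁻¹ - 1 ≤ -(x / 2) := by
    rw [sub_le_iff_le_add, inv_le_comm₀ (by positivity) (by linarith)]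
    rw [inv_le_iff_one_le_mul₀ (by linarith)]
    nlinarith
  rw [Real.log_pow] at h1
  rw [Real.log_inv]
  have h4 : Δ / (4 * (g : ℝ) ^ 2) = x / 4 := by rw [hx]; field_simp
  rw [h4]
  push_cast at h1
  linarith

theorem Admissible.rate_lt_one (h : Admissible θ Δ g B φ) (hΔ : 0 < Δ) (hg : 1 ≤ g) :
    rate θ B φ < 1 := by
  have h1 := h.rate_sq_le hΔ hg
  have h0 : (0 : ℝ) < g := by exact_mod_cast hg
  have h2 : (1 + Δ / (g : ℝ) ^ 2)⁻¹ < 1 := inv_lt_one_of_one_lt₀ (by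
    have : 0 < Δ / (g : ℝ) ^ 2 := by positivity
    linarith)
  nlinarith [rate_nonneg (θ := θ) (B := B) (φ := φ)]

theorem Admissible.norm_act_cycleOp_pow_le (h : Admissible θ Δ g B φ) {χ : Ket (Assignment n)}
    (hχ : χ ∈ (groundSpace θ φ)ᗮ) (r : ℕ) :
    ‖act (cycleOp θ B φ ^ r) χ‖ ≤ rate θ B φ ^ r * ‖χ‖ ∧
      act (cycleOp θ B φ ^ r) χ ∈ (groundSpace θ φ)ᗮ := by
  induction r with
  | zero => simpa using hχ
  | succ r ih =>
    rw [pow_succ', act_mul]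
    refine ⟨?_, h.act_cycleOp_mem ih.2⟩
    set χ' := act (cycleOp θ B φ ^ r) χ
    have h1 : act (cycleOp θ B φ) χ' =
        (act (cycleOp θ B φ) - (groundSpace θ φ).starProjection) χ' := by
      rw [sub_apply, (Submodule.starProjection_apply_eq_zero_iff _).mpr ih.2, sub_zero]
    rw [h1]
    refine (ContinuousLinearMap.le_opNorm _ _).trans ?_
    rw [pow_succ', mul_assoc]
    exact mul_le_mul_of_nonneg_left ih.1 rate_nonneg

/-- The number of cycles suffices for the tolerance. -/
theorem Admissible.rate_pow_cycles_le (h : Admissible θ Δ g B φ) (hΔ : 0 < Δ) (hg : 1 ≤ g)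
    {ε : ℝ} (hε : 0 < ε * Real.cos (θ / 2) ^ n) :
    rate θ B φ ^ cycles θ B φ ε ≤ ε * Real.cos (θ / 2) ^ n := by
  have h1 : 1 ≤ cycles θ B φ ε := le_max_left _ _
  -- For `μ = 0` the logarithms take default values and say nothing; the `max 1` in `cycles` ensures
  -- that `0 ^ r = 0`.
  rcases (rate_nonneg (θ := θ) (B := B) (φ := φ)).eq_or_lt with h0 | h0
  · rw [← h0, zero_pow (by omega)]
    exact hε.le
  have hlog : 0 < Real.log (rate θ B φ)⁻¹ :=
    Real.log_pos ((one_lt_inv₀ h0).mpr (h.rate_lt_one hΔ hg))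
  have h2 : Real.log (ε * Real.cos (θ / 2) ^ n)⁻¹ / Real.log (rate θ B φ)⁻¹ ≤
      cycles θ B φ ε :=
    (Nat.le_ceil _).trans (by exact_mod_cast le_max_right _ _)
  rw [div_le_iff₀ hlog, Real.log_inv, Real.log_inv] at h2
  rw [← Real.log_le_log_iff (by positivity) hε, Real.log_pow]
  linarith

theorem Admissible.cycles_le (h : Admissible θ Δ g B φ) (hΔ : 0 < Δ) (hΔ1 : Δ ≤ 1)
    (hg : 1 ≤ g) {ε : ℝ} (hε : 0 ≤ Real.log (ε * Real.cos (θ / 2) ^ n)⁻¹) :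
    (cycles θ B φ ε : ℝ) ≤
      1 + Real.log (ε * Real.cos (θ / 2) ^ n)⁻¹ / (Δ / (4 * (g : ℝ) ^ 2)) := by
  have hg0 : (0 : ℝ) < g := by exact_mod_cast hg
  have hd : 0 < Δ / (4 * (g : ℝ) ^ 2) := by positivity
  have hq : 0 ≤ Real.log (ε * Real.cos (θ / 2) ^ n)⁻¹ / (Δ / (4 * (g : ℝ) ^ 2)) :=
    div_nonneg hε hd.le
  rw [cycles, Nat.cast_max, Nat.cast_one, max_le_iff]
  refine ⟨by linarith, ?_⟩
  rcases (rate_nonneg (θ := θ) (B := B) (φ := φ)).eq_or_lt with h0 | h0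
  · rw [← h0]
    simp only [inv_zero, Real.log_zero, div_zero, Nat.ceil_zero, Nat.cast_zero]
    linarith
  have hl := h.le_log_inv_rate hΔ hΔ1 hg h0
  have h1 : Real.log (ε * Real.cos (θ / 2) ^ n)⁻¹ / Real.log (rate θ B φ)⁻¹ ≤
      Real.log (ε * Real.cos (θ / 2) ^ n)⁻¹ / (Δ / (4 * (g : ℝ) ^ 2)) :=
    div_le_div_of_nonneg_left hε hd hl
  have h2 := Nat.ceil_lt_add_one (div_nonneg hε (hd.le.trans hl))
  linarith

end


/-! ## One attempt at state preparation -/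

/-- A unit vector at distance at most `ε` from the ground space. -/
def NearGround {n : ℕ} (θ : ℝ) (φ : Formula n) (ε : ℝ) (ψ : Ket (Assignment n)) : Prop :=
  ‖ψ‖ = 1 ∧ ‖ψ - (groundSpace θ φ).starProjection ψ‖ ≤ ε

/-- An attempt makes at most `D` measurements and succeeds with probability at least `p`, with a
good result. -/
def AttemptSpec {α : Type} (A : Alg (Option α)) (D : ℕ) (p : ℝ) (good : α → Prop) : Prop :=
  ∀ t, D ≤ t → ∀ (f : Option α → ℕ → ℝ≥0∞) (X Y : ℝ), 0 ≤ X → X ≤ Y →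
    (∀ a s, good a → t ≤ s + D → f (some a) s ≤ ENNReal.ofReal X) →
    (∀ s, t ≤ s + D → f none s ≤ ENNReal.ofReal Y) →
    loss A t f ≤ ENNReal.ofReal (p * X + (1 - p) * Y)

theorem norm_normalized {ι : Type} [Fintype ι] {ψ : Ket ι} (h : ψ ≠ 0) : ‖normalized ψ‖ = 1 := by
  rw [normalized, norm_smul, Complex.norm_real, norm_inv, norm_norm,
    inv_mul_cancel₀ (norm_ne_zero_iff.mpr h)]

/-- Intermediate renormalizations are positive factors and do not affect the final normalized state.
-/
theorem normalized_smul {ι : Type} [Fintype ι] {a : ℝ} (ha : 0 < a) (ψ : Ket ι) :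
    normalized ((a : ℂ) • ψ) = normalized ψ := by
  rw [normalized, normalized, norm_smul, Complex.norm_real, Real.norm_eq_abs, abs_of_pos ha,
    smul_smul, ← Complex.ofReal_mul, mul_inv_rev, inv_mul_cancel_right₀ ha.ne']

theorem nearGround_normalized {n : ℕ} {θ ε : ℝ} {φ : Formula n} {ψ : Ket (Assignment n)}
    (h0 : ψ ≠ 0) (h : ‖ψ - (groundSpace θ φ).starProjection ψ‖ ≤ ε * ‖ψ‖) :
    NearGround θ φ ε (normalized ψ) := by
  refine ⟨norm_normalized h0, ?_⟩
  have hpos : 0 < ‖ψ‖ := norm_pos_iff.mpr h0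
  rw [normalized, map_smul, ← smul_sub, norm_smul, Complex.norm_real, norm_inv, norm_norm,
    inv_mul_le_iff₀ hpos, mul_comm]
  exact h

theorem sum_bool_weights {w : Bool → ℝ} (x : Bool → ℝ) :
    ∑ b, w b * x b = w true * x true + w false * x false := Fintype.sum_bool _

/-- The conditional passing probabilities telescope: passing all checks has as probability the
squared norm of the unnormalized product applied to `ψ`, and the outcome is the normalization of
that vector. -/
theorem loss_runChecks_le {n : ℕ} (L : List (Op (Assignment n)))
    (hL : ∀ Q ∈ L, IsStarProjection Q) (ψ : Ket (Assignment n)) (hψ : ‖ψ‖ = 1) (t : ℕ)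
    (ht : L.length ≤ t) (f : Option (Ket (Assignment n)) → ℕ → ℝ≥0∞) (X Y : ℝ)
    (hX : 0 ≤ X) (hXY : X ≤ Y)
    (h1 : ∀ s, act L.reverse.prod ψ ≠ 0 → t ≤ s + L.length →
      f (some (normalized (act L.reverse.prod ψ))) s ≤ ENNReal.ofReal X)
    (h0 : ∀ s, t ≤ s + L.length → f none s ≤ ENNReal.ofReal Y) :
    loss (runChecks L ψ) t f ≤
      ENNReal.ofReal (‖act L.reverse.prod ψ‖ ^ 2 * X + (1 - ‖act L.reverse.prod ψ‖ ^ 2) * Y) := by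
  induction L generalizing ψ t with
  | nil =>
    have hne : ψ ≠ 0 := by rintro rfl; simp at hψ
    have hn : normalized ψ = ψ := by rw [normalized, hψ]; simp
    have := h1 t (by simpa using hne) (by simp)
    simp only [List.reverse_nil, List.prod_nil, act_one, hn] at this ⊢
    rw [runChecks, loss_pure, hψ]
    simpa using this
  | cons Q L ih =>
    have hQ := hL Q (by simp)
    have hprod : ∀ χ : Ket (Assignment n),
        act (Q :: L).reverse.prod χ = act L.reverse.prod (act Q χ) := by
      intro χ
      rw [List.reverse_cons, List.prod_append, List.prod_singleton, act_mul]
    simp only [List.length_cons] at ht h1 h0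
    simp only [hprod] at h1 ⊢
    rw [runChecks, loss_bind, measureCheck, loss_bind, loss_tick, if_pos (by omega), loss_bind]
    have hw := hQ.norm_sq_add ψ
    rw [hψ, one_pow] at hw
    set q := ‖act Q ψ‖ ^ 2 with hq
    set v := act L.reverse.prod (act Q ψ) with hv
    -- Given that the first check passes, the others pass with probability `‖v‖² / q`.
    let Z : Bool → ℝ := fun b => if b then
      (‖v‖ ^ 2 / q) * X + (1 - ‖v‖ ^ 2 / q) * Y else Y
    have hvnorm : act Q ψ ≠ 0 → act L.reverse.prod (normalized (act Q ψ)) =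
        ((‖act Q ψ‖⁻¹ : ℝ) : ℂ) • v := by
      intro _
      rw [normalized, map_smul]
    have hvle : ∀ (l : List (Op (Assignment n))), (∀ P ∈ l, IsStarProjection P) →
        ∀ χ : Ket (Assignment n), ‖act l.prod χ‖ ≤ ‖χ‖ := by
      intro l
      induction l with
      | nil => simp
      | cons P l ih =>
        intro hl χ
        rw [List.prod_cons, act_mul]
        exact ((hl P (by simp)).norm_act_le _).trans (ih (fun R hR => hl R (by simp [hR])) χ)
    have hvQ : ‖v‖ ≤ ‖act Q ψ‖ :=
      hvle _ (fun P hP => hL P (by simp [List.mem_reverse.mp hP])) _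
    have hratio : ‖v‖ ^ 2 / q ≤ 1 := by
      refine div_le_one_of_le₀ ?_ (sq_nonneg _)
      exact pow_le_pow_left₀ (norm_nonneg _) hvQ 2
    have hr0 : 0 ≤ ‖v‖ ^ 2 / q := by positivity
    refine (loss_draw_sample_le (x := Z) ?_ ?_ (t - 1) _ ?_ ?_).trans ?_
    · intro b; split_ifs <;> positivity
    · simpa using hw
    · intro b hb
      rw [loss_pure]
      cases b with
      | false =>
        simp only [Bool.false_eq_true, if_false, loss_pure, Z]
        exact h0 _ (by omega)
      | true =>
        simp only [if_true, Z] at hb ⊢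
        have hne : act Q ψ ≠ 0 := by
          intro h
          exact hb (by rw [hq, h]; simp)
        have hpos : 0 < ‖act Q ψ‖ := norm_pos_iff.mpr hne
        have hih := ih (fun R hR => hL R (by simp [hR])) (normalized (act Q ψ))
          (norm_normalized hne) (t - 1) (by omega) (fun s hs hs' => by
            rw [hvnorm hne] at hs ⊢
            rw [normalized_smul (inv_pos.mpr hpos)]
            exact h1 s (fun h => hs (by rw [h, smul_zero])) (by omega))
          (fun s hs => h0 s (by omega))
        have hnv : ‖act L.reverse.prod (normalized (act Q ψ))‖ ^ 2 = ‖v‖ ^ 2 / q := by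
          rw [hvnorm hne, norm_smul, Complex.norm_real, norm_inv, norm_norm, mul_pow, inv_pow,
            inv_mul_eq_div]
        rw [hnv] at hih
        exact hih
    · intro b _
      cases b <;> simp only [Z, Bool.false_eq_true, if_false, if_true]
      · exact hX.trans hXY
      · have : 0 ≤ Y := hX.trans hXY
        have h3 : 0 ≤ 1 - ‖v‖ ^ 2 / q := by linarith
        positivity
    · refine ENNReal.ofReal_le_ofReal (le_of_eq ?_)
      rw [sum_bool_weights]
      simp only [Z, Bool.false_eq_true, if_false, if_true]
      -- If `q = 0` the quotient in `Z` is a default value, but it carries weight zero.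
      by_cases hq0 : q = 0
      · have hv0 : ‖v‖ ^ 2 = 0 := by
          have : ‖act Q ψ‖ = 0 := by simpa [hq] using hq0
          have h4 : ‖v‖ = 0 := le_antisymm (by linarith) (norm_nonneg _)
          rw [h4]; norm_num
        rw [← hw, hq0, hv0]
        ring
      · have h5 : ‖act (1 - Q) ψ‖ ^ 2 = 1 - q := by linarith
        rw [h5]
        field_simp
        ring

section

variable {n : ℕ} {θ Δ : ℝ} {g : ℕ} {B : List (Assignment n)} {φ : Formula n}

theorem prod_reverse_schedule (ε : ℝ) :
    (schedule θ B φ ε).reverse.prod = cycleOp θ B φ ^ cycles θ B φ ε := by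
  rw [schedule]
  induction cycles θ B φ ε with
  | zero => simp
  | succ r ih =>
    rw [List.replicate_succ, List.flatten_cons, List.reverse_append, List.prod_append, ih, pow_succ]
    rfl

theorem length_schedule (ε : ℝ) :
    (schedule θ B φ ε).length = cycles θ B φ ε * B.length := by
  rw [schedule, List.length_flatten, List.map_replicate, List.sum_replicate, cycleChecks,
    List.length_map, length_layers, smul_eq_mul]

theorem isStarProjection_of_mem_schedule {ε : ℝ} {Q : Op (Assignment n)}
    (hQ : Q ∈ schedule θ B φ ε) : IsStarProjection Q := by
  obtain ⟨l, hl, hQl⟩ := List.mem_flatten.mp hQ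
  rw [List.eq_of_mem_replicate hl] at hQl
  exact isStarProjection_of_mem_cycleChecks hQl

/-- The encoding of any solution is a unit vector in the ground space, and its overlap with the
initial state is seen entirely by the projection. -/
theorem Admissible.cos_pow_le_norm (h : Admissible θ Δ g B φ) :
    Real.cos (θ / 2) ^ n ≤ ‖(groundSpace θ φ).starProjection (plusState n)‖ := by
  obtain ⟨x, hx⟩ := h.sat
  have hmem := encKet_mem_groundSpace θ hx
  set u := (groundSpace θ φ).starProjection (plusState n) with hu
  have h1 : inner ℂ (encKet θ x) u = ((Real.cos (θ / 2) ^ n : ℝ) : ℂ) := by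
    rw [← inner_encKet_plusState θ x]
    have h2 := (Submodule.mem_orthogonal _ _).mp
      (Submodule.sub_starProjection_mem_orthogonal (K := groundSpace θ φ) (plusState n)) _ hmem
    rw [inner_sub_right] at h2
    exact (sub_eq_zero.mp h2).symm
  have h3 := norm_inner_le_norm (𝕜 := ℂ) (encKet θ x) u
  rw [h1, norm_encKet, one_mul, Complex.norm_real] at h3
  exact (le_abs_self _).trans h3

/-- The outcome of a passed run is close to the ground space, and passing is likely enough. -/
theorem Admissible.schedule_spec (h : Admissible θ Δ g B φ) (hΔ : 0 < Δ) (hg : 1 ≤ g)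
    (hθ : 0 < Real.cos (θ / 2)) {ε : ℝ} (hε : 0 < ε) :
    let v := act (schedule θ B φ ε).reverse.prod (plusState n)
    Real.cos (θ / 2) ^ n ≤ ‖v‖ ∧ ‖v - (groundSpace θ φ).starProjection v‖ ≤ ε * ‖v‖ := by
  intro v
  set K := groundSpace θ φ
  set u := K.starProjection (plusState n) with hu
  have hmem : u ∈ K := Submodule.starProjection_apply_mem _ _
  have hχ : plusState n - u ∈ Kᗮ := Submodule.sub_starProjection_mem_orthogonal _
  set r := cycles θ B φ ε
  have hTu : act (cycleOp θ B φ ^ r) u = u := by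
    induction r with
    | zero => simp
    | succ r ih => rw [pow_succ, act_mul, h.act_cycleOp hmem, ih]
  obtain ⟨h1, h2⟩ := h.norm_act_cycleOp_pow_le hχ r
  set η := act (cycleOp θ B φ ^ r) (plusState n - u) with hη
  have hv : v = u + η := by
    change act (schedule θ B φ ε).reverse.prod (plusState n) = _
    rw [prod_reverse_schedule]
    conv_lhs => rw [← add_sub_cancel u (plusState n), map_add, hTu]
  have hPv : K.starProjection v = u := Submodule.eq_starProjection_of_mem_orthogonal' hmem h2 hv
  have horth : inner ℂ u η = 0 := (Submodule.mem_orthogonal _ _).mp h2 u hmem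
  have hpyth := norm_add_sq_eq_norm_sq_add_norm_sq_of_inner_eq_zero _ _ horth
  rw [← hv] at hpyth
  have huv : ‖u‖ ≤ ‖v‖ := by nlinarith [norm_nonneg u, norm_nonneg v, mul_self_nonneg ‖η‖]
  have hcos := h.cos_pow_le_norm
  have hcv : Real.cos (θ / 2) ^ n ≤ ‖v‖ := hcos.trans huv
  refine ⟨hcv, ?_⟩
  have hχ1 : ‖plusState n - u‖ ≤ 1 := by
    have h4 : inner ℂ u (plusState n - u) = 0 := (Submodule.mem_orthogonal _ _).mp hχ u hmem
    have h5 := norm_add_sq_eq_norm_sq_add_norm_sq_of_inner_eq_zero _ _ h4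
    rw [add_sub_cancel, norm_plusState] at h5
    nlinarith [mul_self_nonneg ‖u‖, norm_nonneg (plusState n - u)]
  have hrate := h.rate_pow_cycles_le hΔ hg (ε := ε) (by positivity)
  rw [hPv, hv, add_sub_cancel_left, ← hv]
  -- The ground component `u` is untouched and only `η` decays. The factor `cos(θ/2)^n` in the
  -- tolerance of `cycles` pays for the later renormalization by `‖v‖`.
  calc ‖η‖ ≤ rate θ B φ ^ r * ‖plusState n - u‖ := h1
    _ ≤ rate θ B φ ^ r * 1 := mul_le_mul_of_nonneg_left hχ1 (pow_nonneg rate_nonneg _)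
    _ ≤ ε * Real.cos (θ / 2) ^ n := by rw [mul_one]; exact hrate
    _ ≤ ε * ‖v‖ := by gcongr

theorem Admissible.attemptSpec_plain (h : Admissible θ Δ g B φ) (hΔ : 0 < Δ) (hg : 1 ≤ g)
    (hθ : 0 < Real.cos (θ / 2)) {ε : ℝ} (hε : 0 < ε) :
    AttemptSpec (attempt θ (schedule θ B φ ε) .plain) (schedule θ B φ ε).length
      ((Real.cos (θ / 2) ^ n) ^ 2) (NearGround θ φ ε) := by
  intro t ht f X Y hX hXY h1 h0
  obtain ⟨hv1, hv2⟩ := h.schedule_spec hΔ hg hθ hε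
  refine (loss_runChecks_le _ (fun Q hQ => isStarProjection_of_mem_schedule hQ) _
    (norm_plusState n) t ht f X Y hX hXY (fun s hs hs' =>
      h1 _ s (nearGround_normalized hs hv2) hs') h0).trans ?_
  refine ENNReal.ofReal_le_ofReal ?_
  -- Since `X ≤ Y`, passing more often than guaranteed only lowers the loss.
  have := pow_le_pow_left₀ (by positivity) hv1 2
  nlinarith

end


/-! ## Amplitude amplification -/

/-- Each term `2 sin x cos((2j+1)x)` equals `sin(2(j+1)x) - sin(2jx)`, and the sum telescopes. -/
theorem two_mul_sin_mul_sum_cos (x : ℝ) (M : ℕ) :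
    2 * Real.sin x * ∑ j ∈ Finset.range M, Real.cos ((2 * j + 1) * x) =
      Real.sin (2 * M * x) := by
  induction M with
  | zero => simp
  | succ M ih =>
    rw [Finset.sum_range_succ, mul_add, ih]
    push_cast
    rw [show 2 * ((M : ℝ) + 1) * x = (2 * M + 1) * x + x by ring,
      show 2 * (M : ℝ) * x = (2 * M + 1) * x - x by ring, Real.sin_add, Real.sin_sub]
    ring

/-- The average success probability of amplitude amplification with a random number of
iterates. -/
theorem quarter_le_sum_sin_sq {α : ℝ} (h0 : 0 ≤ α) (h1 : α ≤ Real.pi / 2) {M : ℕ}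
    (hM : 1 ≤ M * Real.sin α) :
    (M : ℝ) / 4 ≤ ∑ j ∈ Finset.range M, Real.sin ((2 * j + 1) * α) ^ 2 := by
  have hpi := Real.pi_pos
  have hpi4 := Real.pi_le_four
  have hMpos : (0 : ℝ) < M := by
    rcases (Nat.cast_nonneg (α := ℝ) M).eq_or_lt with h | h
    · rw [← h] at hM; linarith
    · exact h
  set x := 2 * α with hx
  set S := ∑ j ∈ Finset.range M, Real.cos ((2 * j + 1) * x) with hS
  have hsum : ∑ j ∈ Finset.range M, Real.sin ((2 * j + 1) * α) ^ 2 = M / 2 - S / 2 := by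
    have : ∀ j : ℕ, Real.sin ((2 * j + 1) * α) ^ 2 =
        1 / 2 - Real.cos ((2 * j + 1) * x) / 2 := by
      intro j
      rw [Real.sin_sq_eq_half_sub, hx]
      ring_nf
    simp only [this, Finset.sum_sub_distrib, Finset.sum_const, Finset.card_range, nsmul_eq_mul,
      hS, Finset.sum_div]
    ring
  rw [hsum]
  suffices h : S ≤ M / 2 by linarith
  have hid : 2 * Real.sin x * S = Real.sin (2 * M * x) := two_mul_sin_mul_sum_cos x M
  -- The identity gives `2 sin x · S ≤ 1`, so it is enough that `sin x` is not too small.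
  have key : 1 / (M : ℝ) ≤ Real.sin x → S ≤ M / 2 := by
    intro hs
    have hspos : 0 < Real.sin x := lt_of_lt_of_le (by positivity) hs
    have h2 : 2 * Real.sin x * S ≤ 1 := hid ▸ Real.sin_le_one _
    by_contra hcon
    push Not at hcon
    have h3 : 1 ≤ M * Real.sin x := by
      rw [div_le_iff₀ hMpos] at hs; linarith
    nlinarith
  -- For `x ≤ π/2`, Jordan's inequality and `π ≤ 4` give `sin x ≥ 2x/π ≥ α ≥ sin α ≥ 1/M`. Beyond,
  -- `sin x` may be small again: with `y = π - x`, either `2My > π` and Jordan applies to `y`, or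
  -- `sin(2Mx) = -sin(2My) ≤ 0` forces `S ≤ 0`. At `y = 0` every cosine is `-1`.
  rcases le_or_gt x (Real.pi / 2) with hx2 | hx2
  · apply key
    have h2 : 2 / Real.pi * x ≤ Real.sin x := Real.mul_le_sin (by positivity) hx2
    have h3 : Real.sin α ≤ α := Real.sin_le h0
    have h4 : α ≤ 2 / Real.pi * x := by
      rw [hx, div_mul_eq_mul_div, le_div_iff₀ hpi]
      nlinarith
    rw [div_le_iff₀ hMpos]
    nlinarith
  · set y := Real.pi - x with hy
    have hy0 : 0 ≤ y := by rw [hy, hx]; linarith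
    have hxy : Real.sin x = Real.sin y := by rw [hy, Real.sin_pi_sub]
    rcases hy0.eq_or_lt with hy0 | hy0
    · have hxpi : x = Real.pi := by linarith
      have : ∀ j ∈ Finset.range M, Real.cos ((2 * j + 1) * x) = -1 := by
        intro j _
        rw [hxpi, show (2 * (j : ℝ) + 1) * Real.pi = Real.pi + j * (2 * Real.pi) by ring,
          Real.cos_add_nat_mul_two_pi, Real.cos_pi]
      rw [hS, Finset.sum_congr rfl this]
      simp only [Finset.sum_const, Finset.card_range, nsmul_eq_mul]
      linarith
    · rcases le_or_gt (2 * M * y) Real.pi with h2 | h2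
      · have h3 : 0 ≤ Real.sin (2 * M * y) := Real.sin_nonneg_of_nonneg_of_le_pi (by positivity) h2
        have h4 : Real.sin (2 * M * x) = -Real.sin (2 * M * y) := by
          rw [show 2 * (M : ℝ) * x = M * (2 * Real.pi) - 2 * M * y by rw [hy]; ring,
            Real.sin_nat_mul_two_pi_sub]
        have h5 : 0 < Real.sin x := by
          rw [hxy]
          exact Real.sin_pos_of_pos_of_lt_pi hy0 (by linarith)
        have h6 : S ≤ 0 := by
          by_contra hcon
          push Not at hcon
          have : 0 < 2 * Real.sin x * S := by positivity
          linarith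
        linarith
      · apply key
        rw [hxy]
        have h3 : 2 / Real.pi * y ≤ Real.sin y := Real.mul_le_sin hy0.le (by linarith)
        refine le_trans ?_ h3
        rw [div_mul_eq_mul_div, div_le_div_iff₀ hMpos hpi]
        linarith

/-- The half-angle formula. For `q = 1` this is the inverse of the guaranteed passing probability,
for `q = 2` of the guaranteed amplitude. -/
theorem inv_cos_pow_eq (θ : ℝ) (n : ℕ) (hθ : 0 < Real.cos (θ / 2)) (q : ℝ) :
    (2 / (1 + Real.cos θ)) ^ ((n : ℝ) / q) = ((Real.cos (θ / 2) ^ n) ^ (2 / q))⁻¹ := by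
  have h : 2 / (1 + Real.cos θ) = (Real.cos (θ / 2) ^ (2 : ℝ))⁻¹ := by
    rw [Real.rpow_two, Real.cos_sq, mul_div_cancel₀ θ two_ne_zero]
    rw [show 1 / 2 + Real.cos θ / 2 = (1 + Real.cos θ) / 2 by ring, inv_div]
  rw [h, Real.inv_rpow (by positivity), ← Real.rpow_mul hθ.le, ← Real.rpow_natCast,
    ← Real.rpow_mul hθ.le]
  congr 2
  ring


/-! ### Deferred measurements and the joint register -/

/-- The component of a state at given values of the auxiliary qubits. -/
def slice {N n : ℕ} (Ψ : Ket (Reg N n)) (a : Assignment N) : Ket (Assignment n) :=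
  WithLp.toLp 2 fun x => Ψ (a, x)

theorem ket_ext_slice {N n : ℕ} {Ψ Φ : Ket (Reg N n)} (h : ∀ a, slice Ψ a = slice Φ a) :
    Ψ = Φ := by
  ext ⟨a, x⟩
  exact congrArg (fun ψ : Ket (Assignment n) => ψ x) (h a)

theorem slice_add {N n : ℕ} (Ψ Φ : Ket (Reg N n)) (a : Assignment N) :
    slice (Ψ + Φ) a = slice Ψ a + slice Φ a := rfl

theorem slice_smul {N n : ℕ} (z : ℂ) (Ψ : Ket (Reg N n)) (a : Assignment N) :
    slice (z • Ψ) a = z • slice Ψ a := rfl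

theorem slice_act_kronecker {N n : ℕ} (A : Op (Assignment N)) (Q : Op (Assignment n))
    (Ψ : Ket (Reg N n)) (a : Assignment N) :
    slice (act (A ⊗ₖ Q) Ψ) a = ∑ a', A a a' • act Q (slice Ψ a') := by
  ext x
  change act (A ⊗ₖ Q) Ψ (a, x) = _
  rw [act_apply, Fintype.sum_prod_type, WithLp.ofLp_sum, Finset.sum_apply]
  refine Finset.sum_congr rfl fun a' _ => ?_
  rw [PiLp.smul_apply, act_apply, smul_eq_mul, Finset.mul_sum]
  refine Finset.sum_congr rfl fun y _ => ?_
  rw [Matrix.kroneckerMap_apply, mul_assoc]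
  rfl

theorem flip_eq_iff {N : ℕ} (k : Fin N) (a a' : Assignment N) :
    a = Function.update a' k (!a' k) ↔ a' = Function.update a k (!a k) := by
  constructor <;> rintro rfl <;> simp

theorem slice_act_coherentCheck {N n : ℕ} (k : Fin N) (Q : Op (Assignment n))
    (Ψ : Ket (Reg N n)) (a : Assignment N) :
    slice (act (coherentCheck k Q) Ψ) a =
      act Q (slice Ψ a) + act (1 - Q) (slice Ψ (Function.update a k (!a k))) := by
  rw [coherentCheck, act_add, slice_add, slice_act_kronecker, slice_act_kronecker]
  congr 1
  · simp [Matrix.one_apply]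
  · rw [Finset.sum_eq_single (Function.update a k (!a k))]
    · simp [flipAux]
    · intro a' _ ha'
      rw [flipAux, Matrix.of_apply, if_neg, zero_smul]
      exact fun h => ha' ((flip_eq_iff k a a').mp h)
    · simp

/-- The auxiliary qubits of all pending checks are still `0`. Each check has its own qubit, so a
failure once recorded is never erased, and only the passing branch reaches the all-zero component.
-/
theorem slice_act_prod_coherentCheck {N n : ℕ} (Q : Fin N → Op (Assignment n))
    (l : List (Fin N)) (hl : l.Nodup) (Ψ : Ket (Reg N n))
    (hΨ : ∀ a : Assignment N, (∃ k ∈ l, a k = true) → slice Ψ a = 0) :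
    slice (act (l.map fun k => coherentCheck k (Q k)).reverse.prod Ψ) (fun _ => false) =
      act (l.map Q).reverse.prod (slice Ψ fun _ => false) := by
  induction l generalizing Ψ with
  | nil => simp
  | cons k l ih =>
    have hk := List.nodup_cons.mp hl
    simp only [List.map_cons, List.reverse_cons, List.prod_append, List.prod_singleton, act_mul]
    rw [ih hk.2]
    · congr 1
      rw [slice_act_coherentCheck, hΨ (Function.update _ k _) ⟨k, by simp, by simp⟩, map_zero,
        add_zero]
    · rintro a ⟨j, hj, haj⟩
      have hjk : j ≠ k := by rintro rfl; exact hk.1 hj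
      rw [slice_act_coherentCheck, hΨ a ⟨j, by simp [hj], haj⟩,
        hΨ (Function.update a k _) ⟨j, by simp [hj], by rw [Function.update_of_ne hjk, haj]⟩,
        map_zero, map_zero, add_zero]

theorem slice_coherentInput {N n : ℕ} (a : Assignment N) :
    slice (coherentInput N n) a = if a = (fun _ => false) then plusState n else 0 := by
  ext x
  simp only [slice, coherentInput]
  split_ifs <;> rfl

/-- The component of the deferred run in which all checks are passed. -/
theorem slice_coherentRun {n : ℕ} (L : List (Op (Assignment n))) :
    slice (act (coherentRun L) (coherentInput L.length n)) (fun _ => false) =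
      act L.reverse.prod (plusState n) := by
  rw [coherentRun, slice_act_prod_coherentCheck L.get _ (List.nodup_finRange _),
    slice_coherentInput, if_pos rfl, ← List.ofFn_eq_map, List.ofFn_get]
  rintro a ⟨k, -, hk⟩
  rw [slice_coherentInput, if_neg]
  rintro rfl
  simp at hk

theorem norm_sq_eq_sum_slice {N n : ℕ} (Ψ : Ket (Reg N n)) :
    ‖Ψ‖ ^ 2 = ∑ a, ‖slice Ψ a‖ ^ 2 := by
  simp only [EuclideanSpace.norm_sq_eq, Fintype.sum_prod_type]
  rfl

theorem norm_coherentInput (N n : ℕ) : ‖coherentInput N n‖ = 1 := by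
  have h : ‖coherentInput N n‖ ^ 2 = 1 := by
    rw [norm_sq_eq_sum_slice, Finset.sum_eq_single fun _ => false]
    · rw [slice_coherentInput, if_pos rfl, norm_plusState, one_pow]
    · intro a _ ha
      rw [slice_coherentInput, if_neg ha, norm_zero, zero_pow two_ne_zero]
    · simp
  nlinarith [norm_nonneg (coherentInput N n)]

theorem slice_allPassed {N n : ℕ} (Ψ : Ket (Reg N n)) (a : Assignment N) :
    slice (act (allPassed N n) Ψ) a =
      if a = (fun _ => false) then slice Ψ (fun _ => false) else 0 := by
  rw [allPassed, slice_act_kronecker]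
  split_ifs with h
  · subst h
    simp [ketbra, Matrix.vecMulVec_apply]
  · simp [ketbra, Matrix.vecMulVec_apply, h]

theorem isStarProjection_allPassed (N n : ℕ) : IsStarProjection (allPassed N n) := by
  constructor
  · refine op_ext fun Ψ => ket_ext_slice fun a => ?_
    rw [act_mul]
    simp only [slice_allPassed, if_true]
  · rw [IsSelfAdjoint, Matrix.star_eq_conjTranspose, allPassed, Matrix.conjTranspose_kronecker]
    congr 1
    · ext a a'
      simp only [ketbra, Matrix.conjTranspose_apply, Matrix.vecMulVec_apply, Pi.star_apply]
      split_ifs <;> simp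
    · simp

theorem norm_act_allPassed {N n : ℕ} (Ψ : Ket (Reg N n)) :
    ‖act (allPassed N n) Ψ‖ = ‖slice Ψ (fun _ => false)‖ := by
  have h : ‖act (allPassed N n) Ψ‖ ^ 2 = ‖slice Ψ (fun _ => false)‖ ^ 2 := by
    rw [norm_sq_eq_sum_slice, Finset.sum_eq_single fun _ => false]
    · rw [slice_allPassed, if_pos rfl]
    · intro a _ ha
      rw [slice_allPassed, if_neg ha, norm_zero, zero_pow two_ne_zero]
    · simp
  exact (pow_left_inj₀ (norm_nonneg _) (norm_nonneg _) two_ne_zero).mp h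

/-- The second flip on the failing subspace undoes the first. Together with self-adjointness this
makes the deferred run unitary. -/
theorem coherentCheck_mul_self {N n : ℕ} (k : Fin N) {Q : Op (Assignment n)}
    (hQ : IsStarProjection Q) : coherentCheck k Q * coherentCheck k Q = 1 := by
  have h1 : Q * (1 - Q) = 0 := hQ.mul_one_sub_self
  have h2 : (1 - Q) * Q = 0 := hQ.one_sub_mul_self
  refine op_ext fun Ψ => ket_ext_slice fun a => ?_
  rw [act_mul, act_one]
  simp only [slice_act_coherentCheck, map_add]
  simp only [← act_mul, hQ.isIdempotentElem.eq,
    hQ.one_sub.isIdempotentElem.eq, h1, h2, act_zero, Function.update_self, Bool.not_not,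
    Function.update_idem, Function.update_eq_self, add_zero, zero_add]
  rw [← act_add, add_sub_cancel, act_one]

theorem coherentCheck_conjTranspose {N n : ℕ} (k : Fin N) {Q : Op (Assignment n)}
    (hQ : IsStarProjection Q) : (coherentCheck k Q).conjTranspose = coherentCheck k Q := by
  have h1 : (flipAux k).conjTranspose = flipAux k := by
    ext a a'
    rw [Matrix.conjTranspose_apply]
    simp only [flipAux, Matrix.of_apply, flip_eq_iff k a' a]
    split_ifs <;> simp
  have h2 : Q.conjTranspose = Q := hQ.isSelfAdjoint
  have h3 : (1 - Q).conjTranspose = 1 - Q := hQ.one_sub.isSelfAdjoint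
  rw [coherentCheck, Matrix.conjTranspose_add, Matrix.conjTranspose_kronecker,
    Matrix.conjTranspose_kronecker, h1, h2, h3, Matrix.conjTranspose_one]

theorem coherentRun_mul_conjTranspose {n : ℕ} {L : List (Op (Assignment n))}
    (hL : ∀ Q ∈ L, IsStarProjection Q) :
    coherentRun L * (coherentRun L).conjTranspose = 1 := by
  rw [coherentRun]
  generalize List.finRange L.length = l
  rw [← List.map_reverse]
  induction l.reverse with
  | nil => simp
  | cons k l ih =>
    have hQ := hL (L.get k) (List.get_mem _ _)
    rw [List.map_cons, List.prod_cons, Matrix.conjTranspose_mul, mul_assoc,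
      ← mul_assoc (List.prod _), ih, one_mul, coherentCheck_conjTranspose k hQ,
      coherentCheck_mul_self k hQ]

theorem act_ketbra {ι : Type} [Fintype ι] [DecidableEq ι] (u ψ : Ket ι) :
    act (ketbra u.ofLp) ψ = inner ℂ u ψ • u := by
  ext x
  rw [act_apply, PiLp.smul_apply, PiLp.inner_apply, smul_eq_mul, Finset.sum_mul]
  refine Finset.sum_congr rfl fun y _ => ?_
  simp only [ketbra, Matrix.vecMulVec_apply, Pi.star_apply, RCLike.inner_apply, Complex.star_def]
  ring

section Projection

variable {ι : Type} [Fintype ι] [DecidableEq ι] {P : Op ι}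

theorem _root_.IsStarProjection.act_act_one_sub (h : IsStarProjection P) (ψ : Ket ι) :
    act P (act (1 - P) ψ) = 0 := by
  rw [← act_mul, h.mul_one_sub_self, act_zero]

theorem _root_.IsStarProjection.act_one_sub_act (h : IsStarProjection P) (ψ : Ket ι) :
    act (1 - P) (act P ψ) = 0 := by
  rw [← act_mul, h.one_sub_mul_self, act_zero]

theorem _root_.IsStarProjection.act_reflection_act (h : IsStarProjection P) (ψ : Ket ι) :
    act (1 - (2 : ℂ) • P) (act P ψ) = -act P ψ := by
  rw [act_sub, act_one, act_smul, h.act_act, two_smul]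
  abel

theorem _root_.IsStarProjection.act_reflection_act_one_sub (h : IsStarProjection P) (ψ : Ket ι) :
    act (1 - (2 : ℂ) • P) (act (1 - P) ψ) = act (1 - P) ψ := by
  rw [act_sub, act_one, act_smul, h.act_act_one_sub, smul_zero, sub_zero]

end Projection

section Grover

variable {n : ℕ} {L : List (Op (Assignment n))}

theorem norm_act_coherentRun (hL : ∀ Q ∈ L, IsStarProjection Q) (Ψ : Ket (Reg L.length n)) :
    ‖act (coherentRun L) Ψ‖ = ‖Ψ‖ := by
  have h1 : (coherentRun L).conjTranspose * coherentRun L = 1 :=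
    mul_eq_one_comm.mp (coherentRun_mul_conjTranspose hL)
  have h2 : inner ℂ (act (coherentRun L) Ψ) (act (coherentRun L) Ψ) = inner ℂ Ψ Ψ := by
    rw [inner_act, ← act_mul, h1, act_one]
  have h3 := congrArg RCLike.re h2
  rw [inner_self_eq_norm_sq, inner_self_eq_norm_sq] at h3
  exact (pow_left_inj₀ (norm_nonneg _) (norm_nonneg _) two_ne_zero).mp h3

/-- Conjugating the reflection about the input by the unitary run gives the reflection about the
output of the run. -/
theorem act_groverIterate (hL : ∀ Q ∈ L, IsStarProjection Q) (Ψ : Ket (Reg L.length n)) :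
    act (groverIterate L) Ψ =
      (2 * inner ℂ (act (coherentRun L) (coherentInput L.length n))
        (act (1 - (2 : ℂ) • allPassed L.length n) Ψ)) •
        act (coherentRun L) (coherentInput L.length n) -
      act (1 - (2 : ℂ) • allPassed L.length n) Ψ := by
  rw [groverIterate, act_mul, act_mul, act_mul]
  set Φ := act (1 - (2 : ℂ) • allPassed L.length n) Ψ
  rw [act_sub, act_smul, act_ketbra, act_one, map_sub, map_smul, map_smul, ← inner_act, ← act_mul,
    coherentRun_mul_conjTranspose hL, act_one, smul_smul]

/-- Amplitude amplification rotates in the plane of the passing and the failing component. -/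
theorem act_groverIterate_pow (hL : ∀ Q ∈ L, IsStarProjection Q) {α : ℝ}
    (hα : ‖act L.reverse.prod (plusState n)‖ = Real.sin α) (j : ℕ) :
    let a := act (coherentRun L) (coherentInput L.length n)
    let Pr := allPassed L.length n
    ∃ x y : ℝ, act (groverIterate L ^ j) a = (x : ℂ) • act Pr a + (y : ℂ) • act (1 - Pr) a ∧
      Real.sin α * x = Real.sin ((2 * j + 1) * α) ∧
      Real.cos α * y = Real.cos ((2 * j + 1) * α) := by
  -- The coefficients refer to unnormalized components of norms `|sin α|` and `|cos α|`; the product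
  -- form of the claims avoids division when one of these vanishes.
  intro a Pr
  have hPr : IsStarProjection Pr := isStarProjection_allPassed _ _
  have ha : ‖a‖ = 1 := by rw [norm_act_coherentRun hL, norm_coherentInput]
  have hγ : ‖act Pr a‖ ^ 2 = Real.sin α ^ 2 := by
    rw [norm_act_allPassed, slice_coherentRun, hα]
  have hβ : ‖act (1 - Pr) a‖ ^ 2 = Real.cos α ^ 2 := by
    have h1 := hPr.norm_sq_add a
    rw [ha, hγ] at h1
    nlinarith [Real.sin_sq_add_cos_sq α]
  have hγβ : a = act Pr a + act (1 - Pr) a := by rw [← act_add, add_sub_cancel, act_one]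
  induction j with
  | zero =>
    refine ⟨1, 1, ?_, by simp, by simp⟩
    rw [pow_zero, act_one, Complex.ofReal_one, one_smul, one_smul]
    exact hγβ
  | succ j ih =>
    obtain ⟨x, y, h, hx, hy⟩ := ih
    -- In the coordinates `sin α · x` and `cos α · y` this is the rotation by `2α`.
    refine ⟨(1 - 2 * Real.sin α ^ 2) * x + 2 * Real.cos α ^ 2 * y,
      -(2 * Real.sin α ^ 2) * x + (2 * Real.cos α ^ 2 - 1) * y, ?_, ?_, ?_⟩
    · rw [pow_succ', act_mul, h, act_groverIterate hL]
      have hΦ : act (1 - (2 : ℂ) • Pr) ((x : ℂ) • act Pr a + (y : ℂ) • act (1 - Pr) a) =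
          -(x : ℂ) • act Pr a + (y : ℂ) • act (1 - Pr) a := by
        rw [map_add, map_smul, map_smul, hPr.act_reflection_act, hPr.act_reflection_act_one_sub,
          smul_neg, neg_smul]
      have hin : inner ℂ a (-(x : ℂ) • act Pr a + (y : ℂ) • act (1 - Pr) a) =
          ((-(x * Real.sin α ^ 2) + y * Real.cos α ^ 2 : ℝ) : ℂ) := by
        rw [inner_add_right, inner_smul_right, inner_smul_right, hPr.inner_self,
          hPr.one_sub.inner_self, hγ, hβ]
        push_cast
        ring
      change (2 * inner ℂ a (act (1 - (2 : ℂ) • Pr) _)) • a - act (1 - (2 : ℂ) • Pr) _ = _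
      rw [hΦ, hin]
      conv_lhs => enter [1, 2]; rw [hγβ]
      have hs : (Real.cos α : ℂ) ^ 2 = 1 - (Real.sin α : ℂ) ^ 2 := by
        have := Real.sin_sq_add_cos_sq α
        have h4 : Real.cos α ^ 2 = 1 - Real.sin α ^ 2 := by linarith
        exact_mod_cast h4
      push_cast at hs ⊢
      rw [hs]
      module
    · have h1 : (2 * ((j + 1 : ℕ) : ℝ) + 1) * α = (2 * j + 1) * α + 2 * α := by
        push_cast; ring
      rw [h1, Real.sin_add, ← hx, ← hy, Real.cos_two_mul, Real.sin_two_mul]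
      have := Real.sin_sq_add_cos_sq α
      linear_combination (-2 * Real.sin α * x) * this
    · have h1 : (2 * ((j + 1 : ℕ) : ℝ) + 1) * α = (2 * j + 1) * α + 2 * α := by
        push_cast; ring
      rw [h1, Real.cos_add, ← hx, ← hy, Real.cos_two_mul, Real.sin_two_mul]
      ring

/-- The state after `j` iterates. -/
theorem groverState_spec (hL : ∀ Q ∈ L, IsStarProjection Q) {α : ℝ}
    (hα : ‖act L.reverse.prod (plusState n)‖ = Real.sin α) (j : ℕ) :
    let Ψ := act (groverIterate L ^ j * coherentRun L) (coherentInput L.length n)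
    ‖act (allPassed L.length n) Ψ‖ ^ 2 = Real.sin ((2 * j + 1) * α) ^ 2 ∧
      ‖act (1 - allPassed L.length n) Ψ‖ ^ 2 = Real.cos ((2 * j + 1) * α) ^ 2 ∧
      ∃ x : ℝ, slice Ψ (fun _ => false) = (x : ℂ) • act L.reverse.prod (plusState n) := by
  intro Ψ
  obtain ⟨x, y, hxy, hx, hy⟩ := act_groverIterate_pow hL hα j
  rw [← act_mul] at hxy
  change Ψ = _ at hxy
  set a := act (coherentRun L) (coherentInput L.length n) with ha
  have hP : IsStarProjection (allPassed L.length n) := isStarProjection_allPassed _ _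
  set P := allPassed L.length n with hPdef
  have hgood : act P Ψ = (x : ℂ) • act P a := by
    rw [hxy, map_add, map_smul, map_smul, hP.act_act, hP.act_act_one_sub, smul_zero, add_zero]
  have hγ : ‖act P a‖ = Real.sin α := by
    rw [hPdef, norm_act_allPassed, ha, slice_coherentRun, hα]
  have hpg : ‖act P Ψ‖ ^ 2 = Real.sin ((2 * j + 1) * α) ^ 2 := by
    rw [hgood, norm_smul, Complex.norm_real, hγ, mul_pow, Real.norm_eq_abs, sq_abs, ← hx]
    ring
  have hΨ : ‖act (1 - P) Ψ‖ ^ 2 = Real.cos ((2 * j + 1) * α) ^ 2 := by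
    have h1 := hP.norm_sq_add a
    rw [hγ, ha, norm_act_coherentRun hL, norm_coherentInput] at h1
    have hbad : act (1 - P) Ψ = (y : ℂ) • act (1 - P) a := by
      rw [hxy, map_add, map_smul, map_smul, hP.one_sub.act_act, hP.act_one_sub_act, smul_zero,
        zero_add]
    rw [hbad, norm_smul, Complex.norm_real, mul_pow, Real.norm_eq_abs, sq_abs, ← hy, mul_pow]
    have h2 := Real.sin_sq_add_cos_sq α
    have h3 : ‖act (1 - P) a‖ ^ 2 = Real.cos α ^ 2 := by rw [ha]; linarith
    rw [h3]
    ring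
  refine ⟨hpg, hΨ, x, ?_⟩
  have h5 : slice (act P Ψ) (fun _ => false) = slice Ψ (fun _ => false) := by
    rw [hPdef, slice_allPassed, if_pos rfl]
  rw [← h5, hgood, slice_smul, hPdef, slice_allPassed, if_pos rfl, ha, slice_coherentRun]

end Grover

theorem loss_draw_uniform_le {α : Type} [Fintype α] [Nonempty α] (t : ℕ) (f : α → ℕ → ℝ≥0∞)
    (x : α → ℝ) (hf : ∀ a, f a t ≤ ENNReal.ofReal (x a)) (hx : ∀ a, 0 ≤ x a) :
    loss (draw (PMF.uniformOfFintype α)) t f ≤ ENNReal.ofReal ((∑ a, x a) / Fintype.card α) := by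
  rw [loss_draw, tsum_fintype, Finset.sum_div, ENNReal.ofReal_sum_of_nonneg]
  · refine Finset.sum_le_sum fun a _ => ?_
    rw [PMF.uniformOfFintype_apply, div_eq_inv_mul, ENNReal.ofReal_mul (by positivity),
      ENNReal.ofReal_inv_of_pos (by exact_mod_cast Fintype.card_pos), ENNReal.ofReal_natCast]
    exact mul_le_mul_right (hf a) _
  · intro a _
    have := hx a
    positivity

section

variable {n : ℕ} {θ Δ : ℝ} {g : ℕ} {B : List (Assignment n)} {φ : Formula n}

/-- With `sin α` the norm of the passed component, at least `cos(θ/2)^n`, the choice of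
`maxIterates` makes the number of possible `j` at least `1 / sin α`, as the averaging bound
requires. -/
theorem Admissible.sum_sin_sq (h : Admissible θ Δ g B φ) (hΔ : 0 < Δ) (hg : 1 ≤ g)
    (hθ : 0 < Real.cos (θ / 2)) {ε : ℝ} (hε : 0 < ε) :
    ∃ α, ‖act (schedule θ B φ ε).reverse.prod (plusState n)‖ = Real.sin α ∧
      ((maxIterates θ n + 1 : ℕ) : ℝ) / 4 ≤
        ∑ j ∈ Finset.range (maxIterates θ n + 1), Real.sin ((2 * j + 1) * α) ^ 2 := by
  obtain ⟨hv1, -⟩ := h.schedule_spec hΔ hg hθ hε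
  set L := schedule θ B φ ε with hLdef
  have hL : ∀ Q ∈ L, IsStarProjection Q := fun Q hQ => isStarProjection_of_mem_schedule hQ
  set v := act L.reverse.prod (plusState n) with hv
  have hv3 : ‖v‖ ≤ 1 := by
    rw [hv, ← slice_coherentRun, ← norm_act_allPassed]
    refine ((isStarProjection_allPassed _ _).norm_act_le _).trans ?_
    rw [norm_act_coherentRun hL, norm_coherentInput]
  have hsin : ‖v‖ = Real.sin (Real.arcsin ‖v‖) :=
    (Real.sin_arcsin (by linarith [norm_nonneg v]) hv3).symm
  refine ⟨Real.arcsin ‖v‖, hsin, quarter_le_sum_sin_sq (Real.arcsin_nonneg.mpr (norm_nonneg v))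
    (Real.arcsin_le_pi_div_two _) ?_⟩
  rw [← hsin]
  have h2 : (Real.cos (θ / 2) ^ n)⁻¹ ≤ ((maxIterates θ n + 1 : ℕ) : ℝ) := by
    have h3 := Nat.le_ceil ((2 / (1 + Real.cos θ)) ^ ((n : ℝ) / 2))
    have h4 : (2 / (1 + Real.cos θ)) ^ ((n : ℝ) / 2) = (Real.cos (θ / 2) ^ n)⁻¹ := by
      rw [inv_cos_pow_eq θ n hθ, div_self two_ne_zero, Real.rpow_one]
    rw [← h4, maxIterates]
    push_cast
    linarith
  have hc : 0 < Real.cos (θ / 2) ^ n := by positivity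
  calc (1 : ℝ) = (Real.cos (θ / 2) ^ n)⁻¹ * Real.cos (θ / 2) ^ n := (inv_mul_cancel₀ hc.ne').symm
    _ ≤ _ := mul_le_mul h2 hv1 hc.le (by positivity)

theorem Admissible.attemptSpec_amplified (h : Admissible θ Δ g B φ) (hΔ : 0 < Δ) (hg : 1 ≤ g)
    (hθ : 0 < Real.cos (θ / 2)) {ε : ℝ} (hε : 0 < ε) :
    AttemptSpec (attempt θ (schedule θ B φ ε) .amplified)
      ((2 * maxIterates θ n + 1) * ((schedule θ B φ ε).length + 1))
      (1 / 4) (NearGround θ φ ε) := by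
  intro t ht f X Y hX hXY h1 h0
  obtain ⟨-, hv2⟩ := h.schedule_spec hΔ hg hθ hε
  obtain ⟨α, hsin, hsum⟩ := h.sum_sin_sq hΔ hg hθ hε
  have hL : ∀ Q ∈ schedule θ B φ ε, IsStarProjection Q :=
    fun Q hQ => isStarProjection_of_mem_schedule hQ
  generalize schedule θ B φ ε = L at *
  have hY : 0 ≤ Y := hX.trans hXY
  set J := maxIterates θ n with hJ
  let z : Fin (J + 1) → ℝ := fun j => Real.sin ((2 * (j : ℕ) + 1) * α) ^ 2 * X +
    Real.cos ((2 * (j : ℕ) + 1) * α) ^ 2 * Y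
  rw [attempt, loss_bind]
  refine (loss_draw_uniform_le t _ z ?_ fun j => by positivity).trans ?_
  · intro j
    have hcost : (2 * (j : ℕ) + 1) * L.length + 2 * (j : ℕ) + 1 ≤ (2 * J + 1) * (L.length + 1) := by
      have hj : (j : ℕ) ≤ J := Nat.lt_succ_iff.mp j.2
      have : (2 * (j : ℕ) + 1) * L.length ≤ (2 * J + 1) * L.length :=
        Nat.mul_le_mul_right _ (by omega)
      rw [mul_add]
      omega
    rw [loss_bind, loss_tick, if_pos (hcost.trans ht), loss_bind]
    obtain ⟨hpg, hpb, x, hx⟩ := groverState_spec hL hsin j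
    have hslice := norm_act_allPassed
      (act (groverIterate L ^ (j : ℕ) * coherentRun L) (coherentInput L.length n))
    generalize act (groverIterate L ^ (j : ℕ) * coherentRun L) (coherentInput L.length n) = Ψ at *
    refine (loss_draw_sample_le (x := fun b => if b then X else Y) ?_ ?_ _ _ ?_ ?_).trans ?_
    · intro b; split_ifs <;> positivity
    · rw [Fintype.sum_bool]
      simp only [if_true, Bool.false_eq_true, if_false]
      rw [hpg, hpb, Real.sin_sq_add_cos_sq]
    · intro b hb
      rw [loss_pure]
      cases b with
      | false => exact h0 _ (by omega)
      | true =>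
        simp only [if_true] at hb ⊢
        change f (some (normalized (slice Ψ fun _ => false))) _ ≤ _
        refine h1 _ _ (nearGround_normalized ?_ ?_) (by omega)
        · intro h6
          rw [hslice, h6] at hb
          simp at hb
        -- The amplified outcome is a real multiple of the plain passed state, so its relative
        -- distance to the ground space is the same.
        · rw [hx, map_smul, ← smul_sub, norm_smul, norm_smul, mul_left_comm]
          exact mul_le_mul_of_nonneg_left hv2 (norm_nonneg _)
    · intro b _
      cases b <;> simp [hX, hY]
    · refine ENNReal.ofReal_le_ofReal (le_of_eq ?_)
      rw [sum_bool_weights]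
      simp only [if_true, Bool.false_eq_true, if_false]
      rw [hpg, hpb]
  · refine ENNReal.ofReal_le_ofReal ?_
    rw [Fintype.card_fin, div_le_iff₀ (by positivity)]
    have h2 : ∑ j, z j =
        ∑ j ∈ Finset.range (J + 1), (Y - Real.sin ((2 * j + 1) * α) ^ 2 * (Y - X)) := by
      rw [Finset.sum_range]
      refine Finset.sum_congr rfl fun j _ => ?_
      simp only [z]
      have := Real.sin_sq_add_cos_sq ((2 * ((j : ℕ) : ℝ) + 1) * α)
      linear_combination Y * this
    rw [h2, Finset.sum_sub_distrib, ← Finset.sum_mul, Finset.sum_const, Finset.card_range,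
      nsmul_eq_mul]
    nlinarith


end

/-! ## Repeated preparation -/

/-- The loss of preparing a good state when there is time for `m` attempts. -/
def PrepSpec {α : Type} (A : Alg α) (D : ℕ) (p : ℝ) (good : α → Prop) : Prop :=
  ∀ (m t t₀ : ℕ) (f : α → ℕ → ℝ≥0∞) (X Y : ℝ), (∀ a s, f a s ≤ 1) → 1 ≤ X → 0 ≤ Y →
    m * D + t₀ ≤ t →
    (∀ a m' s, good a → m' * D + t₀ ≤ s → f a s ≤ ENNReal.ofReal (X * (1 - p / 2) ^ m' + Y)) →
    loss A t f ≤ ENNReal.ofReal (2 * X * (1 - p / 2) ^ m + Y)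

theorem AttemptSpec.mono {α : Type} {A : Alg (Option α)} {D D' : ℕ} {p : ℝ} {good : α → Prop}
    (h : AttemptSpec A D p good) (hD : D ≤ D') : AttemptSpec A D' p good :=
  fun t ht f X Y hX hXY h1 h0 => h t (hD.trans ht) f X Y hX hXY
    (fun a s ha hs => h1 a s ha (by omega)) (fun s hs => h0 s (by omega))

/-- Write `β = 1 - p/2`. A trial leaves potential `X β^m` on success and, inductively, `2X β^m` on
failure; the average `(p + 2(1 - p)) X β^m` equals `2X β^(m+1)`. So one preparation doubles the
prefactor but loses nothing in the exponent. Without time, `1 ≤ X` makes the bound trivial. -/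
theorem AttemptSpec.loss_repeatUntil_le {α : Type} {A : Alg (Option α)} {D : ℕ} {p : ℝ}
    {good : α → Prop} (h : AttemptSpec A D p good) (hp1 : p ≤ 1)
    {t₀ : ℕ} {f : α → ℕ → ℝ≥0∞} {X Y : ℝ} (hf : ∀ a s, f a s ≤ 1) (hX : 1 ≤ X) (hY : 0 ≤ Y)
    (hgood : ∀ a m' s, good a → m' * D + t₀ ≤ s →
      f a s ≤ ENNReal.ofReal (X * (1 - p / 2) ^ m' + Y))
    (m fuel t : ℕ) (hm : m ≤ fuel) (ht : m * D + t₀ ≤ t) :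
    loss (repeatUntil A fuel) t f ≤ ENNReal.ofReal (2 * X * (1 - p / 2) ^ m + Y) := by
  have hβ : 0 ≤ 1 - p / 2 := by linarith
  induction m generalizing fuel t with
  | zero =>
    refine (loss_le_one _ _ hf).trans ?_
    rw [pow_zero, mul_one, ENNReal.one_le_ofReal]
    linarith
  | succ m ih =>
    obtain ⟨k, rfl⟩ : ∃ k, fuel = k + 1 := ⟨fuel - 1, by omega⟩
    have hβm := pow_nonneg hβ m
    have hmul : (m + 1) * D = m * D + D := by ring
    rw [repeatUntil, loss_bind]
    refine (h t (by omega) _ (X * (1 - p / 2) ^ m + Y) (2 * X * (1 - p / 2) ^ m + Y)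
      (by positivity) (by nlinarith) ?_ ?_).trans ?_
    · intro a s ha hs
      rw [loss_pure]
      exact hgood a m s ha (by omega)
    · intro s hs
      exact ih k s (by omega) (by omega)
    · refine ENNReal.ofReal_le_ofReal (le_of_eq ?_)
      rw [pow_succ]
      ring

/-- As `D ≥ 1`, a budget for `m` trials exceeds `m`, so the recursion limit in `prepare` does not
interfere. -/
theorem prepSpec_prepare {n : ℕ} {mode : Mode} {θ : ℝ} {B : List (Assignment n)} {φ : Formula n}
    {ε : ℝ} {D : ℕ} {p : ℝ} {good : Ket (Assignment n) → Prop}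
    (h : AttemptSpec (attempt θ (schedule θ B φ ε) mode) D p good) (hD : 1 ≤ D)
    (hp1 : p ≤ 1) : PrepSpec (prepare mode θ B φ ε) D p good := by
  intro m t t₀ f X Y hf hX hY ht hgood
  rw [prepare, loss_bind, loss_get]
  refine h.loss_repeatUntil_le hp1 hf hX hY hgood m _ t ?_ ht
  have : m ≤ m * D := Nat.le_mul_of_pos_right m hD
  omega

/-! ## Readout -/

theorem loss_readAll_le {n : ℕ} {ψ : Ket (Assignment n)} (hψ : ‖ψ‖ = 1) {t : ℕ} (ht : 1 ≤ t)
    (f : Assignment n → ℕ → ℝ≥0∞) (x : Assignment n → ℝ)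
    (hf : ∀ y, f y (t - 1) ≤ ENNReal.ofReal (x y)) (hx : ∀ y, 0 ≤ x y) :
    loss (readAll ψ) t f ≤ ENNReal.ofReal (∑ y, ‖ψ y‖ ^ 2 * x y) := by
  rw [readAll, loss_bind, loss_tick, if_pos ht]
  refine loss_draw_sample_le (fun y => sq_nonneg _) ?_ _ _ x (fun y _ => hf y) fun y _ => hx y
  rw [← EuclideanSpace.norm_sq_eq, hψ, one_pow]

theorem loss_readFirst_le {n : ℕ} {ψ : Ket (Assignment (n + 1))} (hψ : ‖ψ‖ = 1) {t : ℕ}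
    (ht : 1 ≤ t) (f : Bool → ℕ → ℝ≥0∞) (x : Bool → ℝ)
    (hf : ∀ b, f b (t - 1) ≤ ENNReal.ofReal (x b)) (hx : ∀ b, 0 ≤ x b) :
    loss (readFirst ψ) t f ≤ ENNReal.ofReal (∑ y, ‖ψ y‖ ^ 2 * x (y 0)) := by
  rw [readFirst, loss_bind, loss_tick, if_pos ht]
  have h1 : ∀ z : Bool → ℝ, ∑ b, (∑ y with y 0 = b, ‖ψ y‖ ^ 2) * z b =
      ∑ y, ‖ψ y‖ ^ 2 * z (y 0) := by
    intro z
    rw [← Finset.sum_fiberwise (s := Finset.univ) (g := fun y : Assignment (n + 1) => y 0)]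
    refine Finset.sum_congr rfl fun b _ => ?_
    rw [Finset.sum_mul]
    refine Finset.sum_congr rfl fun y hy => ?_
    rw [(Finset.mem_filter.mp hy).2]
  rw [← h1]
  refine loss_draw_sample_le (fun b => Finset.sum_nonneg fun y _ => sq_nonneg _) ?_ _ _ x
    (fun b _ => hf b) fun b _ => hx b
  have h2 := h1 fun _ => 1
  simp only [mul_one] at h2
  rw [h2, ← EuclideanSpace.norm_sq_eq, hψ, one_pow]

/-- Averaging an affine function over the outcomes of a measurement. -/
theorem sum_weights_affine {n : ℕ} {ψ : Ket (Assignment n)} (hψ : ‖ψ‖ = 1) (a b : ℝ)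
    (w : Assignment n → ℝ) :
    ∑ y, ‖ψ y‖ ^ 2 * (a + b * w y) = a + b * ∑ y, ‖ψ y‖ ^ 2 * w y := by
  have h : ∑ y, ‖ψ y‖ ^ 2 = 1 := by rw [← EuclideanSpace.norm_sq_eq, hψ, one_pow]
  calc ∑ y, ‖ψ y‖ ^ 2 * (a + b * w y)
      = (∑ y, ‖ψ y‖ ^ 2) * a + b * ∑ y, ‖ψ y‖ ^ 2 * w y := by
        rw [Finset.sum_mul, Finset.mul_sum, ← Finset.sum_add_distrib]
        exact Finset.sum_congr rfl fun y _ => by ring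
    _ = _ := by rw [h, one_mul]

/-- Two potentials run side by side: `2^k (1 - p/2)^m` for running out of time, and `ρ^k W v` for a
misleading tally. Each further copy doubles the first and multiplies the second by `ρ`. The budget
reserves one measurement for each of the `k` readouts and `t₀` for what follows, whose loss is `ζ`.
-/
theorem loss_tally_le {n : ℕ} {prep : Alg (Ket (Assignment n))} {D : ℕ} {p : ℝ}
    {good : Ket (Assignment n) → Prop} (h : PrepSpec prep D p good) (hp1 : p ≤ 1)
    (hgood : ∀ ψ, good ψ → ‖ψ‖ = 1) {t₀ : ℕ} {f : (Fin n → ℤ) → ℕ → ℝ≥0∞}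
    (hf : ∀ v s, f v s ≤ 1) {W : (Fin n → ℤ) → ℝ} {ρ ζ : ℝ} (hW : ∀ v, 0 ≤ W v) (hρ : 0 ≤ ρ)
    (hζ : 0 ≤ ζ) (hfW : ∀ v s, t₀ ≤ s → f v s ≤ ENNReal.ofReal (ζ + W v))
    (hstep : ∀ ψ, good ψ → ∀ v,
      ∑ x, ‖ψ x‖ ^ 2 * W (fun i => v i + if x i then -1 else 1) ≤ ρ * W v)
    (k : ℕ) (v : Fin n → ℤ) (m t : ℕ) (ht : m * D + (t₀ + k) ≤ t) :
    loss (tally prep k v) t f ≤ ENNReal.ofReal (2 ^ k * (1 - p / 2) ^ m + (ζ + ρ ^ k * W v)) := by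
  have hβ : 0 ≤ 1 - p / 2 := by linarith
  induction k generalizing v m t with
  | zero =>
    rw [tally, loss_pure]
    refine (hfW v t (by omega)).trans (ENNReal.ofReal_le_ofReal ?_)
    have := pow_nonneg hβ m
    simp only [pow_zero, one_mul]
    linarith
  | succ k ih =>
    rw [tally, loss_bind]
    have h1 := h m t (t₀ + (k + 1)) (fun ψ s => loss (do
      let x ← readAll ψ
      tally prep k fun i => v i + if x i then -1 else 1) s f) (2 ^ k) (ζ + ρ ^ (k + 1) * W v)
      (fun ψ s => loss_le_one _ _ hf) (one_le_pow₀ one_le_two)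
      (by have := hW v; positivity) ht ?_
    · refine h1.trans (le_of_eq ?_)
      rw [pow_succ' 2 k]
    · intro ψ m' s hψ hs
      rw [loss_bind]
      refine (loss_readAll_le (hgood ψ hψ) (by omega) _
        (fun x => (2 ^ k * (1 - p / 2) ^ m' + ζ) +
          ρ ^ k * W (fun i => v i + if x i then -1 else 1)) ?_ ?_).trans ?_
      · intro x
        refine (ih _ m' (s - 1) (by omega)).trans (le_of_eq ?_)
        rw [add_assoc]
      · intro x
        have := hW fun i => v i + if x i then -1 else 1
        have := pow_nonneg hβ m'
        positivity
      · refine ENNReal.ofReal_le_ofReal ?_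
        rw [sum_weights_affine (hgood ψ hψ)]
        have := mul_le_mul_of_nonneg_left (hstep ψ hψ v) (pow_nonneg hρ k)
        rw [pow_succ]
        linarith

theorem loss_tallyFirst_le {n : ℕ} {prep : Alg (Ket (Assignment (n + 1)))} {D : ℕ} {p : ℝ}
    {good : Ket (Assignment (n + 1)) → Prop} (h : PrepSpec prep D p good) (hp1 : p ≤ 1)
    (hgood : ∀ ψ, good ψ → ‖ψ‖ = 1) {t₀ : ℕ} {f : ℤ → ℕ → ℝ≥0∞}
    (hf : ∀ v s, f v s ≤ 1) {W : ℤ → ℝ} {ρ ζ : ℝ} (hW : ∀ v, 0 ≤ W v) (hρ : 0 ≤ ρ)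
    (hζ : 0 ≤ ζ) (hfW : ∀ v s, t₀ ≤ s → f v s ≤ ENNReal.ofReal (ζ + W v))
    (hstep : ∀ ψ, good ψ → ∀ v,
      ∑ x, ‖ψ x‖ ^ 2 * W (v + if x 0 then 1 else -1) ≤ ρ * W v)
    (k : ℕ) (v : ℤ) (m t : ℕ) (ht : m * D + (t₀ + k) ≤ t) :
    loss (tallyFirst prep k v) t f ≤
      ENNReal.ofReal (2 ^ k * (1 - p / 2) ^ m + (ζ + ρ ^ k * W v)) := by
  have hβ : 0 ≤ 1 - p / 2 := by linarith
  induction k generalizing v m t with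
  | zero =>
    rw [tallyFirst, loss_pure]
    refine (hfW v t (by omega)).trans (ENNReal.ofReal_le_ofReal ?_)
    have := pow_nonneg hβ m
    simp only [pow_zero, one_mul]
    linarith
  | succ k ih =>
    rw [tallyFirst, loss_bind]
    have h1 := h m t (t₀ + (k + 1)) (fun ψ s => loss (do
      let b ← readFirst ψ
      tallyFirst prep k (v + if b then 1 else -1)) s f) (2 ^ k) (ζ + ρ ^ (k + 1) * W v)
      (fun ψ s => loss_le_one _ _ hf) (one_le_pow₀ one_le_two)
      (by have := hW v; positivity) ht ?_
    · refine h1.trans (le_of_eq ?_)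
      rw [pow_succ' 2 k]
    · intro ψ m' s hψ hs
      rw [loss_bind]
      refine (loss_readFirst_le (hgood ψ hψ) (by omega) _
        (fun b => (2 ^ k * (1 - p / 2) ^ m' + ζ) +
          ρ ^ k * W (v + if b then 1 else -1)) ?_ ?_).trans ?_
      · intro b
        refine (ih _ m' (s - 1) (by omega)).trans (le_of_eq ?_)
        rw [add_assoc]
      · intro b
        have := hW (v + if b then 1 else -1)
        have := pow_nonneg hβ m'
        positivity
      · refine ENNReal.ofReal_le_ofReal ?_
        rw [sum_weights_affine (hgood ψ hψ) _ _ fun y => W (v + if y 0 then 1 else -1)]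
        have := mul_le_mul_of_nonneg_left (hstep ψ hψ v) (pow_nonneg hρ k)
        rw [pow_succ]
        linarith

/-! ## Exponential moments of the outcomes -/

/-- The contraction factor of the exponential moment of a biased outcome. -/
def momentFactor (θ : ℝ) : ℝ := Real.sqrt ((1 + Real.cos θ ^ 2) / 2)

/-- The optimal Chernoff parameter for bias `b₀` is `l = ½ ln((1 + b₀)/(1 - b₀))`. A larger bias
shifts weight from `exp l` to the smaller `exp (-l)`. -/
theorem exists_moment_le {b₀ : ℝ} (h0 : 0 ≤ b₀) (h1 : b₀ < 1) :
    ∃ l : ℝ, 0 ≤ l ∧ ∀ b, b₀ ≤ b →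
      (1 + b) / 2 * Real.exp (-l) + (1 - b) / 2 * Real.exp l ≤ Real.sqrt (1 - b₀ ^ 2) := by
  set p := Real.sqrt (1 + b₀)
  set q := Real.sqrt (1 - b₀)
  have hp : 0 < p := Real.sqrt_pos.mpr (by linarith)
  have hq : 0 < q := Real.sqrt_pos.mpr (by linarith)
  have hp2 : p ^ 2 = 1 + b₀ := Real.sq_sqrt (by linarith)
  have hq2 : q ^ 2 = 1 - b₀ := Real.sq_sqrt (by linarith)
  have hqp : q ≤ p := Real.sqrt_le_sqrt (by linarith)
  have hpq : 1 ≤ p / q := (one_le_div hq).mpr hqp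
  refine ⟨Real.log (p / q), Real.log_nonneg hpq, fun b hb => ?_⟩
  rw [Real.exp_neg, Real.exp_log (by positivity), inv_div]
  have hs : Real.sqrt (1 - b₀ ^ 2) = p * q := by
    rw [← Real.sqrt_mul (by linarith)]
    congr 1
    ring
  rw [hs]
  have h2 : (1 + b₀) / 2 * (q / p) + (1 - b₀) / 2 * (p / q) = p * q := by
    rw [← hp2, ← hq2]
    field_simp
    ring
  have h3 : q / p ≤ 1 := (div_le_one hp).mpr hqp
  nlinarith

/-- Any function of a sign is affine, so averages of this exponential depend on the state only
through the bias. -/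
theorem exp_neg_mul_sign {σ : ℝ} (h : σ = 1 ∨ σ = -1) (l : ℝ) :
    Real.exp (-(l * σ)) = (Real.exp (-l) + Real.exp l) / 2 +
      (Real.exp (-l) - Real.exp l) / 2 * σ := by
  rcases h with rfl | rfl
  · rw [mul_one]; ring
  · rw [mul_neg_one, neg_neg]; ring

theorem sgn_mul_sgn (s s' : Bool) : sgn s * sgn s' = 1 ∨ sgn s * sgn s' = -1 := by
  cases s <;> cases s' <;> simp [sgn]

theorem sum_exp_eq {n : ℕ} {ψ : Ket (Assignment n)} (hψ : ‖ψ‖ = 1) (i : Fin n) (s : Bool)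
    (l : ℝ) :
    ∑ x, ‖ψ x‖ ^ 2 * Real.exp (-(l * (sgn s * sgn (x i)))) =
      (1 + sgn s * bias i ψ) / 2 * Real.exp (-l) +
        (1 - sgn s * bias i ψ) / 2 * Real.exp l := by
  simp only [exp_neg_mul_sign (sgn_mul_sgn _ _)]
  rw [sum_weights_affine hψ]
  have : ∑ x, ‖ψ x‖ ^ 2 * (sgn s * sgn (x i)) = sgn s * bias i ψ := by
    rw [bias, Finset.mul_sum]
    exact Finset.sum_congr rfl fun x _ => by ring
  rw [this]
  ring

theorem momentFactor_eq (θ : ℝ) :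
    momentFactor θ = Real.sqrt (1 - (Real.sin θ / Real.sqrt 2) ^ 2) := by
  rw [momentFactor, div_pow, Real.sq_sqrt (by norm_num : (0 : ℝ) ≤ 2), Real.cos_sq']
  congr 1
  ring

/-- The exponential moment of the outcome of a determined variable. -/
theorem exists_sum_exp_le {θ ε : ℝ} (hθ : 0 < Real.sin θ) (hε0 : 0 ≤ ε)
    (hε : ε ≤ Real.sin θ ^ 2 / 8) :
    ∃ l : ℝ, 0 ≤ l ∧ ∀ (n : ℕ) (φ : Formula n) (ψ : Ket (Assignment n)), NearGround θ φ ε ψ →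
      ∀ (i : Fin n) (s : Bool), (∀ x, Sat φ x → x i = s) →
      ∑ x, ‖ψ x‖ ^ 2 * Real.exp (-(l * (sgn s * sgn (x i)))) ≤ momentFactor θ := by
  have hs1 := Real.sin_le_one θ
  have h2 : (0 : ℝ) < Real.sqrt 2 := by positivity
  have h22 := sqrt_two_mul_self
  have hlow : (1.4 : ℝ) ≤ Real.sqrt 2 := Real.le_sqrt_of_sq_le (by norm_num)
  -- The threshold `b₀ = sin θ / √2` is the one for which `1 - b₀² = (1 + cos² θ)/2`.
  obtain ⟨l, hl, h⟩ := exists_moment_le (b₀ := Real.sin θ / Real.sqrt 2) (by positivity)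
    ((div_lt_one h2).mpr (by linarith))
  refine ⟨l, hl, fun n φ ψ hψ i s hs => ?_⟩
  rw [sum_exp_eq hψ.1, momentFactor_eq]
  refine h _ ?_
  set u := (groundSpace θ φ).starProjection ψ with hu
  have hmem : u ∈ groundSpace θ φ := Submodule.starProjection_apply_mem _ _
  have horth : inner ℂ u (ψ - u) = 0 := (Submodule.mem_orthogonal _ _).mp
    (Submodule.sub_starProjection_mem_orthogonal _) u hmem
  refine le_trans ?_ (le_bias_of_near hθ hψ.1 hmem horth hψ.2 hs)
  -- The numbers fit exactly: `1/√2 ≤ 23/32`, and the perturbation `2ε + 2ε²` is at most `(1/4 +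
  -- 1/32) sin θ = (9/32) sin θ`.
  have h3 : Real.sin θ / Real.sqrt 2 ≤ Real.sin θ * (23 / 32) := by
    rw [div_le_iff₀ h2]
    nlinarith
  have h4 : Real.sin θ ^ 2 ≤ Real.sin θ := by nlinarith
  have h5 : ε ≤ Real.sin θ / 8 := by linarith
  have h6 : ε ^ 2 ≤ ε / 8 := by nlinarith
  linarith


/-! ## Failure probabilities of the solvers -/

theorem momentFactor_nonneg (θ : ℝ) : 0 ≤ momentFactor θ := Real.sqrt_nonneg _

theorem outcome_neg (b : Bool) : ((if b then -1 else 1 : ℤ) : ℝ) = -sgn b := by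
  cases b <;> simp [sgn]

theorem outcome_pos (b : Bool) : ((if b then 1 else -1 : ℤ) : ℝ) = sgn b := by
  cases b <;> simp [sgn]

/-- Majority votes on the copies find the unique solution. -/
theorem loss_majority_le {n : ℕ} {θ ε : ℝ} (hθ : 0 < Real.sin θ) (hε0 : 0 ≤ ε)
    (hε : ε ≤ Real.sin θ ^ 2 / 8) {φ : Formula n} {x₀ : Assignment n} (hx₀ : Sat φ x₀)
    (huniq : ∀ x, Sat φ x → x = x₀) {prep : Alg (Ket (Assignment n))} {D : ℕ} {p : ℝ}
    (hprep : PrepSpec prep D p (NearGround θ φ ε)) (hp1 : p ≤ 1) [DecidablePred (Sat φ)]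
    (R m t : ℕ) (ht : m * D + R ≤ t) :
    loss (do
      let v ← tally prep R 0
      return fun i => if 0 < v i then false else true) t
      (fun a _ => if Sat φ a then 0 else 1) ≤
      ENNReal.ofReal (2 ^ R * (1 - p / 2) ^ m + n * momentFactor θ ^ R) := by
  obtain ⟨l, hl, hmoment⟩ := exists_sum_exp_le hθ hε0 hε
  rw [loss_bind]
  simp only [loss_pure]
  have h := loss_tally_le hprep hp1 (fun ψ hψ => hψ.1) (t₀ := 0)
    (f := fun v _ => if Sat φ (fun i => if 0 < v i then false else true) then 0 else 1)
    (fun v s => by split_ifs <;> simp)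
    -- The sum over qubits builds in the union bound. A wrong vote at `i`, ties included, makes the
    -- exponent nonnegative, so `W ≥ 1`. The tally counts `|0⟩` as `+1`, hence the sign.
    (W := fun v => ∑ i, Real.exp (l * (sgn (x₀ i) * v i))) (ρ := momentFactor θ) (ζ := 0)
    (fun v => Finset.sum_nonneg fun i _ => (Real.exp_pos _).le) (momentFactor_nonneg θ) le_rfl
    ?_ ?_ R 0 m t (by omega)
  · refine h.trans (ENNReal.ofReal_le_ofReal (le_of_eq ?_))
    simp
    ring
  · intro v s _
    split_ifs with hsat
    · exact zero_le
    · rw [ENNReal.one_le_ofReal, zero_add]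
      have hne : (fun i => if 0 < v i then false else true) ≠ x₀ := fun h => hsat (h ▸ hx₀)
      obtain ⟨i, hi⟩ := Function.ne_iff.mp hne
      refine le_trans ?_ (Finset.single_le_sum (fun i _ => (Real.exp_pos _).le)
        (Finset.mem_univ i))
      rw [Real.one_le_exp_iff]
      refine mul_nonneg hl ?_
      cases hx : x₀ i
      · have : v i ≤ 0 := by
          by_contra hv
          push Not at hv
          simp [hv, hx] at hi
        have : (v i : ℝ) ≤ 0 := by exact_mod_cast this
        simp only [sgn, Bool.false_eq_true, if_false]
        linarith
      · have : 0 ≤ v i := by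
          by_contra hv
          push Not at hv
          simp [hv.le.not_gt, hx] at hi
        have : (0 : ℝ) ≤ v i := by exact_mod_cast this
        simpa [sgn] using this
  · intro ψ hψ v
    simp only [Finset.mul_sum]
    rw [Finset.sum_comm]
    refine Finset.sum_le_sum fun i _ => ?_
    have h1 := hmoment n φ ψ hψ i (x₀ i) fun x hx => by rw [huniq x hx]
    calc ∑ x, ‖ψ x‖ ^ 2 * Real.exp (l * (sgn (x₀ i) * ((v i + if x i then -1 else 1 : ℤ) : ℝ)))
        = (∑ x, ‖ψ x‖ ^ 2 * Real.exp (-(l * (sgn (x₀ i) * sgn (x i))))) *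
            Real.exp (l * (sgn (x₀ i) * v i)) := by
          rw [Finset.sum_mul]
          refine Finset.sum_congr rfl fun x _ => ?_
          rw [mul_assoc, ← Real.exp_add, Int.cast_add, outcome_neg]
          congr 2
          ring
      _ ≤ _ := mul_le_mul_of_nonneg_right h1 (Real.exp_pos _).le

/-- Comparing distances to `± sin θ` amounts to taking the sign of the tally, with ties decided as
FALSE. -/
theorem abs_add_le_abs_sub_iff {a b : ℝ} (hb : 0 < b) : |a + b| ≤ |a - b| ↔ a ≤ 0 := by
  rw [← sq_le_sq]
  constructor
  · intro h; nlinarith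
  · intro h; nlinarith

/-- The readout of the first qubit finds a value that some solution has: the exponential moment
that controls the probability of a wrong decision. -/
theorem exists_potential_first {n : ℕ} {θ ε : ℝ} (hθ : 0 < Real.sin θ) (hε0 : 0 ≤ ε)
    (hε : ε ≤ Real.sin θ ^ 2 / 8) {φ : Formula (n + 1)} (hsat : ∃ x, Sat φ x) {dec : ℤ → Bool}
    (hdec : ∀ v, dec v = false ↔ v ≤ 0) :
    ∃ W : ℤ → ℝ, (∀ v, 0 ≤ W v) ∧ W 0 ≤ 1 ∧
      (∀ v, (¬ ∃ x, Sat φ x ∧ x 0 = dec v) → 1 ≤ W v) ∧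
      ∀ ψ, NearGround θ φ ε ψ → ∀ v,
        ∑ x, ‖ψ x‖ ^ 2 * W (v + if x 0 then 1 else -1) ≤ momentFactor θ * W v := by
  obtain ⟨l, hl, hmoment⟩ := exists_sum_exp_le hθ hε0 hε
  -- If both values extend to solutions no decision is wrong, and the zero potential works although
  -- the bias is uncontrolled.
  by_cases hall : ∀ s, ∃ x, Sat φ x ∧ x 0 = s
  · exact ⟨fun _ => 0, fun _ => le_rfl, zero_le_one, fun v hv => absurd (hall _) hv,
      fun ψ _ v => by simp⟩
  · push Not at hall
    obtain ⟨s', hs'⟩ := hall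
    have hforced : ∀ x, Sat φ x → x 0 = !s' := by
      intro x hx
      have := hs' x hx
      cases s' <;> cases hx0 : x 0 <;> simp_all
    refine ⟨fun v => Real.exp (-(l * (sgn (!s') * v))), fun v => (Real.exp_pos _).le,
      by simp, fun v hv => ?_, fun ψ hψ v => ?_⟩
    · rw [Real.one_le_exp_iff, Left.nonneg_neg_iff]
      refine mul_nonpos_of_nonneg_of_nonpos hl ?_
      have hne : dec v = s' := by
        by_contra hcon
        obtain ⟨x, hx⟩ := hsat
        refine hv ⟨x, hx, ?_⟩
        rw [hforced x hx]
        cases s' <;> cases hd : dec v <;> simp_all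
      cases s'
      · have : (v : ℝ) ≤ 0 := by exact_mod_cast (hdec v).mp hne
        simpa [sgn] using this
      · have : 0 < v := by
          by_contra hcon
          have := (hdec v).mpr (not_lt.mp hcon)
          rw [hne] at this
          cases this
        have : (0 : ℝ) < v := by exact_mod_cast this
        simp only [sgn, Bool.not_true, Bool.false_eq_true, if_false]
        linarith
    · have h1 := hmoment (n + 1) φ ψ hψ 0 (!s') hforced
      calc ∑ x, ‖ψ x‖ ^ 2 *
            Real.exp (-(l * (sgn (!s') * ((v + if x 0 then 1 else -1 : ℤ) : ℝ))))
          = (∑ x, ‖ψ x‖ ^ 2 * Real.exp (-(l * (sgn (!s') * sgn (x 0))))) *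
            Real.exp (-(l * (sgn (!s') * v))) := by
            rw [Finset.sum_mul]
            refine Finset.sum_congr rfl fun x _ => ?_
            rw [mul_assoc, ← Real.exp_add, Int.cast_add, outcome_pos]
            congr 2
            ring
        _ ≤ _ := mul_le_mul_of_nonneg_right h1 (Real.exp_pos _).le

/-- Determining the variables one after the other. -/
theorem loss_multipleLoop_le {θ ε Δ : ℝ} {g Λ r : ℕ} {mode : Mode} (hθ : 0 < Real.sin θ)
    (hε0 : 0 ≤ ε) (hε : ε ≤ Real.sin θ ^ 2 / 8) (hr : 0 < r) {D m : ℕ → ℕ} {p : ℕ → ℝ}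
    (hspec : ∀ (k : ℕ) (B : List (Assignment k)) (φ : Formula k), 1 ≤ k → B.length = Λ →
      Admissible θ Δ g B φ →
      AttemptSpec (attempt θ (schedule θ B φ ε) mode) (D k) (p k) (NearGround θ φ ε))
    (hD : ∀ k, 1 ≤ D k) (hp1 : ∀ k, p k ≤ 1) {η : ℝ} (hη0 : 0 ≤ η)
    (hη : ∀ k, 1 ≤ k → 2 ^ r * (1 - p k / 2) ^ m k + momentFactor θ ^ r ≤ η)
    (n : ℕ) (B : List (Assignment n)) (φ : Formula n) [DecidablePred (Sat φ)]
    (hB : B.length = Λ) (h : Admissible θ Δ g B φ) (t : ℕ)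
    (ht : ∑ k ∈ Finset.range n, (m (k + 1) * D (k + 1) + r) ≤ t) :
    loss (multipleLoop mode θ ε r n B φ) t (fun a _ => if Sat φ a then 0 else 1) ≤
      ENNReal.ofReal (n * η) := by
  classical
  induction n generalizing t with
  | zero =>
    rw [multipleLoop, loss_pure, if_pos]
    · exact zero_le
    · obtain ⟨x, hx⟩ := h.sat
      rwa [Subsingleton.elim Fin.elim0 x]
  | succ n ih =>
    rw [Finset.sum_range_succ] at ht
    let dec : ℤ → Bool := fun v =>
      if |(v : ℝ) / r + Real.sin θ| ≤ |(v : ℝ) / r - Real.sin θ| then false else true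
    have hdec : ∀ v, dec v = false ↔ v ≤ 0 := by
      intro v
      have hr' : (0 : ℝ) < r := by exact_mod_cast hr
      have hv : (v : ℝ) / r ≤ 0 ↔ v ≤ 0 := by
        rw [div_le_iff₀ hr', zero_mul]
        norm_cast
      simp only [dec, abs_add_le_abs_sub_iff hθ, hv]
      by_cases hv : v ≤ 0 <;> simp [hv]
    rw [multipleLoop, loss_bind]
    set f : ℤ → ℕ → ℝ≥0∞ := fun v s => loss (do
      let rest ← multipleLoop mode θ ε r n (B.map fun b i => b i.succ) (φ.assign (dec v))
      return Fin.cons (dec v) rest : Alg (Assignment (n + 1))) s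
        (fun a _ => if Sat φ a then 0 else 1) with hf
    change loss (tallyFirst (prepare mode θ B φ ε) r 0) t f ≤ _
    have hf1 : ∀ v s, f v s ≤ 1 := fun v s => loss_le_one _ _ fun a s => by
      split_ifs <;> simp
    set t₀ := ∑ k ∈ Finset.range n, (m (k + 1) * D (k + 1) + r) with ht₀
    -- After a correct decision the restricted formula is admissible with unchanged `Δ`, `g` and
    -- number of layers, so induction applies; its loss `n η` enters below as `ζ`.
    have hok : ∀ v s, (∃ x, Sat φ x ∧ x 0 = dec v) → t₀ ≤ s →
        f v s ≤ ENNReal.ofReal (n * η) := by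
      intro v s hv hs
      have h1 := ih (B.map fun b i => b i.succ) (φ.assign (dec v)) (by simpa using hB)
        (h.assign hv) s hs
      rw [hf]
      simp only [loss_bind, loss_pure, ← sat_assign_iff]
      exact h1
    clear_value f dec
    obtain ⟨W, hW, hW0, hWdec, hWstep⟩ := exists_potential_first hθ hε0 hε h.sat hdec
    have hmain := loss_tallyFirst_le
      (prepSpec_prepare (hspec (n + 1) B φ (by omega) hB h) (hD _) (hp1 _))
      (hp1 _) (fun ψ hψ => hψ.1) (t₀ := t₀) (f := f) hf1 hW (momentFactor_nonneg θ)
      (ζ := n * η) (by positivity) (fun v s hs => by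
        by_cases hv : ∃ x, Sat φ x ∧ x 0 = dec v
        · refine (hok v s hv hs).trans (ENNReal.ofReal_le_ofReal ?_)
          linarith [hW v]
        · refine (hf1 v s).trans ?_
          rw [ENNReal.one_le_ofReal]
          have := hWdec v hv
          have : 0 ≤ (n : ℝ) * η := by positivity
          linarith)
      hWstep r 0 (m (n + 1)) t (by omega)
    refine hmain.trans (ENNReal.ofReal_le_ofReal ?_)
    have h2 := hη (n + 1) (by omega)
    have h3 : momentFactor θ ^ r * W 0 ≤ momentFactor θ ^ r :=
      mul_le_of_le_one_right (pow_nonneg (momentFactor_nonneg θ) r) hW0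
    push_cast
    linarith only [h2, h3]


/-! ## Perfect hash families -/

/-- Fixing one bijection of `S` with the symbols leaves the other `n - 3` values free, so at least
`1/27` of all functions separate `S`. The true fraction `6/27` is not needed. -/
theorem pow_le_card_injOn {n : ℕ} {S : Finset (Fin n)} (hS : S.card = 3) [DecidablePred
    fun f : Fin n → Fin 3 => Set.InjOn f (S : Set (Fin n))] :
    3 ^ n ≤ 27 * (Finset.univ.filter fun f : Fin n → Fin 3 =>
      Set.InjOn f (S : Set (Fin n))).card := by
  let e := S.equivFinOfCardEq hS
  let t : Fin n → Finset (Fin 3) := fun i => if h : i ∈ S then {e ⟨i, h⟩} else Finset.univ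
  have hsub : Fintype.piFinset t ⊆ Finset.univ.filter fun f : Fin n → Fin 3 =>
      Set.InjOn f (S : Set (Fin n)) := by
    intro f hf
    rw [Fintype.mem_piFinset] at hf
    have hfe : ∀ (i : Fin n) (h : i ∈ S), f i = e ⟨i, h⟩ := by
      intro i h
      have := hf i
      simpa only [t, dif_pos h, Finset.mem_singleton] using this
    refine Finset.mem_filter.mpr ⟨Finset.mem_univ _, fun i hi j hj hij => ?_⟩
    rw [hfe i hi, hfe j hj] at hij
    exact congrArg Subtype.val (e.injective hij)
  have hcard : 27 * (Fintype.piFinset t).card = 3 ^ n := by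
    rw [Fintype.card_piFinset]
    have h1 : (27 : ℕ) = ∏ i : Fin n, if i ∈ S then 3 else 1 := by
      rw [Finset.prod_ite_mem, Finset.univ_inter, Finset.prod_const, hS]
      norm_num
    rw [h1, ← Finset.prod_mul_distrib]
    calc ∏ i, (if i ∈ S then 3 else 1) * (t i).card = ∏ _i : Fin n, 3 := by
          refine Finset.prod_congr rfl fun i _ => ?_
          by_cases h : i ∈ S <;> simp [t, h]
      _ = 3 ^ n := by simp
  rw [← hcard]
  exact Nat.mul_le_mul_left _ (Finset.card_le_card hsub)

open Classical in
/-- Some function separates a constant fraction of given triples. -/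
theorem exists_separating {n : ℕ} (𝒮 : Finset (Finset (Fin n))) (h𝒮 : ∀ S ∈ 𝒮, S.card = 3) :
    ∃ f : Fin n → Fin 3, 27 * (𝒮.filter fun S : Finset (Fin n) => ¬ Set.InjOn f (S : Set (Fin n))).card ≤
      26 * 𝒮.card := by
  have hsum : ∑ _f : Fin n → Fin 3, 𝒮.card ≤
      ∑ f : Fin n → Fin 3, 27 * (𝒮.filter fun S : Finset (Fin n) => Set.InjOn f (S : Set (Fin n))).card := by
    have h1 : ∑ f : Fin n → Fin 3, (𝒮.filter fun S : Finset (Fin n) => Set.InjOn f (S : Set (Fin n))).card =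
        ∑ S ∈ 𝒮, (Finset.univ.filter fun f : Fin n → Fin 3 =>
          Set.InjOn f (S : Set (Fin n))).card := by
      simp only [Finset.card_filter]
      exact Finset.sum_comm
    rw [← Finset.mul_sum, h1, Finset.mul_sum]
    calc ∑ _f : Fin n → Fin 3, 𝒮.card = ∑ _S ∈ 𝒮, 3 ^ n := by simp [mul_comm]
      _ ≤ _ := Finset.sum_le_sum fun S hS => pow_le_card_injOn (h𝒮 S hS)
  obtain ⟨f, -, hf⟩ := Finset.exists_le_of_sum_le
    (s := (Finset.univ : Finset (Fin n → Fin 3))) Finset.univ_nonempty hsum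
  refine ⟨f, ?_⟩
  have := Finset.card_filter_add_card_filter_not (s := 𝒮)
    fun S : Finset (Fin n) => Set.InjOn f (S : Set (Fin n))
  omega

-- Greedy choice: every new function separates at least `1/27` of the triples still unseparated.
open Classical in
theorem exists_family_separating {n : ℕ} (N : ℕ) (𝒮 : Finset (Finset (Fin n)))
    (h𝒮 : ∀ S ∈ 𝒮, S.card = 3) :
    ∃ F : Fin N → Fin n → Fin 3,
      27 ^ N * (𝒮.filter fun S : Finset (Fin n) => ∀ i, ¬ Set.InjOn (F i) (S : Set (Fin n))).card ≤
        26 ^ N * 𝒮.card := by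
  induction N generalizing 𝒮 with
  | zero => exact ⟨Fin.elim0, by simp⟩
  | succ N ih =>
    obtain ⟨f, hf⟩ := exists_separating 𝒮 h𝒮
    obtain ⟨F, hF⟩ := ih (𝒮.filter fun S : Finset (Fin n) => ¬ Set.InjOn f (S : Set (Fin n)))
      fun S hS => h𝒮 S (Finset.mem_filter.mp hS).1
    refine ⟨Fin.cons f F, ?_⟩
    have h1 : (𝒮.filter fun S : Finset (Fin n) => ∀ i : Fin (N + 1),
        ¬ Set.InjOn ((Fin.cons f F : Fin (N + 1) → Fin n → Fin 3) i) (S : Set (Fin n))) =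
        (𝒮.filter fun S : Finset (Fin n) => ¬ Set.InjOn f (S : Set (Fin n))).filter fun S : Finset (Fin n) =>
          ∀ i, ¬ Set.InjOn (F i) (S : Set (Fin n)) := by
      ext S
      simp only [Finset.mem_filter, Fin.forall_fin_succ, Fin.cons_zero, Fin.cons_succ, and_assoc]
    rw [h1, pow_succ, pow_succ]
    calc 27 ^ N * 27 * _ = 27 * (27 ^ N * _) := by ring
      _ ≤ 27 * (26 ^ N * _) := Nat.mul_le_mul_left _ hF
      _ = 26 ^ N * (27 * _) := by ring
      _ ≤ 26 ^ N * (26 * 𝒮.card) := Nat.mul_le_mul_left _ hf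
      _ = _ := by ring

/-- Perfect hash families of logarithmic size. -/
theorem exists_perfectHashFamily :
    ∃ K : ℝ, ∀ n : ℕ, 3 ≤ n → ∃ (N : ℕ) (F : Fin N → Fin n → Fin 3),
      IsPerfectHashFamily F ∧ (N : ℝ) ≤ K * Real.log n := by
  classical
  set l := Real.log (27 / 26) with hl
  have hl0 : 0 < l := Real.log_pos (by norm_num)
  -- More than `3 ln n / l` functions leave fewer than `n³ (26/27)^N < 1` triples unseparated, hence
  -- none. The `2` covers rounding up and the additional function, as `ln n ≥ 1`.
  refine ⟨3 / l + 2, fun n hn => ?_⟩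
  have hn3 : (3 : ℝ) ≤ n := by exact_mod_cast hn
  have hlog1 : 1 ≤ Real.log n := by
    rw [Real.le_log_iff_exp_le (by linarith)]
    exact (Real.exp_one_lt_d9.le.trans (by norm_num)).trans hn3
  set N := ⌈3 * Real.log n / l⌉₊ + 1 with hN
  obtain ⟨F, hF⟩ := exists_family_separating N (Finset.univ.powersetCard 3 : Finset (Finset (Fin n)))
    fun S hS => (Finset.mem_powersetCard.mp hS).2
  refine ⟨N, F, ?_, ?_⟩
  · have hlt : 26 ^ N * (Finset.univ.powersetCard 3 : Finset (Finset (Fin n))).card < 27 ^ N := by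
      have h1 : 3 * Real.log n < N * l := by
        have := Nat.le_ceil (3 * Real.log n / l)
        rw [div_le_iff₀ hl0] at this
        rw [hN]
        push_cast
        linarith
      have h2 : (n : ℝ) ^ 3 < (27 / 26) ^ N := by
        rw [← Real.log_lt_log_iff (by positivity) (by positivity), Real.log_pow, Real.log_pow]
        exact_mod_cast h1
      have h3 : (26 : ℝ) ^ N * (n : ℝ) ^ 3 < 27 ^ N := by
        rw [div_pow, lt_div_iff₀ (by positivity)] at h2
        linarith
      have h4 : (Finset.univ.powersetCard 3 : Finset (Finset (Fin n))).card ≤ n ^ 3 := by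
        rw [Finset.card_powersetCard, Finset.card_univ, Fintype.card_fin]
        exact Nat.choose_le_pow n 3
      calc _ ≤ 26 ^ N * n ^ 3 := Nat.mul_le_mul_left _ h4
        _ < 27 ^ N := by exact_mod_cast h3
    intro S hS
    by_contra hcon
    push Not at hcon
    have hmem : S ∈ (Finset.univ.powersetCard 3 : Finset (Finset (Fin n))).filter
        fun S : Finset (Fin n) => ∀ i, ¬ Set.InjOn (F i) (S : Set (Fin n)) :=
      Finset.mem_filter.mpr ⟨Finset.mem_powersetCard.mpr ⟨Finset.subset_univ _, hS⟩, hcon⟩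
    have hpos := Finset.card_pos.mpr ⟨S, hmem⟩
    have : 27 ^ N ≤ 27 ^ N * _ := Nat.le_mul_of_pos_right (27 ^ N) hpos
    omega
  · have h1 := Nat.ceil_lt_add_one (show 0 ≤ 3 * Real.log n / l by positivity)
    have h2 : 3 * Real.log n / l = 3 / l * Real.log n := by ring
    rw [hN]
    push_cast
    rw [h2] at h1 ⊢
    linarith

theorem length_layerStrings {N n : ℕ} (F : Fin N → Fin n → Fin 3) :
    (layerStrings F).length = 8 * N := by
  simp [layerStrings, List.length_flatMap, mul_comm]

/-- Every clause with at most three literals has a layer. -/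
theorem exists_compatible_layerStrings {N n : ℕ} (hn : 3 ≤ n) {F : Fin N → Fin n → Fin 3}
    (hF : IsPerfectHashFamily F) {φ : Formula n} (hφ : IsKSat 3 φ) :
    ∀ c ∈ φ, ∃ b ∈ layerStrings F, compatible b c = true := by
  intro c hc
  obtain ⟨S, hcS, hS⟩ := Finset.exists_superset_card_eq (hφ c hc)
    (by rw [Fintype.card_fin]; exact hn)
  obtain ⟨i, hi⟩ := hF S hS
  -- A symbol gets the bit `1` if it is the symbol of a positive literal. Injectivity on `S`, the
  -- support padded to three variables, prevents conflict with a negative literal.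
  let s : Fin 3 → Bool := fun k => decide (∃ j ∈ S, F i j = k ∧ c j = some true)
  refine ⟨s ∘ F i, ?_, ?_⟩
  · exact List.mem_flatMap.mpr ⟨i, List.mem_finRange i, List.mem_map.mpr
      ⟨s, Finset.mem_toList.mpr (Finset.mem_univ s), rfl⟩⟩
  · simp only [compatible, decide_eq_true_eq, Function.comp_apply]
    intro j
    cases hcj : c j with
    | none => exact Or.inl rfl
    | some v =>
      right
      have hjS : j ∈ S := hcS (by simp [hcj])
      congr 1
      cases v
      · symm
        simp only [s, decide_eq_false_iff_not]
        rintro ⟨j', hj', hjj', hc'⟩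
        rw [hi hj' hjS hjj', hcj] at hc'
        cases hc'
      · symm
        simp only [s, decide_eq_true_eq]
        exact ⟨j, hjS, rfl, hcj⟩

theorem one_le_of_isPerfectHashFamily {N n : ℕ} (hn : 3 ≤ n) {F : Fin N → Fin n → Fin 3}
    (hF : IsPerfectHashFamily F) : 1 ≤ N := by
  obtain ⟨S, hS⟩ := Finset.exists_subset_card_eq
    (show 3 ≤ (Finset.univ : Finset (Fin n)).card by simpa using hn)
  obtain ⟨i, -⟩ := hF S hS.2
  exact Fin.pos i

theorem admissible_layerStrings {N n : ℕ} (hn : 3 ≤ n) {F : Fin N → Fin n → Fin 3}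
    (hF : IsPerfectHashFamily F) {φ : Formula n} (hφ : IsKSat 3 φ) (hsat : ∃ x, Sat φ x)
    {θ : ℝ} {g : ℕ} (hg : NoncommBound θ φ g) :
    Admissible θ (uniformGap θ φ) g (layerStrings F) φ :=
  ⟨hsat, gapAtLeast_uniformGap θ φ, hg.noncommLe, exists_compatible_layerStrings hn hF hφ⟩


/-! ## Budgets -/

theorem cos_half_pos {θ : ℝ} (h0 : 0 < θ) (h1 : θ ≤ Real.pi / 2) : 0 < Real.cos (θ / 2) :=
  Real.cos_pos_of_mem_Ioo ⟨by linarith [Real.pi_pos], by linarith [Real.pi_pos]⟩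

theorem sin_pos_of_angle {θ : ℝ} (h0 : 0 < θ) (h1 : θ ≤ Real.pi / 2) : 0 < Real.sin θ :=
  Real.sin_pos_of_pos_of_lt_pi h0 (by linarith [Real.pi_pos])

/-- The factor of the runtime bound that depends on the tolerance and the number of qubits. -/
def angleFactor (θ : ℝ) (n : ℕ) : ℝ :=
  Real.log (1 / (1 - Real.cos θ ^ 2)) + n * Real.log (1 / Real.cos (θ / 2))

theorem log_inv_tolerance {θ κ : ℝ} (hκ : 0 < κ) (hs : 0 < Real.sin θ)
    (hc : 0 < Real.cos (θ / 2)) (n : ℕ) :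
    Real.log (κ * Real.sin θ ^ 2 * Real.cos (θ / 2) ^ n)⁻¹ =
      Real.log κ⁻¹ + angleFactor θ n := by
  have hs2 : 1 - Real.cos θ ^ 2 = Real.sin θ ^ 2 := by rw [Real.sin_sq]
  rw [angleFactor, hs2, one_div, one_div, mul_inv, mul_inv,
    Real.log_mul (by positivity) (by positivity), Real.log_mul (by positivity) (by positivity),
    ← inv_pow (Real.cos (θ / 2)), Real.log_pow]
  ring

theorem angleFactor_mono {θ : ℝ} (hc : 0 < Real.cos (θ / 2)) {k n : ℕ} (h : k ≤ n) :
    angleFactor θ k ≤ angleFactor θ n := by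
  have : 0 ≤ Real.log (1 / Real.cos (θ / 2)) :=
    Real.log_nonneg ((one_le_div hc).mpr (Real.cos_le_one _))
  have h2 : (k : ℝ) ≤ n := by exact_mod_cast h
  unfold angleFactor
  nlinarith

theorem angleFactor_nonneg {θ : ℝ} (hs : 0 < Real.sin θ) (hc : 0 < Real.cos (θ / 2)) (n : ℕ) :
    0 ≤ angleFactor θ n := by
  refine le_trans ?_ (angleFactor_mono hc (Nat.zero_le n))
  rw [angleFactor, Nat.cast_zero, zero_mul, add_zero]
  refine Real.log_nonneg ?_
  rw [← Real.sin_sq, one_le_div (by positivity)]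
  exact pow_le_one₀ hs.le (Real.sin_le_one θ)

/-- The first logarithm vanishes at `θ = π/2` and the second tends to zero as `θ → 0`, but not
together: with `x = cos²(θ/2)`, two qubits already give `-ln(4x²(1 - x))`, and `4x²(1 - x) ≤ 3/4`.
This uniform bound lets additive constants be absorbed. -/
theorem quarter_le_angleFactor {θ : ℝ} (hs : 0 < Real.sin θ) (hc : 0 < Real.cos (θ / 2)) {n : ℕ}
    (hn : 3 ≤ n) : 1 / 4 ≤ angleFactor θ n := by
  refine le_trans ?_ (angleFactor_mono hc (show 2 ≤ n by omega))
  set x := Real.cos (θ / 2) ^ 2 with hx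
  have hx0 : 0 < x := by positivity
  have hx1 : x ≤ 1 := pow_le_one₀ hc.le (Real.cos_le_one _)
  have hsin : Real.sin θ ^ 2 = 4 * x * (1 - x) := by
    rw [sin_eq_half, hx]
    have := Real.sin_sq_add_cos_sq (θ / 2)
    have h2 : Real.sin (θ / 2) ^ 2 = 1 - Real.cos (θ / 2) ^ 2 := by linarith
    rw [mul_pow, mul_pow, h2]
    ring
  have h1 := log_inv_tolerance (κ := 1) one_pos hs hc 2
  rw [one_mul, inv_one, Real.log_one, zero_add, hsin, ← hx] at h1
  rw [← h1, Real.log_inv]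
  have hpos : 0 < 4 * x * (1 - x) * x := by
    rw [← hsin]; positivity
  have h2 := Real.log_le_sub_one_of_pos hpos
  have h3 : 4 * x * (1 - x) * x ≤ 3 / 4 := by
    nlinarith [mul_nonneg hx0.le (sq_nonneg (x - 2 / 3)), sq_nonneg (x - 2 / 3)]
  linarith

/-- The chance of having made too few attempts is at most `exp (-A)`. -/
theorem two_pow_mul_pow_le {p A : ℝ} (hp : 0 < p) (hp1 : p ≤ 1) {r m : ℕ}
    (hm : 2 / p * (r * Real.log 2 + A) ≤ m) :
    2 ^ r * (1 - p / 2) ^ m ≤ Real.exp (-A) := by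
  have h1 : (1 - p / 2) ^ m ≤ Real.exp (-(p / 2)) ^ m :=
    pow_le_pow_left₀ (by linarith) (by linarith [Real.add_one_le_exp (-(p / 2))]) m
  have h2 : (2 : ℝ) ^ r = Real.exp (r * Real.log 2) := by
    rw [Real.exp_nat_mul, Real.exp_log two_pos]
  have h3 : r * Real.log 2 + A ≤ m * (p / 2) := by
    rw [div_mul_eq_mul_div, div_le_iff₀ hp] at hm
    linarith
  calc 2 ^ r * (1 - p / 2) ^ m ≤ Real.exp (r * Real.log 2) * Real.exp (-(p / 2)) ^ m := by
        rw [h2]; gcongr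
    _ = Real.exp (r * Real.log 2 - m * (p / 2)) := by
        rw [← Real.exp_nat_mul, ← Real.exp_add]; congr 1; ring
    _ ≤ _ := Real.exp_le_exp.mpr (by linarith)

/-- A bound for the number of cycles. -/
def cycleBound (θ d ε : ℝ) (k : ℕ) : ℕ := ⌊1 + Real.log (ε * Real.cos (θ / 2) ^ k)⁻¹ / d⌋₊

/-- A bound for the number of measurements of an attempt. -/
def attemptCost (θ d ε : ℝ) (Λ : ℕ) : Mode → ℕ → ℕ
  | .plain, k => cycleBound θ d ε k * Λ
  | .amplified, k => (2 * maxIterates θ k + 1) * (cycleBound θ d ε k * Λ + 1)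

/-- A lower bound for the success probability of an attempt. -/
def attemptProb (θ : ℝ) : Mode → ℕ → ℝ
  | .plain, k => (Real.cos (θ / 2) ^ k) ^ 2
  | .amplified, _ => 1 / 4

theorem attemptProb_pos {θ : ℝ} (hc : 0 < Real.cos (θ / 2)) (mode : Mode) (k : ℕ) :
    0 < attemptProb θ mode k := by
  cases mode <;> simp only [attemptProb] <;> positivity

theorem attemptProb_le_one {θ : ℝ} (hc : 0 < Real.cos (θ / 2)) (mode : Mode) (k : ℕ) :
    attemptProb θ mode k ≤ 1 := by
  cases mode
  · exact pow_le_one₀ (by positivity) (pow_le_one₀ hc.le (Real.cos_le_one _))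
  · norm_num [attemptProb]

section

variable {θ d ε κ : ℝ}

theorem log_inv_tolerance_nonneg (hs : 0 < Real.sin θ) (hc : 0 < Real.cos (θ / 2))
    (hκ : 0 < κ) (hκ1 : κ ≤ 1) (k : ℕ) :
    0 ≤ Real.log (κ * Real.sin θ ^ 2 * Real.cos (θ / 2) ^ k)⁻¹ := by
  rw [log_inv_tolerance hκ hs hc]
  exact add_nonneg (Real.log_nonneg ((one_le_inv₀ hκ).mpr hκ1)) (angleFactor_nonneg hs hc k)

theorem one_le_cycleBound (hs : 0 < Real.sin θ) (hc : 0 < Real.cos (θ / 2))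
    (hκ : 0 < κ) (hκ1 : κ ≤ 1) (hd : 0 < d) (k : ℕ) :
    1 ≤ cycleBound θ d (κ * Real.sin θ ^ 2) k := by
  refine Nat.le_floor ?_
  have := div_nonneg (log_inv_tolerance_nonneg hs hc hκ hκ1 k) hd.le
  push_cast
  linarith

/-- The additive terms sum to at most `1 + 99 = 100`, which is at most `400` times the angle factor.
-/
theorem cycleBound_le (hs : 0 < Real.sin θ) (hc : 0 < Real.cos (θ / 2))
    (hκ : 1 / 100 ≤ κ) (hκ1 : κ ≤ 1) (hd : 0 < d) (hd1 : d ≤ 1) {k n : ℕ} (hkn : k ≤ n)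
    (hn : 3 ≤ n) :
    (cycleBound θ d (κ * Real.sin θ ^ 2) k : ℝ) ≤ 401 * (angleFactor θ n / d) := by
  have hκ0 : 0 < κ := by linarith
  have h1 := Nat.floor_le (a := 1 + Real.log (κ * Real.sin θ ^ 2 * Real.cos (θ / 2) ^ k)⁻¹ / d)
    (by have := div_nonneg (log_inv_tolerance_nonneg hs hc hκ0 hκ1 k) hd.le; linarith)
  refine h1.trans ?_
  rw [log_inv_tolerance hκ0 hs hc]
  have h2 : Real.log κ⁻¹ ≤ 99 := by
    have h3 : κ⁻¹ ≤ 100 := by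
      rw [inv_le_comm₀ hκ0 (by norm_num)]; linarith
    have := Real.log_le_sub_one_of_pos (inv_pos.mpr hκ0)
    linarith
  have h3 := angleFactor_mono hc hkn
  have h4 := quarter_le_angleFactor hs hc hn
  have h5 : 1 + (Real.log κ⁻¹ + angleFactor θ k) / d ≤ (401 * angleFactor θ n) / d := by
    rw [le_div_iff₀ hd, add_mul, div_mul_cancel₀ _ hd.ne']
    linarith
  linarith [mul_div_assoc 401 (angleFactor θ n) d]

theorem one_le_attemptCost (hs : 0 < Real.sin θ) (hc : 0 < Real.cos (θ / 2))
    (hκ : 0 < κ) (hκ1 : κ ≤ 1) (hd : 0 < d) {Λ : ℕ} (hΛ : 1 ≤ Λ) (mode : Mode) (k : ℕ) :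
    1 ≤ attemptCost θ d (κ * Real.sin θ ^ 2) Λ mode k := by
  cases mode
  · exact Nat.mul_pos (one_le_cycleBound hs hc hκ hκ1 hd k) hΛ
  · exact Nat.mul_pos (Nat.succ_pos _) (Nat.succ_pos _)

/-- The cost of an attempt over its success probability. -/
theorem attemptCost_div_le (hs : 0 < Real.sin θ) (hc : 0 < Real.cos (θ / 2))
    (hκ : 0 < κ) (hκ1 : κ ≤ 1) (hd : 0 < d) {Λ : ℕ} (hΛ : 1 ≤ Λ) (mode : Mode) (k : ℕ) :
    attemptCost θ d (κ * Real.sin θ ^ 2) Λ mode k / attemptProb θ mode k ≤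
      40 * ((cycleBound θ d (κ * Real.sin θ ^ 2) k * Λ : ℕ) : ℝ) *
        (2 / (1 + Real.cos θ)) ^ ((k : ℝ) / mode.q) := by
  have hcyc := one_le_cycleBound hs hc hκ hκ1 hd k
  set w := cycleBound θ d (κ * Real.sin θ ^ 2) k * Λ with hw
  have hw1 : (1 : ℝ) ≤ w := by exact_mod_cast Nat.mul_pos hcyc hΛ
  have hck : 0 < Real.cos (θ / 2) ^ k := by positivity
  rw [inv_cos_pow_eq θ k hc]
  cases mode
  · simp only [attemptCost, attemptProb, Mode.q, div_one, Real.rpow_two]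
    rw [← hw, div_eq_mul_inv]
    have : 0 ≤ (w : ℝ) * ((Real.cos (θ / 2) ^ k) ^ 2)⁻¹ := by positivity
    linarith
  · simp only [attemptCost, attemptProb, Mode.q]
    rw [div_self two_ne_zero, Real.rpow_one, ← hw]
    set y := (Real.cos (θ / 2) ^ k)⁻¹ with hy
    have hy1 : 1 ≤ y := (one_le_inv₀ hck).mpr (pow_le_one₀ hc.le (Real.cos_le_one _))
    have hJ : (maxIterates θ k : ℝ) ≤ y + 1 := by
      have h1 : (2 / (1 + Real.cos θ)) ^ ((k : ℝ) / 2) = y := by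
        rw [inv_cos_pow_eq θ k hc, div_self two_ne_zero, Real.rpow_one]
      rw [maxIterates, h1]
      exact (Nat.ceil_lt_add_one (by linarith)).le
    push_cast
    -- From `J ≤ y + 1` and `y ≥ 1`. The constant `40` is `5 · 2` divided by the success probability
    -- `1/4`.
    have h2 : 2 * (maxIterates θ k : ℝ) + 1 ≤ 5 * y := by linarith
    have h3 : (w : ℝ) + 1 ≤ 2 * w := by linarith
    calc (2 * (maxIterates θ k : ℝ) + 1) * (w + 1) / (1 / 4)
        = 4 * ((2 * (maxIterates θ k : ℝ) + 1) * (w + 1)) := by ring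
      _ ≤ 4 * ((5 * y) * (2 * w)) := by gcongr
      _ = 40 * w * y := by ring

theorem Admissible.attemptSpec {Δ : ℝ} {g : ℕ} (hΔ : 0 < Δ) (hΔ1 : Δ ≤ 1) (hg : 1 ≤ g)
    (hs : 0 < Real.sin θ) (hc : 0 < Real.cos (θ / 2)) (hκ : 0 < κ) (hκ1 : κ ≤ 1) {k Λ : ℕ}
    {B : List (Assignment k)} {φ : Formula k} (hB : B.length = Λ) (h : Admissible θ Δ g B φ)
    (mode : Mode) :
    AttemptSpec (attempt θ (schedule θ B φ (κ * Real.sin θ ^ 2)) mode)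
      (attemptCost θ (Δ / (4 * (g : ℝ) ^ 2)) (κ * Real.sin θ ^ 2) Λ mode k)
      (attemptProb θ mode k) (NearGround θ φ (κ * Real.sin θ ^ 2)) := by
  have hε : 0 < κ * Real.sin θ ^ 2 := by positivity
  have hlen : (schedule θ B φ (κ * Real.sin θ ^ 2)).length ≤
      cycleBound θ (Δ / (4 * (g : ℝ) ^ 2)) (κ * Real.sin θ ^ 2) k * Λ := by
    rw [length_schedule, hB]
    refine Nat.mul_le_mul_right _ (Nat.le_floor ?_)
    exact h.cycles_le hΔ hΔ1 hg (log_inv_tolerance_nonneg hs hc hκ hκ1 k)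
  cases mode
  · exact (h.attemptSpec_plain hΔ hg hc hε).mono hlen
  · exact (h.attemptSpec_amplified hΔ hg hc hε).mono
      (Nat.mul_le_mul_left _ (Nat.add_le_add_right hlen 1))

/-- A sufficient number of attempts for `r` copies. -/
def attemptCount (p A : ℝ) (r : ℕ) : ℕ := ⌈2 / p * (r * Real.log 2 + A)⌉₊

theorem attemptCount_le {p A : ℝ} (hp : 0 < p) (hp1 : p ≤ 1) {r : ℕ} (hr : 1 ≤ r) (hA0 : 0 ≤ A)
    (hA : A ≤ r) : (attemptCount p A r : ℝ) ≤ 5 * r / p := by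
  have hr1 : (1 : ℝ) ≤ r := by exact_mod_cast hr
  have hlog : Real.log 2 ≤ 1 := by linarith [Real.log_two_lt_d9]
  have hlog0 : 0 ≤ Real.log 2 := Real.log_nonneg one_le_two
  have h1 : (attemptCount p A r : ℝ) ≤ 2 / p * (r * Real.log 2 + A) + 1 :=
    (Nat.ceil_lt_add_one (by positivity)).le
  have h2 : 2 / p * (r * Real.log 2 + A) ≤ 2 / p * (r + r) := by
    gcongr
    nlinarith
  have h3 : (1 : ℝ) ≤ r / p := (one_le_div hp).mpr (hp1.trans hr1)
  calc (attemptCount p A r : ℝ) ≤ 2 / p * (r + r) + r / p := by linarith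
    _ = 5 * r / p := by ring

/-- The time for `r` copies of the state. -/
theorem copies_cost_le (hs : 0 < Real.sin θ) (hc : 0 < Real.cos (θ / 2))
    (hκ : 1 / 100 ≤ κ) (hκ1 : κ ≤ 1) (hd : 0 < d) (hd1 : d ≤ 1) {Λ : ℕ} (hΛ : 1 ≤ Λ)
    (mode : Mode) {k n : ℕ} (hkn : k ≤ n) (hn : 3 ≤ n) {A : ℝ} {r : ℕ} (hr : 1 ≤ r)
    (hA0 : 0 ≤ A) (hA : A ≤ r) :
    ((attemptCount (attemptProb θ mode k) A r *
        attemptCost θ d (κ * Real.sin θ ^ 2) Λ mode k + r : ℕ) : ℝ) ≤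
      96240 * r * (angleFactor θ n / d * Λ) * (2 / (1 + Real.cos θ)) ^ ((k : ℝ) / mode.q) := by
  have hκ0 : 0 < κ := by linarith
  have hp := attemptProb_pos hc mode k
  have hp1 := attemptProb_le_one hc mode k
  have hm := attemptCount_le hp hp1 hr hA0 hA
  have hD := attemptCost_div_le hs hc hκ0 hκ1 hd hΛ mode k
  have hD1 := one_le_attemptCost hs hc hκ0 hκ1 hd hΛ mode k
  have hcyc := cycleBound_le hs hc hκ hκ1 hd hd1 hkn hn
  set p := attemptProb θ mode k
  set D := attemptCost θ d (κ * Real.sin θ ^ 2) Λ mode k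
  set P := (2 / (1 + Real.cos θ)) ^ ((k : ℝ) / mode.q)
  have hP : 0 ≤ P := by
    refine Real.rpow_nonneg (div_nonneg zero_le_two ?_) _
    linarith [Real.neg_one_le_cos θ]
  have hD1' : (1 : ℝ) ≤ D := by exact_mod_cast hD1
  have hr0 : (0 : ℝ) ≤ r := Nat.cast_nonneg r
  have hDp : (1 : ℝ) ≤ D / p := (one_le_div hp).mpr (hp1.trans hD1')
  have hΛ0 : (0 : ℝ) ≤ Λ := Nat.cast_nonneg Λ
  push_cast at hD ⊢
  -- The `r` readouts are absorbed because `D / p ≥ 1`; the constant is `96240 = 6 · 40 · 401`.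
  calc (attemptCount p A r : ℝ) * D + r ≤ 5 * r / p * D + r * (D / p) := by
        refine add_le_add (mul_le_mul_of_nonneg_right hm (Nat.cast_nonneg D)) ?_
        exact le_mul_of_one_le_right hr0 hDp
    _ = 6 * r * (D / p) := by ring
    _ ≤ 6 * r * (40 * (cycleBound θ d (κ * Real.sin θ ^ 2) k * Λ) * P) := by gcongr
    _ ≤ 6 * r * (40 * (401 * (angleFactor θ n / d) * Λ) * P) := by gcongr
    _ = 96240 * r * (angleFactor θ n / d * Λ) * P := by ring

end

/-! ## Runtime bounds -/

/-- Here `n/δ ≥ 6` exceeds both `e` and `4`, so constants inside the logarithm become factors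
outside. -/
theorem log_bounds {n : ℕ} (hn : 3 ≤ n) {δ : ℝ} (hδ : 0 < δ) (hδ1 : δ ≤ 1 / 2) :
    1 ≤ Real.log (n / δ) ∧ Real.log (4 * (n / δ)) ≤ 2 * Real.log (n / δ) ∧
      1 / 2 ≤ Real.log δ⁻¹ := by
  have hn3 : (3 : ℝ) ≤ n := by exact_mod_cast hn
  have h6 : 6 ≤ n / δ := by
    rw [le_div_iff₀ hδ]
    linarith
  refine ⟨?_, ?_, ?_⟩
  · rw [Real.le_log_iff_exp_le (by linarith)]
    linarith [Real.exp_one_lt_d9]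
  · rw [Real.log_mul (by norm_num) (by linarith)]
    have : Real.log 4 ≤ Real.log (n / δ) := Real.log_le_log (by norm_num) (by linarith)
    linarith
  · have h2 : (2 : ℝ) ≤ δ⁻¹ := by
      rw [le_inv_comm₀ two_pos hδ]
      linarith
    have := Real.log_le_log two_pos h2
    linarith [Real.log_two_gt_d9]

theorem momentFactor_sq (θ : ℝ) : momentFactor θ ^ 2 = (1 + Real.cos θ ^ 2) / 2 :=
  Real.sq_sqrt (by positivity)

theorem momentFactor_pos (θ : ℝ) : 0 < momentFactor θ := Real.sqrt_pos.mpr (by positivity)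

theorem log_momentFactor (θ : ℝ) :
    Real.log (momentFactor θ) = -(Real.log (2 / (1 + Real.cos θ ^ 2)) / 2) := by
  have h1 : Real.log (momentFactor θ ^ 2) = -Real.log (2 / (1 + Real.cos θ ^ 2)) := by
    rw [momentFactor_sq, ← Real.log_inv, inv_div]
  rw [Real.log_pow] at h1
  push_cast at h1
  linarith

theorem momentFactor_pow_le {θ x : ℝ} {r : ℕ} (hx : 0 < x)
    (h : Real.log x⁻¹ ≤ r * (Real.log (2 / (1 + Real.cos θ ^ 2)) / 2)) :
    momentFactor θ ^ r ≤ x := by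
  rw [← Real.log_le_log_iff (pow_pos (momentFactor_pos θ) r) hx, Real.log_pow, log_momentFactor]
  rw [Real.log_inv] at h
  linarith

/-- The lower bound is `-ln(1 - u) ≥ u` at `u = sin² θ / 2`, tying the moment to the number of
copies in the multiple solution readout. The upper bound serves to absorb rounding for unique
solutions. -/
theorem readout_rate_bounds (θ : ℝ) :
    Real.sin θ ^ 2 / 2 ≤ Real.log (2 / (1 + Real.cos θ ^ 2)) ∧
      Real.log (2 / (1 + Real.cos θ ^ 2)) ≤ 1 := by
  have hpos : 0 < 1 + Real.cos θ ^ 2 := by positivity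
  constructor
  · have h0 : Real.log (2 / (1 + Real.cos θ ^ 2)) = -Real.log ((1 + Real.cos θ ^ 2) / 2) := by
      rw [← Real.log_inv, inv_div]
    rw [h0]
    have := Real.log_le_sub_one_of_pos (show 0 < (1 + Real.cos θ ^ 2) / 2 by positivity)
    rw [Real.cos_sq'] at this ⊢
    linarith
  · have := Real.log_le_sub_one_of_pos (show 0 < 2 / (1 + Real.cos θ ^ 2) by positivity)
    have h2 : 2 / (1 + Real.cos θ ^ 2) ≤ 2 := by
      rw [div_le_iff₀ hpos]
      nlinarith [sq_nonneg (Real.cos θ)]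
    linarith

/-- Combining the factors of the runtime bound. -/
theorem le_gapBound {θ K T c r P t : ℝ} {n g N : ℕ} {Δ δ q : ℝ} (hX : 0 ≤ angleFactor θ n)
    (hd : 0 < Δ / (4 * (g : ℝ) ^ 2)) (hδ : 1 / 2 ≤ Real.log δ⁻¹) (hc : 0 ≤ c) (hP : 0 ≤ P)
    (hPq : P = (2 / (1 + Real.cos θ)) ^ ((n : ℝ) / q)) (hr0 : 0 ≤ r)
    (hr : r ≤ 17 * t) (hN : (N : ℝ) ≤ K * Real.log n)
    (hT : T ≤ c * r * (angleFactor θ n / (Δ / (4 * (g : ℝ) ^ 2)) * ((8 * N : ℕ) : ℝ)) * P) :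
    T ≤ 272 * c * K * gapBound θ n Δ g δ q t := by
  refine hT.trans ?_
  rw [gapBound, ← hPq]
  change _ ≤ 272 * c * K * (Real.log n * (angleFactor θ n / _) * _ * _ * _)
  set x := angleFactor θ n / (Δ / (4 * (g : ℝ) ^ 2)) with hx
  have hx0 : 0 ≤ x := div_nonneg hX hd.le
  have ht0 : 0 ≤ t := by linarith
  have hKn : 0 ≤ K * Real.log n := (Nat.cast_nonneg N).trans hN
  push_cast
  -- The constant is `272 = 17 · 8 · 2`. The factor `ln δ⁻¹ ≥ 1/2` is only inserted at the price of
  -- the `2`; the estimate holds without it.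
  calc c * r * (x * (8 * N)) * P ≤ c * (17 * t) * (x * (8 * (K * Real.log n))) * P := by gcongr
    _ = (272 * c * t * x * (K * Real.log n) * P) * (1 / 2) := by ring
    _ ≤ (272 * c * t * x * (K * Real.log n) * P) * Real.log δ⁻¹ :=
        mul_le_mul_of_nonneg_left hδ (by positivity)
    _ = 272 * c * K * (Real.log n * x * Real.log δ⁻¹ * P * t) := by ring

/-- A geometric sum is dominated by its last term, with a factor `y/(y - 1)` that decreases in `y`
and is thus controlled by `y₀`. -/
theorem sum_pow_succ_le {y y₀ : ℝ} (h0 : 1 < y₀) (h : y₀ ≤ y) (n : ℕ) :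
    ∑ k ∈ Finset.range n, y ^ (k + 1) ≤ y₀ / (y₀ - 1) * y ^ n := by
  have hy : 1 < y := h0.trans_le h
  have h1 : y / (y - 1) ≤ y₀ / (y₀ - 1) := by
    rw [div_le_div_iff₀ (by linarith) (by linarith)]
    linarith
  refine le_trans ?_ (mul_le_mul_of_nonneg_right h1 (by positivity))
  rw [div_mul_eq_mul_div, le_div_iff₀ (by linarith)]
  have h2 := geom_sum_mul y n
  calc (∑ k ∈ Finset.range n, y ^ (k + 1)) * (y - 1)
      = y * ((∑ k ∈ Finset.range n, y ^ k) * (y - 1)) := by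
        rw [← mul_assoc, Finset.mul_sum]
        simp only [pow_succ']
    _ = y * (y ^ n - 1) := by rw [h2]
    _ ≤ y * y ^ n := by
        refine mul_le_mul_of_nonneg_left ?_ (by linarith)
        linarith

theorem gapScale_le_one {Δ : ℝ} {g : ℕ} (hΔ1 : Δ ≤ 1) (hg : 1 ≤ g) :
    Δ / (4 * (g : ℝ) ^ 2) ≤ 1 := by
  have hg1 : (1 : ℝ) ≤ g := by exact_mod_cast hg
  rw [div_le_one (by positivity)]
  nlinarith

theorem Mode.q_pos (mode : Mode) : 0 < mode.q := by
  cases mode <;> norm_num [Mode.q]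

theorem Mode.q_le_two (mode : Mode) : mode.q ≤ 2 := by
  cases mode <;> norm_num [Mode.q]

/-- The failure probability is split evenly: `δ/2` for running out of time and `δ/2`, that is
`δ/(2n)` per qubit, for a wrong vote. -/
theorem uniqueSolver_runtime (K : ℝ) {n N : ℕ} {F : Fin N → Fin n → Fin 3} (hn : 3 ≤ n)
    (hF : IsPerfectHashFamily F) (hN : (N : ℝ) ≤ K * Real.log n) (mode : Mode) {θ : ℝ}
    (hθ0 : 0 < θ) (hθ1 : θ ≤ Real.pi / 2) {φ : Formula n} (hne : φ ≠ []) (hφ : IsKSat 3 φ)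
    (hsat : ∃! x, Sat φ x) {g : ℕ} (hg : 1 ≤ g) (hgφ : NoncommBound θ φ g) {δ : ℝ} (hδ : 0 < δ)
    (hδ1 : δ ≤ 1 / 2) :
    ∃ T : ℕ, (T : ℝ) ≤ 272 * 96240 * K *
        gapBound θ n (uniformGap θ φ) g δ mode.q (tUnique θ n δ) ∧
      1 - δ ≤ successProb (uniqueSolver mode θ (δ / 2) (layerStrings F) φ) T (Sat φ) := by
  classical
  have hs := sin_pos_of_angle hθ0 hθ1
  have hc := cos_half_pos hθ0 hθ1
  obtain ⟨x₀, hx₀, huniq⟩ := hsat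
  have hadm := admissible_layerStrings hn hF hφ ⟨x₀, hx₀⟩ hgφ
  have hΔ := uniformGap_pos θ hne ⟨x₀, hx₀⟩
  have hΔ1 := uniformGap_le_one θ hne ⟨x₀, hx₀⟩
  set Δ := uniformGap θ φ
  have hg0 : (0 : ℝ) < g := by exact_mod_cast hg
  have hd : 0 < Δ / (4 * (g : ℝ) ^ 2) := by positivity
  have hd1 := gapScale_le_one hΔ1 hg
  have hΛ : 1 ≤ 8 * N := by have := one_le_of_isPerfectHashFamily hn hF; omega
  set κ : ℝ := (1 - 1 / Real.sqrt 2) ^ 2 / 8 with hκdef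
  have hsq : (1.4 : ℝ) ≤ Real.sqrt 2 := Real.le_sqrt_of_sq_le (by norm_num)
  have hinv : 1 / Real.sqrt 2 ≤ 0.715 := by
    rw [div_le_iff₀ (by positivity)]
    linarith
  have hinv0 : 0 < 1 / Real.sqrt 2 := by positivity
  -- Since `1/√2 ≤ 0.715`, the constant is at least `0.285² / 8 > 0.01`.
  have hκ : 1 / 100 ≤ κ := by rw [hκdef]; nlinarith
  have hκ8 : κ ≤ 1 / 8 := by rw [hκdef]; nlinarith
  have hκ1 : κ ≤ 1 := by linarith
  have hκ0 : 0 < κ := by linarith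
  set R : ℕ := ⌈2 * Real.log (n / (δ / 2)) / Real.log (2 / (1 + Real.cos θ ^ 2))⌉₊ with hR
  obtain ⟨hl0, hl1⟩ := readout_rate_bounds θ
  obtain ⟨hb1, hb2, hb3⟩ := log_bounds hn hδ hδ1
  set l := Real.log (2 / (1 + Real.cos θ ^ 2)) with hl
  have hlpos : 0 < l := lt_of_lt_of_le (by positivity) hl0
  have hn3 : (3 : ℝ) ≤ n := by exact_mod_cast hn
  have hnδ : 0 < n / δ := by positivity
  have hnδ' : (n : ℝ) / (δ / 2) = 2 * (n / δ) := by field_simp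
  have hlog2 : Real.log (n / (δ / 2)) ≤ 2 * Real.log (n / δ) :=
    (Real.log_le_log (by positivity) (by rw [hnδ']; linarith)).trans hb2
  have hlog1 : Real.log (n / δ) ≤ Real.log (n / (δ / 2)) :=
    Real.log_le_log hnδ (by rw [hnδ']; linarith)
  have hRlow : 2 * Real.log (n / (δ / 2)) / l ≤ R := Nat.le_ceil _
  have hRhigh : (R : ℝ) ≤ 17 * tUnique θ n δ := by
    have h1 : (R : ℝ) ≤ 2 * Real.log (n / (δ / 2)) / l + 1 :=
      (Nat.ceil_lt_add_one (by have : 0 ≤ Real.log (n / (δ / 2)) := by linarith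
                               positivity)).le
    rw [tUnique, ← hl]
    have h2 : 2 * Real.log (n / (δ / 2)) / l ≤ 2 * (2 * Real.log (n / δ)) / l := by gcongr
    have h3 : 1 ≤ Real.log (n / δ) / l := (one_le_div hlpos).mpr (hl1.trans hb1)
    have h4 : 2 * (2 * Real.log (n / δ)) / l = 4 * (Real.log (n / δ) / l) := by ring
    linarith
  have hR2 : 2 * Real.log (n / (δ / 2)) ≤ R :=
    (le_div_self (by linarith) hlpos hl1).trans hRlow
  have hR1 : 1 ≤ R := by
    have : (1 : ℝ) ≤ R := by linarith
    exact_mod_cast this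
  have hA : Real.log (2 / δ) ≤ R := by
    have : Real.log (2 / δ) ≤ Real.log (n / (δ / 2)) := by
      refine Real.log_le_log (by positivity) ?_
      rw [hnδ', ← mul_div_assoc]
      gcongr
      linarith
    linarith
  have hA0 : 0 ≤ Real.log (2 / δ) := Real.log_nonneg (by rw [one_le_div hδ]; linarith)
  have hp := attemptProb_pos hc mode n
  have hp1 := attemptProb_le_one hc mode n
  -- The choice `A = ln(2/δ)` makes the probability of too few trials at most `exp(-A) = δ/2`.
  set m := attemptCount (attemptProb θ mode n) (Real.log (2 / δ)) R with hm
  set D := attemptCost θ (Δ / (4 * (g : ℝ) ^ 2)) (κ * Real.sin θ ^ 2) (8 * N) mode n with hD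
  refine ⟨m * D + R, ?_, ?_⟩
  · have hcost := copies_cost_le hs hc hκ hκ1 hd hd1 hΛ mode le_rfl hn hR1 hA0 hA
    refine le_gapBound (angleFactor_nonneg hs hc n) hd hb3 (by norm_num) ?_ rfl
      (Nat.cast_nonneg R) hRhigh hN hcost
    refine Real.rpow_nonneg (div_nonneg zero_le_two ?_) _
    linarith [Real.neg_one_le_cos θ]
  · refine le_successProb _ _ _ hδ.le ?_
    have hspec := hadm.attemptSpec hΔ hΔ1 hg hs hc hκ0 hκ1 (length_layerStrings F) mode
    have hprep := prepSpec_prepare hspec (one_le_attemptCost hs hc hκ0 hκ1 hd hΛ mode n) hp1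
    have hmaj := loss_majority_le hs (ε := κ * Real.sin θ ^ 2) (by positivity)
      (by nlinarith [sq_nonneg (Real.sin θ)]) hx₀ huniq hprep hp1 R m (m * D + R) le_rfl
    refine hmaj.trans (ENNReal.ofReal_le_ofReal ?_)
    have h1 : 2 ^ R * (1 - attemptProb θ mode n / 2) ^ m ≤ δ / 2 := by
      refine (two_pow_mul_pow_le hp hp1 (Nat.le_ceil _)).trans (le_of_eq ?_)
      rw [← Real.log_inv, inv_div, Real.exp_log (by positivity)]
    have h2 : momentFactor θ ^ R ≤ δ / 2 / n := by
      refine momentFactor_pow_le (by positivity) ?_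
      rw [inv_div, ← hl]
      rw [div_le_iff₀ hlpos] at hRlow
      linarith
    have h3 : n * momentFactor θ ^ R ≤ δ / 2 := by
      rw [le_div_iff₀ (by linarith)] at h2
      linarith
    linarith

/-- Each variable may fail with probability `δ/n`. Of this, `δ/(2n)` goes to the time budget and
`δ/(4n)` to the readout, leaving some slack. -/
theorem multipleSolver_runtime (K : ℝ) {θ₀ : ℝ} (hθ₀ : 0 < θ₀) {n N : ℕ}
    {F : Fin N → Fin n → Fin 3} (hn : 3 ≤ n)
    (hF : IsPerfectHashFamily F) (hN : (N : ℝ) ≤ K * Real.log n) (mode : Mode) {θ : ℝ}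
    (hθ0 : θ₀ ≤ θ) (hθ1 : θ ≤ Real.pi / 2) {φ : Formula n} (hne : φ ≠ []) (hφ : IsKSat 3 φ)
    (hsat : ∃ x, Sat φ x) {g : ℕ} (hg : 1 ≤ g) (hgφ : NoncommBound θ φ g) {δ : ℝ} (hδ : 0 < δ)
    (hδ1 : δ ≤ 1 / 2) :
    ∃ T : ℕ, (T : ℝ) ≤ 272 * (96240 * ((2 / (1 + Real.cos θ₀)) ^ (1 / 2 : ℝ) /
          ((2 / (1 + Real.cos θ₀)) ^ (1 / 2 : ℝ) - 1))) * K *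
        gapBound θ n (uniformGap θ φ) g δ mode.q (tMultiple θ n δ) ∧
      1 - δ ≤ successProb (multipleSolver mode θ (δ / 2) (layerStrings F) φ) T (Sat φ) := by
  classical
  have hθpos : 0 < θ := hθ₀.trans_le hθ0
  have hs := sin_pos_of_angle hθpos hθ1
  have hs1 := Real.sin_le_one θ
  have hc := cos_half_pos hθpos hθ1
  have hadm := admissible_layerStrings hn hF hφ hsat hgφ
  have hΔ := uniformGap_pos θ hne hsat
  have hΔ1 := uniformGap_le_one θ hne hsat
  set Δ := uniformGap θ φ
  have hg0 : (0 : ℝ) < g := by exact_mod_cast hg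
  have hd : 0 < Δ / (4 * (g : ℝ) ^ 2) := by positivity
  have hd1 := gapScale_le_one hΔ1 hg
  have hΛ : 1 ≤ 8 * N := by have := one_le_of_isPerfectHashFamily hn hF; omega
  have hε : Real.sin θ ^ 2 / 8 = 1 / 8 * Real.sin θ ^ 2 := by ring
  set r : ℕ := ⌈8 * Real.log (2 * n / (δ / 2)) / Real.sin θ ^ 2⌉₊ with hr
  obtain ⟨hl0, -⟩ := readout_rate_bounds θ
  obtain ⟨hb1, hb2, hb3⟩ := log_bounds hn hδ hδ1
  have hn3 : (3 : ℝ) ≤ n := by exact_mod_cast hn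
  have hnδ : 0 < n / δ := by positivity
  have hnδ' : 2 * (n : ℝ) / (δ / 2) = 4 * (n / δ) := by field_simp; norm_num
  rw [hnδ'] at hr
  have hs2 : 0 < Real.sin θ ^ 2 := by positivity
  have hs21 : Real.sin θ ^ 2 ≤ 1 := pow_le_one₀ hs.le hs1
  have hlog1 : Real.log (n / δ) ≤ Real.log (4 * (n / δ)) :=
    Real.log_le_log hnδ (by linarith)
  have hrlow : 8 * Real.log (4 * (n / δ)) / Real.sin θ ^ 2 ≤ r := hr ▸ Nat.le_ceil _
  -- Here `17 = 8 · 2 + 1`: the `2` from `ln(4n/δ) ≤ 2 ln(n/δ)`, the `1` from rounding up.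
  have hrhigh : (r : ℝ) ≤ 17 * tMultiple θ n δ := by
    have h1 : (r : ℝ) ≤ 8 * Real.log (4 * (n / δ)) / Real.sin θ ^ 2 + 1 := by
      rw [hr]
      exact (Nat.ceil_lt_add_one (by have : 0 ≤ Real.log (4 * (n / δ)) := by linarith
                                     positivity)).le
    rw [tMultiple]
    have h2 : 8 * Real.log (4 * (n / δ)) / Real.sin θ ^ 2 ≤
        8 * (2 * Real.log (n / δ)) / Real.sin θ ^ 2 := by gcongr
    have h3 : 1 ≤ Real.log (n / δ) / Real.sin θ ^ 2 := (one_le_div hs2).mpr (hs21.trans hb1)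
    have h4 : 8 * (2 * Real.log (n / δ)) / Real.sin θ ^ 2 =
      16 * (Real.log (n / δ) / Real.sin θ ^ 2) := by ring
    linarith
  have hr2 : 8 * Real.log (4 * (n / δ)) ≤ r :=
    (le_div_self (by linarith) hs2 hs21).trans hrlow
  have hr1 : 1 ≤ r := by
    have : (1 : ℝ) ≤ r := by linarith
    exact_mod_cast this
  have hA : Real.log (2 * (n / δ)) ≤ r := by
    have : Real.log (2 * (n / δ)) ≤ Real.log (4 * (n / δ)) :=
      Real.log_le_log (by positivity) (by linarith)
    linarith
  have hA0 : 0 ≤ Real.log (2 * (n / δ)) :=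
    (zero_le_one.trans hb1).trans (Real.log_le_log hnδ (by linarith))
  set D := attemptCost θ (Δ / (4 * (g : ℝ) ^ 2)) (1 / 8 * Real.sin θ ^ 2) (8 * N) mode with hD
  set m : ℕ → ℕ := fun k => attemptCount (attemptProb θ mode k) (Real.log (2 * (n / δ))) r with hm
  refine ⟨∑ k ∈ Finset.range n, (m (k + 1) * D (k + 1) + r), ?_, ?_⟩
  -- The exponent `1/2` is the smaller of the two values of `1/q`, so `y₀` bounds the ratio of the
  -- geometric sum from below in both versions and for all `θ ≥ θ₀`.
  · set y₀ := (2 / (1 + Real.cos θ₀)) ^ (1 / 2 : ℝ) with hy₀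
    set y := (2 / (1 + Real.cos θ)) ^ (1 / mode.q) with hy
    have hcos : 0 ≤ Real.cos θ :=
      Real.cos_nonneg_of_mem_Icc ⟨by linarith [Real.pi_pos], hθ1⟩
    have hcosle : Real.cos θ ≤ Real.cos θ₀ :=
      Real.cos_le_cos_of_nonneg_of_le_pi hθ₀.le (by linarith [Real.pi_pos]) hθ0
    have hcos1 : Real.cos θ₀ < 1 := by
      have := Real.cos_lt_cos_of_nonneg_of_le_pi le_rfl
        (show θ₀ ≤ Real.pi by linarith [Real.pi_pos]) hθ₀
      rwa [Real.cos_zero] at this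
    have ha₀ : 1 < 2 / (1 + Real.cos θ₀) := by
      rw [one_lt_div (by linarith)]
      linarith
    have ha : 2 / (1 + Real.cos θ₀) ≤ 2 / (1 + Real.cos θ) := by gcongr
    have hy₀1 : 1 < y₀ := Real.one_lt_rpow ha₀ (by norm_num)
    have hyy : y₀ ≤ y := by
      refine (Real.rpow_le_rpow (by linarith) ha (by norm_num)).trans ?_
      refine Real.rpow_le_rpow_of_exponent_le (ha₀.le.trans ha) ?_
      exact one_div_le_one_div_of_le mode.q_pos mode.q_le_two
    have hpow : ∀ k : ℕ, (2 / (1 + Real.cos θ)) ^ ((k : ℝ) / mode.q) = y ^ k := by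
      intro k
      rw [hy, ← Real.rpow_natCast, ← Real.rpow_mul (by positivity)]
      congr 1
      ring
    have hG : 0 ≤ y₀ / (y₀ - 1) := div_nonneg (by linarith) (by linarith)
    have hX := angleFactor_nonneg hs hc n
    refine le_gapBound (P := (2 / (1 + Real.cos θ)) ^ ((n : ℝ) / mode.q)) hX hd hb3
      (by positivity) (by positivity) rfl (Nat.cast_nonneg r) hrhigh hN ?_
    rw [hpow]
    set Q := angleFactor θ n / (Δ / (4 * (g : ℝ) ^ 2)) * ((8 * N : ℕ) : ℝ) with hQ
    have hQ0 : 0 ≤ Q := by positivity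
    calc ((∑ k ∈ Finset.range n, (m (k + 1) * D (k + 1) + r) : ℕ) : ℝ)
        = ∑ k ∈ Finset.range n, ((m (k + 1) * D (k + 1) + r : ℕ) : ℝ) := Nat.cast_sum _ _
      _ ≤ ∑ k ∈ Finset.range n, 96240 * r * Q * y ^ (k + 1) := by
          refine Finset.sum_le_sum fun k hk => ?_
          rw [← hpow]
          exact copies_cost_le hs hc (by norm_num) (by norm_num) hd hd1 hΛ mode
            (Finset.mem_range.mp hk) hn hr1 hA0 hA
      _ = 96240 * r * Q * ∑ k ∈ Finset.range n, y ^ (k + 1) := by rw [Finset.mul_sum]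
      _ ≤ 96240 * r * Q * (y₀ / (y₀ - 1) * y ^ n) :=
          mul_le_mul_of_nonneg_left (sum_pow_succ_le hy₀1 hyy n) (by positivity)
      _ = 96240 * (y₀ / (y₀ - 1)) * r * Q * y ^ n := by ring
  · refine le_successProb _ _ _ hδ.le ?_
    have hη : ∀ k, 1 ≤ k → 2 ^ r * (1 - attemptProb θ mode k / 2) ^ m k + momentFactor θ ^ r ≤
        δ / n := by
      intro k _
      have h1 : 2 ^ r * (1 - attemptProb θ mode k / 2) ^ m k ≤ (2 * (n / δ))⁻¹ := by
        refine (two_pow_mul_pow_le (attemptProb_pos hc mode k) (attemptProb_le_one hc mode k)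
          (Nat.le_ceil _)).trans (le_of_eq ?_)
        rw [← Real.log_inv, Real.exp_log (by positivity)]
      have h2 : momentFactor θ ^ r ≤ (4 * (n / δ))⁻¹ := by
        refine momentFactor_pow_le (by positivity) ?_
        rw [inv_inv]
        have h3 : (r : ℝ) * (Real.sin θ ^ 2 / 2 / 2) ≤
            r * (Real.log (2 / (1 + Real.cos θ ^ 2)) / 2) := by gcongr
        rw [div_le_iff₀ hs2] at hrlow
        linarith
      have h3 : (2 * ((n : ℝ) / δ))⁻¹ + (4 * (n / δ))⁻¹ = 3 / 4 * (δ / n) := by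
        field_simp
        norm_num
      have h4 : 0 ≤ δ / n := by positivity
      linarith
    have hloop := loss_multipleLoop_le (Δ := Δ) (g := g) (Λ := 8 * N) (r := r) (mode := mode)
      (ε := 1 / 8 * Real.sin θ ^ 2) (D := D) (m := m) (p := attemptProb θ mode) hs
      (by positivity) (by linarith) hr1
      (fun k B ψ _ hB h => h.attemptSpec hΔ hΔ1 hg hs hc (by norm_num) (by norm_num) hB mode)
      (one_le_attemptCost hs hc (by norm_num) (by norm_num) hd hΛ mode)
      (attemptProb_le_one hc mode) (η := δ / n) (by positivity) hη n (layerStrings F) φ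
      (length_layerStrings F) hadm _ le_rfl
    rw [multipleSolver, hε, hnδ', ← hr]
    refine hloop.trans (ENNReal.ofReal_le_ofReal (le_of_eq ?_))
    field_simp

end QSat

end

/-! ### The runtime theorem -/

theorem mainTheorem10 :
    -- perfect hash families of logarithmic size
    (∃ K : ℝ, ∀ n : ℕ, 3 ≤ n → ∃ (N : ℕ) (F : Fin N → Fin n → Fin 3),
      QSat.IsPerfectHashFamily F ∧ (N : ℝ) ≤ K * Real.log n) ∧
    -- possibly many satisfying assignments
    (∀ K θ₀ : ℝ, 0 < θ₀ → ∃ C : ℝ, ∀ (n N : ℕ) (F : Fin N → Fin n → Fin 3),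
      3 ≤ n → QSat.IsPerfectHashFamily F → (N : ℝ) ≤ K * Real.log n →
      ∀ (m : QSat.Mode) (θ : ℝ), θ₀ ≤ θ → θ ≤ Real.pi / 2 →
      ∀ φ : QSat.Formula n, φ ≠ [] → QSat.IsKSat 3 φ → (∃ x, QSat.Sat φ x) →
      ∀ g : ℕ, 1 ≤ g → QSat.NoncommBound θ φ g →
      ∀ δ : ℝ, 0 < δ → δ ≤ 1 / 2 →
      ∃ T : ℕ,
        (T : ℝ) ≤ C * QSat.gapBound θ n (QSat.uniformGap θ φ) g δ m.q (QSat.tMultiple θ n δ) ∧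
        1 - δ ≤ QSat.successProb
          (QSat.multipleSolver m θ (δ / 2) (QSat.layerStrings F) φ) T (QSat.Sat φ)) ∧
    -- exactly one satisfying assignment
    (∀ K : ℝ, ∃ C : ℝ, ∀ (n N : ℕ) (F : Fin N → Fin n → Fin 3),
      3 ≤ n → QSat.IsPerfectHashFamily F → (N : ℝ) ≤ K * Real.log n →
      ∀ (m : QSat.Mode) (θ : ℝ), 0 < θ → θ ≤ Real.pi / 2 →
      ∀ φ : QSat.Formula n, φ ≠ [] → QSat.IsKSat 3 φ → (∃! x, QSat.Sat φ x) →
      ∀ g : ℕ, 1 ≤ g → QSat.NoncommBound θ φ g →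
      ∀ δ : ℝ, 0 < δ → δ ≤ 1 / 2 →
      ∃ T : ℕ,
        (T : ℝ) ≤ C * QSat.gapBound θ n (QSat.uniformGap θ φ) g δ m.q (QSat.tUnique θ n δ) ∧
        1 - δ ≤ QSat.successProb
          (QSat.uniqueSolver m θ (δ / 2) (QSat.layerStrings F) φ) T (QSat.Sat φ)) := by
  refine ⟨QSat.exists_perfectHashFamily, fun K θ₀ hθ₀ =>
    ⟨272 * (96240 * ((2 / (1 + Real.cos θ₀)) ^ (1 / 2 : ℝ) /
      ((2 / (1 + Real.cos θ₀)) ^ (1 / 2 : ℝ) - 1))) * K, ?_⟩, fun K => ⟨272 * 96240 * K, ?_⟩⟩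
  · intro n N F hn hF hN m θ h0 h1 φ hne hφ hsat g hg hgφ δ hδ hδ1
    exact QSat.multipleSolver_runtime K hθ₀ hn hF hN m h0 h1 hne hφ hsat hg hgφ hδ hδ1
  · intro n N F hn hF hN m θ h0 h1 φ hne hφ hsat g hg hgφ δ hδ hδ1
    exact QSat.uniqueSolver_runtime K hn hF hN m h0 h1 hne hφ hsat hg hgφ hδ hδ1
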